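/- For $n\ge 0$ let $B_n$ be the braid group on $n$ strands with standard generators $\sigma_1,\dots,\sigma_{n-1}$ ($B_0$ and $B_1$ are trivial), and for $m\le n$ regard $B_m$ as mapped to $B_n$ by the standard homomorphism $\sigma_i\mapsto\sigma_i$. For $1\le r\le n$ put $[1,r]=\sigma_1\sigma_2\cdots\sigma_{r-1}\in B_n$, with $[1,1]=1$. For $\beta\in B_n$ let $\widehat{\beta}$ denote the oriented link in $\mathbb{R}^3$ that is the standard closure of $\beta$; equality of links means ambient isotopy respecting orientations. For a list of pairs of integers $(r_1,s_1),\dots,(r_k,s_k)$ with $k\ge 1$ let $T((r_1,s_1),\dots,(r_k,s_k))$ be the closure of the braid $[1,r_1]^{s_1}[1,r_2]^{s_2}\cdots[1,r_k]^{s_k}\in B_{r_k}$; it is a T-link when $2\le r_1\le r_2\le\dots\le r_k$ and all $s_i>0$. (1) Let $a\le s\le r$ be natural numbers with $s\mid r$, and let $\gamma\in B_a$. Then $$\widehat{\gamma\,[1,r]^{s}}=\widehat{\gamma\,[1,s]^{r}},$$ where $\gamma\,[1,r]^s\in B_r$ and $\gamma\,[1,s]^r\in B_s$. (If $s=0$,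 then $a=r=0$ and both braids are the trivial element of $B_0$, whose closure is the empty link.) (2) Let $k\ge1$, $2\le r_1\le\dots\le r_k$ and $s_1,\dots,s_k>0$. If $s_k\le r_k$, $s_k\mid r_k$ and, in case $k\ge2$, $r_{k-1}\le s_k$, then $$T((r_1,s_1),\dots,(r_{k-1},s_{k-1}),(r_k,s_k))=T((r_1,s_1),\dots,(r_{k-1},s_{k-1}),(s_k,r_k)).$$ -/

import Mathlib

/-! ### Oriented links in Euclidean 3-space and ambient isotopy -/

/-- An oriented link in `ℝ³`: finitely many disjoint simple closed curves, each parametrised by `ℝ`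
with period `1` (`t` and `u` give the same point only if they differ by an integer) in the positive
direction. -/
structure OrientedLink where
  ι : Type
  finite_ι : Finite ι
  curve : ι → ℝ → EuclideanSpace ℝ (Fin 3)
  continuous_curve : ∀ i, Continuous (curve i)
  curve_eq_iff : ∀ i j t u, curve i t = curve j u ↔ i = j ∧ ∃ m : ℤ, t = u + m

/-- Two oriented links are the same if an ambient isotopy of `ℝ³` carries the components of the
first bijectively to those of the second, respecting the orientations (the reparametrisations `φ`
are increasing). -/
def OrientedLink.Isotopic (L L' : OrientedLink) : Prop :=
  ∃ H : unitInterval → (EuclideanSpace ℝ (Fin 3) ≃ₜ EuclideanSpace ℝ (Fin 3)),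
    Continuous (fun p : unitInterval × EuclideanSpace ℝ (Fin 3) => H p.1 p.2) ∧
    (∀ x, H 0 x = x) ∧
    ∃ e : L.ι ≃ L'.ι, ∀ i, ∃ φ : ℝ ≃o ℝ, ∀ t, H 1 (L.curve i t) = L'.curve (e i) (φ t)

/-! ### Braid groups -/

/-- The braid relations among `σ_1, …, σ_{n-1}`; the index `i : Fin (n - 1)` stands for
`σ_{i+1}`. -/
def braidRels (n : ℕ) : Set (FreeGroup (Fin (n - 1))) :=
  {x | ∃ i j : Fin (n - 1), (i : ℕ) + 2 ≤ j ∧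
      x = FreeGroup.of i * FreeGroup.of j * (FreeGroup.of j * FreeGroup.of i)⁻¹} ∪
  {x | ∃ i j : Fin (n - 1), (i : ℕ) + 1 = j ∧
      x = FreeGroup.of i * FreeGroup.of j * FreeGroup.of i *
        (FreeGroup.of j * FreeGroup.of i * FreeGroup.of j)⁻¹}

/-- The braid group `B_n` on `n` strands. -/
abbrev BraidGroup (n : ℕ) : Type := PresentedGroup (braidRels n)

/-- The standard generator `σ_i` of `B_n`, for `1 ≤ i < n` (and `1` for other values of `i`). -/
def braidSigma (n i : ℕ) : BraidGroup n :=
  if h : 1 ≤ i ∧ i < n then PresentedGroup.of ⟨i - 1, by omega⟩ else 1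

/-- `[a,b] = σ_a σ_{a+1} ⋯ σ_{b-1}` in `B_n`, for `a ≤ b`; in particular `[a,a] = 1`. -/
def braidBracket (n a b : ℕ) : BraidGroup n :=
  ((List.range' a (b - a)).map (braidSigma n)).prod

/-- The standard inclusion `B_m → B_n`, `σ_i ↦ σ_i`, for `m ≤ n`. -/
def braidIncl {m n : ℕ} (h : m ≤ n) : BraidGroup m →* BraidGroup n :=
  PresentedGroup.toGroup (rels := braidRels m)
    (f := fun i => PresentedGroup.of (Fin.castLE (Nat.sub_le_sub_right h 1) i)) (by
      rintro x (⟨i, j, hij, rfl⟩ | ⟨i, j, hij, rfl⟩)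
      · have := PresentedGroup.one_of_mem (rels := braidRels n)
          (Or.inl ⟨Fin.castLE (Nat.sub_le_sub_right h 1) i,
            Fin.castLE (Nat.sub_le_sub_right h 1) j, by simpa using hij, rfl⟩)
        simpa [PresentedGroup.of] using this
      · have := PresentedGroup.one_of_mem (rels := braidRels n)
          (Or.inr ⟨Fin.castLE (Nat.sub_le_sub_right h 1) i,
            Fin.castLE (Nat.sub_le_sub_right h 1) j, by simpa using hij, rfl⟩)
        simpa [PresentedGroup.of] using this)

/-- A braid word on `n` strands: a list of letters, `(i, true)` standing for `σ_{i+1}` and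
`(i, false)` for its inverse. -/
abbrev BraidWord (n : ℕ) : Type := List (Fin (n - 1) × Bool)

/-- The element of `B_n` that a braid word represents. -/
def BraidWord.toBraid {n : ℕ} (w : BraidWord n) : BraidGroup n :=
  PresentedGroup.mk (braidRels n) (FreeGroup.mk w)

theorem BraidWord.toBraid_surjective (n : ℕ) :
    Function.Surjective (BraidWord.toBraid (n := n)) := by
  intro β
  obtain ⟨x, rfl⟩ := PresentedGroup.mk_surjective (braidRels n) β
  exact ⟨x.toWord, by simp [BraidWord.toBraid, FreeGroup.mk_toWord]⟩

/-! ### Geometric braids: paths of configurations of `n` labelled distinct points of the plane -/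

/-- Configurations of `n` labelled distinct points of the plane. -/
def Conf (n : ℕ) : Type := {x : Fin n → ℂ // Function.Injective x}

noncomputable instance (n : ℕ) : TopologicalSpace (Conf n) := instTopologicalSpaceSubtype

/-- Relabel the points of a configuration. -/
noncomputable def Conf.permute {n : ℕ} (π : Equiv.Perm (Fin n)) (x : Conf n) : Conf n :=
  ⟨x.1 ∘ π, x.2.comp π.injective⟩

theorem Conf.continuous_permute {n : ℕ} (π : Equiv.Perm (Fin n)) :
    Continuous (Conf.permute π) := by
  refine Continuous.subtype_mk ?_ _
  exact continuous_pi fun j => (continuous_apply (π j)).comp continuous_subtype_val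

/-- The base configuration: the point `j` of the real axis, for `0 ≤ j < n`. -/
noncomputable def Conf.base (n : ℕ) : Conf n :=
  ⟨fun j => ((j : ℕ) : ℂ), fun _ _ h => Fin.ext (Nat.cast_injective h)⟩

/-- The transposition of the two positions that a letter exchanges. -/
def letterPerm {n : ℕ} (i : Fin (n - 1)) : Equiv.Perm (Fin n) :=
  Equiv.swap ⟨i, by omega⟩ ⟨i + 1, by omega⟩

/-- At time `t` of the half twist at `i`, the position of the point that started at `j`: the points
`i` and `i + 1` have turned about their midpoint by the angle `π t`, counterclockwise for a
generator and clockwise for its inverse; all others stay. -/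
noncomputable def halfTwist (i : ℕ) (ε : Bool) (t : ℝ) (j : ℕ) : ℂ :=
  if j = i ∨ j = i + 1 then
    ((i : ℂ) + 1 / 2) +
      Complex.exp ((if ε then 1 else -1) * Real.pi * t * Complex.I) * ((j : ℂ) - ((i : ℂ) + 1 / 2))
  else (j : ℂ)

theorem halfTwist_injective (i : ℕ) (ε : Bool) (t : ℝ) : Function.Injective (halfTwist i ε t) := by
  have hn : ‖Complex.exp ((if ε then 1 else -1) * Real.pi * t * Complex.I)‖ = 1 := by
    have : ((if ε then 1 else -1) * Real.pi * t * Complex.I : ℂ)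
        = (((if ε then 1 else -1) * Real.pi * t : ℝ) : ℂ) * Complex.I := by
      push_cast; split_ifs <;> simp
    rw [this, Complex.norm_exp_ofReal_mul_I]
  -- the midpoint of the twisting points has distance 1/2 to these, and more to all others
  have hin : ∀ j : ℕ, (j = i ∨ j = i + 1) → ‖halfTwist i ε t j - ((i : ℂ) + 1 / 2)‖ = 1 / 2 := by
    intro j hj
    rw [halfTwist, if_pos hj, add_sub_cancel_left, norm_mul, hn, one_mul]
    rcases hj with rfl | rfl
    · norm_num
    · push_cast; ring_nf; norm_num
  have hout : ∀ j : ℕ, ¬ (j = i ∨ j = i + 1) →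
      1 / 2 < ‖halfTwist i ε t j - ((i : ℂ) + 1 / 2)‖ := by
    intro j hj
    rw [halfTwist, if_neg hj]
    have : ((j : ℂ) - ((i : ℂ) + 1 / 2)) = (((j : ℝ) - (i + 1 / 2) : ℝ) : ℂ) := by push_cast; ring
    rw [this, Complex.norm_real, Real.norm_eq_abs, lt_abs]
    rcases Nat.lt_or_ge j i with h | h
    · right
      have : (j : ℝ) + 1 ≤ i := by exact_mod_cast h
      linarith
    · left
      have : (i : ℝ) + 2 ≤ j := by exact_mod_cast (by omega : i + 2 ≤ j)
      linarith
  intro j k hjk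
  by_cases hj : j = i ∨ j = i + 1 <;> by_cases hk : k = i ∨ k = i + 1
  · rw [halfTwist, halfTwist, if_pos hj, if_pos hk] at hjk
    have h1 := mul_left_cancel₀ (Complex.exp_ne_zero _) (add_left_cancel hjk)
    exact_mod_cast sub_left_injective h1
  · exact absurd (hjk ▸ hin j hj) (hout k hk).ne'
  · exact absurd (hjk ▸ hin k hk) (hjk ▸ (hout j hj).ne')
  · rwa [halfTwist, halfTwist, if_neg hj, if_neg hk, Nat.cast_inj] at hjk

/-- The elementary geometric braid of a letter: the path `t ↦ halfTwist i ε t`. -/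
noncomputable def letterPath {n : ℕ} (l : Fin (n - 1) × Bool) :
    Path (Conf.base n) (Conf.permute (letterPerm l.1) (Conf.base n)) where
  toFun t := ⟨fun j => halfTwist l.1 l.2 t j,
    fun _ _ h => Fin.ext (halfTwist_injective l.1 l.2 t h)⟩
  continuous_toFun := by
    refine Continuous.subtype_mk (continuous_pi fun j => ?_) _
    unfold halfTwist
    split_ifs <;> fun_prop
  source' := by
    refine Subtype.ext (funext fun j => ?_)
    simp [halfTwist, Conf.base]
  target' := by
    refine Subtype.ext (funext fun j => ?_)
    obtain ⟨i, ε⟩ := l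
    have he : Complex.exp ((if ε then 1 else -1) * Real.pi * ((1 : unitInterval) : ℝ) * Complex.I) = -1 := by
      cases ε
      · simp [Complex.exp_neg, Complex.exp_pi_mul_I]
      · simp [Complex.exp_pi_mul_I]
    show halfTwist i ε ((1 : unitInterval) : ℝ) j = ((letterPerm i j : ℕ) : ℂ)
    rw [halfTwist, he]
    by_cases h0 : j = ⟨i, by omega⟩
    · subst h0
      simp [letterPerm]
      ring
    · by_cases h1 : j = ⟨i + 1, by omega⟩
      · subst h1
        simp [letterPerm]
        ring
      · rw [letterPerm, Equiv.swap_apply_of_ne_of_ne h0 h1, if_neg]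
        rintro (h | h)
        · exact h0 (Fin.ext h)
        · exact h1 (Fin.ext h)

/-- The permutation of a braid word: the strand that starts at position `j` ends at position
`w.perm j`. -/
def BraidWord.perm {n : ℕ} : BraidWord n → Equiv.Perm (Fin n)
  | [] => 1
  | l :: w => BraidWord.perm w * letterPerm l.1

/-- The geometric braid of a braid word: run through its letters from left to right. -/
noncomputable def BraidWord.path {n : ℕ} :
    (w : BraidWord n) → Path (Conf.base n) (Conf.permute w.perm (Conf.base n))
  | [] => Path.refl _
  | l :: w =>
    (letterPath l).trans ((BraidWord.path w).map (Conf.continuous_permute (letterPerm l.1)))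

/-! ### The closure of a geometric braid -/

/-- The point of `ℝ³` in the half plane at angle `2πt` about the third axis that corresponds to
`z : ℂ`; its distance to the axis is `exp (- re z)` and its height is `im z`. -/
noncomputable def axisPoint (t : ℝ) (z : ℂ) : EuclideanSpace ℝ (Fin 3) :=
  !₂[Real.exp (-z.re) * Real.cos (2 * Real.pi * t),
     Real.exp (-z.re) * Real.sin (2 * Real.pi * t), z.im]

/-- The strand of the closed braid that starts at position `j`, followed over all time; one turn
about the axis takes one unit of time and leads from position `j` to position `π j`. -/
noncomputable def closedStrand {n : ℕ} {π : Equiv.Perm (Fin n)}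
    (b : Path (Conf.base n) (Conf.permute π (Conf.base n))) (j : Fin n) (t : ℝ) :
    EuclideanSpace ℝ (Fin 3) :=
  axisPoint t ((b.extend (Int.fract t)).1 ((π ^ ⌊t⌋) j))

theorem axisPoint_eq_iff {t u : ℝ} {z v : ℂ} :
    axisPoint t z = axisPoint u v ↔ (∃ m : ℤ, t = u + m) ∧ z = v := by
  constructor
  · intro h
    have h0 := congrFun (congrArg WithLp.ofLp h) 0
    have h1 := congrFun (congrArg WithLp.ofLp h) 1
    have h2 := congrFun (congrArg WithLp.ofLp h) 2
    simp only [axisPoint, Fin.isValue, Matrix.cons_val] at h0 h1 h2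
    have hz := Real.exp_pos (-z.re)
    have hv := Real.exp_pos (-v.re)
    have hr : Real.exp (-z.re) = Real.exp (-v.re) := by
      have a := Real.sin_sq_add_cos_sq (2 * Real.pi * t)
      have b := Real.sin_sq_add_cos_sq (2 * Real.pi * u)
      have : Real.exp (-z.re) ^ 2 = Real.exp (-v.re) ^ 2 := by
        calc Real.exp (-z.re) ^ 2
            = (Real.exp (-z.re) * Real.cos (2 * Real.pi * t)) ^ 2
              + (Real.exp (-z.re) * Real.sin (2 * Real.pi * t)) ^ 2 := by
              linear_combination (-Real.exp (-z.re) ^ 2) * a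
          _ = _ := by
              rw [h0, h1]
              linear_combination (Real.exp (-v.re) ^ 2) * b
      exact (pow_left_inj₀ hz.le hv.le two_ne_zero).1 this
    rw [hr] at h0 h1
    have hc := mul_left_cancel₀ hv.ne' h0
    have hs := mul_left_cancel₀ hv.ne' h1
    refine ⟨?_, Complex.ext (by have := Real.exp_injective hr; linarith) h2⟩
    obtain ⟨m, hm⟩ := Real.Angle.angle_eq_iff_two_pi_dvd_sub.1
      (Real.Angle.cos_sin_inj hc hs)
    refine ⟨m, ?_⟩
    have hp := Real.pi_pos
    have : (2 * Real.pi) * (t - u - m) = 0 := by linarith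
    rcases mul_eq_zero.1 this with h | h
    · linarith
    · linarith
  · rintro ⟨⟨m, rfl⟩, rfl⟩
    have : 2 * Real.pi * (u + m) = 2 * Real.pi * u + m * (2 * Real.pi) := by ring
    simp only [axisPoint, this, Real.cos_add_int_mul_two_pi, Real.sin_add_int_mul_two_pi]

theorem closedStrand_eq_iff {n : ℕ} {π : Equiv.Perm (Fin n)}
    (b : Path (Conf.base n) (Conf.permute π (Conf.base n))) (j k : Fin n) (t u : ℝ) :
    closedStrand b j t = closedStrand b k u ↔
      ∃ m : ℤ, t = u + m ∧ (π ^ m) j = k := by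
  rw [closedStrand, closedStrand, axisPoint_eq_iff]
  constructor
  · rintro ⟨⟨m, rfl⟩, h⟩
    rw [Int.fract_add_intCast, Int.floor_add_intCast] at h
    have h := (b.extend (Int.fract u)).2 h
    rw [zpow_add, Equiv.Perm.mul_apply] at h
    exact ⟨m, rfl, (π ^ ⌊u⌋).injective h⟩
  · rintro ⟨m, rfl, rfl⟩
    refine ⟨⟨m, rfl⟩, ?_⟩
    rw [Int.fract_add_intCast, Int.floor_add_intCast, zpow_add, Equiv.Perm.mul_apply]

theorem continuous_closedStrand {n : ℕ} {π : Equiv.Perm (Fin n)}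
    (b : Path (Conf.base n) (Conf.permute π (Conf.base n))) (j : Fin n) :
    Continuous (closedStrand b j) := by
  -- on `[k, k + 1]` the strand is given by one continuous formula
  have hf : ∀ k : ℤ, Continuous fun t : ℝ =>
      axisPoint t ((b.extend (t - k)).1 ((π ^ k) j)) := by
    intro k
    have h1 : Continuous fun t : ℝ => (b.extend (t - k)).1 ((π ^ k) j) :=
      (continuous_apply _).comp (continuous_subtype_val.comp
        (b.continuous_extend.comp (continuous_id.sub continuous_const)))
    unfold axisPoint
    refine (PiLp.continuous_toLp 2 _).comp (continuous_pi fun c => ?_)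
    fin_cases c
    · exact ((Real.continuous_exp.comp (Complex.continuous_re.comp h1).neg).mul
        (Real.continuous_cos.comp (by fun_prop)))
    · exact ((Real.continuous_exp.comp (Complex.continuous_re.comp h1).neg).mul
        (Real.continuous_sin.comp (by fun_prop)))
    · exact Complex.continuous_im.comp h1
  have he : ∀ (k : ℤ) (t : ℝ), (k : ℝ) ≤ t → t ≤ k + 1 →
      closedStrand b j t = axisPoint t ((b.extend (t - k)).1 ((π ^ k) j)) := by
    intro k t h1 h2
    rcases h2.lt_or_eq with h2 | rfl
    · have : ⌊t⌋ = k := Int.floor_eq_iff.2 ⟨h1, h2⟩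
      rw [closedStrand, Int.fract, this]
    · have hfl : ⌊(k : ℝ) + 1⌋ = k + 1 := by simp
      rw [closedStrand, Int.fract, hfl]
      have e1 : (k : ℝ) + 1 - ((k + 1 : ℤ) : ℝ) = 0 := by push_cast; ring
      have e2 : (k : ℝ) + 1 - (k : ℝ) = 1 := by ring
      rw [e1, e2, Path.extend_zero, Path.extend_one, add_comm k 1, zpow_add, zpow_one]
      rfl
  rw [continuous_iff_continuousAt]
  intro t
  rw [continuousAt_iff_continuous_left'_right']
  constructor
  · -- just below `t`
    have hk := Int.ceil_lt_add_one t
    have hk' := Int.le_ceil t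
    refine ((hf (⌈t⌉ - 1)).continuousWithinAt).congr_of_eventuallyEq ?_
      (he _ t (by push_cast; linarith) (by push_cast; linarith))
    filter_upwards [self_mem_nhdsWithin,
      mem_nhdsWithin_of_mem_nhds (Ioi_mem_nhds (show ((⌈t⌉ - 1 : ℤ) : ℝ) < t by
        push_cast; linarith))] with x hx hx'
    have hx1 : x < t := hx
    have hx2 : ((⌈t⌉ - 1 : ℤ) : ℝ) < x := hx'
    exact he _ x hx2.le (by push_cast; linarith)
  · have hk := Int.floor_le t
    have hk' := Int.lt_floor_add_one t
    refine ((hf ⌊t⌋).continuousWithinAt).congr_of_eventuallyEq ?_ (he _ t hk hk'.le)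
    filter_upwards [self_mem_nhdsWithin, mem_nhdsWithin_of_mem_nhds (Iio_mem_nhds hk')]
      with x hx hx'
    have hx1 : t < x := hx
    have hx2 : x < (⌊t⌋ : ℝ) + 1 := hx'
    exact he _ x (hk.trans hx1.le) hx2.le

theorem minimalPeriod_perm_pos {n : ℕ} (π : Equiv.Perm (Fin n)) (j : Fin n) :
    0 < Function.minimalPeriod π j :=
  Function.minimalPeriod_pos_of_mem_periodicPts
    (Function.Injective.mem_periodicPts π.injective j)

theorem zpow_perm_eq_iff {n : ℕ} (π : Equiv.Perm (Fin n)) (j : Fin n) (m : ℤ) :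
    (π ^ m) j = j ↔ (Function.minimalPeriod π j : ℤ) ∣ m :=
  MulAction.zpow_smul_eq_iff_minimalPeriod_dvd (a := π) (b := j)

/-- The closure of a geometric braid, as an oriented link winding about the third axis. Its
components are the cycles of the permutation of the braid, and the component through position `j`
closes up after as many turns as the cycle of `j` is long. -/
noncomputable def closedBraid {n : ℕ} {π : Equiv.Perm (Fin n)}
    (b : Path (Conf.base n) (Conf.permute π (Conf.base n))) : OrientedLink where
  ι := Quotient (Equiv.Perm.SameCycle.setoid π)
  finite_ι := inferInstance
  curve q t := closedStrand b q.out (Function.minimalPeriod π q.out * t)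
  continuous_curve q := (continuous_closedStrand b q.out).comp (by fun_prop)
  curve_eq_iff p q t u := by
    rw [closedStrand_eq_iff]
    constructor
    · rintro ⟨m, h1, h2⟩
      have hpq : p = q := by
        rw [← Quotient.out_eq p, ← Quotient.out_eq q]
        exact Quotient.sound ⟨m, h2⟩
      subst hpq
      obtain ⟨c, rfl⟩ := (zpow_perm_eq_iff π p.out m).1 h2
      refine ⟨rfl, c, ?_⟩
      have hp : (0 : ℝ) < Function.minimalPeriod π p.out := by
        exact_mod_cast minimalPeriod_perm_pos π p.out
      refine mul_left_cancel₀ hp.ne' ?_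
      rw [h1]
      push_cast
      ring
    · rintro ⟨rfl, c, rfl⟩
      exact ⟨Function.minimalPeriod π p.out * c, by push_cast; ring,
        (zpow_perm_eq_iff π p.out _).2 (dvd_mul_right _ _)⟩

/-- The closures of the braids `β ∈ B_m` and `β' ∈ B_n` are the same oriented link: whatever words
represent them, the closed braids are ambient isotopic. -/
def SameClosure {m n : ℕ} (β : BraidGroup m) (β' : BraidGroup n) : Prop :=
  ∀ (w : BraidWord m) (w' : BraidWord n), w.toBraid = β → w'.toBraid = β' →
    (closedBraid w.path).Isotopic (closedBraid w'.path)

/-! ### T-links -/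

/-- `((r_1,s_1),…,(r_k,s_k))` is a parameter list of a T-link: `2 ≤ r_1 ≤ ⋯ ≤ r_k` and all
`s_i > 0`. -/
def IsTLinkParams (p : List (ℕ × ℕ)) : Prop :=
  (p.map Prod.fst).Pairwise (· ≤ ·) ∧ ∀ q ∈ p, 2 ≤ q.1 ∧ 0 < q.2

/-- The number of strands `r_k` of the standard braid of `T((r_1,s_1),…,(r_k,s_k))`. -/
def tLinkStrands (p : List (ℕ × ℕ)) : ℕ := (p.getLast?.map Prod.fst).getD 0

/-- The braid `[1,r_1]^{s_1} ⋯ [1,r_k]^{s_k}` in `B_{r_k}` whose closure is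
`T((r_1,s_1),…,(r_k,s_k))`. -/
def tLinkBraid (p : List (ℕ × ℕ)) : BraidGroup (tLinkStrands p) :=
  (p.map fun q => braidBracket (tLinkStrands p) 1 q.1 ^ q.2).prod

/-- `T(p)` and `T(p')` are the same link. -/
def SameTLink (p p' : List (ℕ × ℕ)) : Prop := SameClosure (tLinkBraid p) (tLinkBraid p')

/-! ### Ambient isotopies -/

/-! The algebraic core is short. Let A_k = σ_1⋯σ_k, so that [1,r] = A_{r-1}. For s ≤ k + 1 one has
A_{k+1}^s = A_k^s · (σ_{k+1}σ_k⋯), with s descending letters in the last factor (`ascProd_pow`).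
Hence in γ[1,r]^s, with s < r, the top generator can be made to occur exactly once. A conjugation
and a positive destabilization remove it, leaving γ[1,r-1]^s times a descending product of s - 1
letters. The step repeats, because the full descending product shifts the indices of the products
already collected down by one (`semiconjBy_descProd`). After r - s steps (`sameClosure_destabilize`)
the braid is γ[1,s]^s (σ_{s-1}⋯σ_1)^{r-s}. Since s divides r - s, the last factor is a power of the
full twist (σ_{s-1}⋯σ_1)^s = [1,s]^s (`full_twist`), and the braid is γ[1,s]^r. The statement on
T-links is the case a = s, with γ the product of the earlier factors.

The rest is geometry: closure must be independent of the word and invariant under conjugation and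
positive stabilization, with genuine ambient isotopies of ℝ³. A homotopy through closed braids is
cut into small steps, each realized by a displacement inside the half planes bounded by the axis
(`push_of_homotopy`). The displacement is a contraction, so the identity plus it is bijective.
Conjugation slides a time window along u v u, and cancellation shortens a twist that is undone. For
the positive braid relations both sides are words in which strands with larger labels pass above;
such words are compared by lifting the strands to separate heights (`push_of_layered`).

Stabilization is not an isotopy through closed braids on a fixed number of strands. The closed braid
of the stabilized word is first deformed so that its extra turn runs as a helix very close to the
axis. One horizontal push across the axis then replaces a helix of one and a quarter turns by one of
a quarter turn (`exists_isIsotopicToId_unwind`). This changes the time parameter, so links are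
recognised by their images together with the orientation on a small arc of each component
(`OrientedLink.isotopic_of_image`). -/

/-- `T` is the final map of an ambient isotopy of `ℝ³`. -/
def IsIsotopicToId (T : EuclideanSpace ℝ (Fin 3) → EuclideanSpace ℝ (Fin 3)) : Prop :=
  ∃ H : unitInterval → (EuclideanSpace ℝ (Fin 3) ≃ₜ EuclideanSpace ℝ (Fin 3)),
    Continuous (fun p : unitInterval × EuclideanSpace ℝ (Fin 3) => H p.1 p.2) ∧
    (∀ x, H 0 x = x) ∧ ∀ x, H 1 x = T x

theorem IsIsotopicToId.id : IsIsotopicToId fun x => x :=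
  ⟨fun _ => Homeomorph.refl _, continuous_snd, fun _ => rfl, fun _ => rfl⟩

theorem IsIsotopicToId.comp {T T' : EuclideanSpace ℝ (Fin 3) → EuclideanSpace ℝ (Fin 3)}
    (h' : IsIsotopicToId T') (h : IsIsotopicToId T) : IsIsotopicToId fun x => T' (T x) := by
  obtain ⟨H, hc, h0, h1⟩ := h
  obtain ⟨H', hc', h0', h1'⟩ := h'
  refine ⟨fun s => (H s).trans (H' s), ?_, fun x => by simp [h0, h0'], fun x => by simp [h1, h1']⟩
  exact hc'.comp (continuous_fst.prodMk hc)

/-- The isotopy is run backwards after composing with the inverse of its final map: `H (1 - s) ∘ (H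
1)⁻¹`. -/
theorem IsIsotopicToId.symm {T T' : EuclideanSpace ℝ (Fin 3) → EuclideanSpace ℝ (Fin 3)}
    (h : IsIsotopicToId T) (hT : Function.RightInverse T' T) : IsIsotopicToId T' := by
  obtain ⟨H, hc, h0, h1⟩ := h
  refine ⟨fun s => (H 1).symm.trans (H (unitInterval.symm s)), ?_, fun x => by simp, fun x => ?_⟩
  · exact hc.comp ((unitInterval.continuous_symm.comp continuous_fst).prodMk
      ((H 1).symm.continuous.comp continuous_snd))
  · simp only [Homeomorph.trans_apply, unitInterval.symm_one, h0]
    rw [Homeomorph.symm_apply_eq, h1, hT x]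

/-- A continuous bijection at bounded distance from the identity is a homeomorphism. -/
theorem isClosedMap_of_dist_le {E : Type*} [MetricSpace E] [ProperSpace E] {f : E → E}
    (hf : Continuous f) (C : ℝ) (hC : ∀ x, dist (f x) x ≤ C) : IsClosedMap f := by
  refine (isProperMap_iff_isCompact_preimage.2 ⟨hf, fun K hK => ?_⟩).isClosedMap
  refine Metric.isCompact_of_isClosed_isBounded (hK.isClosed.preimage hf) ?_
  refine (hK.isBounded.cthickening (δ := C)).subset fun x hx => ?_
  exact Metric.mem_cthickening_of_dist_le x (f x) C K hx (by rw [dist_comm]; exact hC x)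

/-- Bounded displacement makes every stage a proper, hence closed, map; thus inverses never have to
be shown continuous by hand. -/
theorem isIsotopicToId_of_bijective
    (T : ℝ → EuclideanSpace ℝ (Fin 3) → EuclideanSpace ℝ (Fin 3))
    (hT : Continuous fun p : ℝ × EuclideanSpace ℝ (Fin 3) => T p.1 p.2)
    (hb : ∀ s ∈ Set.Icc (0 : ℝ) 1, Function.Bijective (T s)) (h0 : ∀ x, T 0 x = x)
    (C : ℝ) (hC : ∀ s ∈ Set.Icc (0 : ℝ) 1, ∀ x, dist (T s x) x ≤ C) : IsIsotopicToId (T 1) := by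
  have hTs : ∀ s, Continuous (T s) := fun s => hT.comp (continuous_const.prodMk continuous_id)
  refine ⟨fun s => (Equiv.ofBijective (T s) (hb s s.2)).toHomeomorphOfContinuousClosed (hTs s)
    (isClosedMap_of_dist_le (hTs s) C (hC s s.2)), ?_, fun x => ?_, fun x => ?_⟩
  · exact hT.comp ((continuous_subtype_val.comp continuous_fst).prodMk continuous_snd)
  · exact h0 x
  · rfl

theorem OrientedLink.Isotopic.trans {L₁ L₂ L₃ : OrientedLink} (h : L₁.Isotopic L₂)
    (h' : L₂.Isotopic L₃) : L₁.Isotopic L₃ := by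
  obtain ⟨H, hc, h0, e, he⟩ := h
  obtain ⟨H', hc', h0', e', he'⟩ := h'
  refine ⟨fun s => (H s).trans (H' s), hc'.comp (continuous_fst.prodMk hc),
    fun x => by simp [h0, h0'], e.trans e', fun i => ?_⟩
  obtain ⟨φ, hφ⟩ := he i
  obtain ⟨φ', hφ'⟩ := he' (e i)
  exact ⟨φ.trans φ', fun t => by simp [hφ, hφ']⟩

theorem OrientedLink.Isotopic.symm {L₁ L₂ : OrientedLink} (h : L₁.Isotopic L₂) :
    L₂.Isotopic L₁ := by
  obtain ⟨H, hc, h0, e, he⟩ := h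
  refine ⟨fun s => (H 1).symm.trans (H (unitInterval.symm s)), ?_, fun x => by simp,
    e.symm, fun i => ?_⟩
  · exact hc.comp ((unitInterval.continuous_symm.comp continuous_fst).prodMk
      ((H 1).symm.continuous.comp continuous_snd))
  · obtain ⟨φ, hφ⟩ := he (e.symm i)
    refine ⟨φ.symm, fun t => ?_⟩
    simp only [Homeomorph.trans_apply, unitInterval.symm_one, h0]
    rw [Homeomorph.symm_apply_eq, hφ]
    simp

/-! ### Recognising isotopic links by their images -/

theorem exists_int_of_continuous {f : ℝ → ℝ} (s : Set ℝ) (hs : IsPreconnected s)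
    (hf : ContinuousOn f s) (hi : ∀ t ∈ s, ∃ m : ℤ, f t = m) {t u : ℝ} (ht : t ∈ s) (hu : u ∈ s) :
    f t = f u := by
  have h1 : ∀ t ∈ s, f t = ((round (f t) : ℤ) : ℝ) := fun t ht => by
    obtain ⟨m, hm⟩ := hi t ht
    rw [hm, round_intCast]
  have : IsPreconnected (f '' s) := hs.image f hf
  have h2 : (f '' s) ⊆ Set.range ((↑) : ℤ → ℝ) := by
    rintro _ ⟨t, ht, rfl⟩
    exact ⟨_, (h1 t ht).symm⟩
  have h3 : (Set.range ((↑) : ℤ → ℝ)).Countable := Set.countable_range _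
  exact (h3.mono h2).isTotallyDisconnected (f '' s) subset_rfl this
    ⟨t, ht, rfl⟩ ⟨u, hu, rfl⟩

/-- A lift to `ℝ` of an injective map of circles that increases somewhere is an increasing
bijection. -/
theorem strictMono_surjective_of_lift {φ : ℝ → ℝ} (hφ : Continuous φ)
    (h : ∀ t u, (∃ m : ℤ, φ t = φ u + m) ↔ ∃ m : ℤ, t = u + m) {a b : ℝ} (hab : a < b)
    (hφab : φ a < φ b) : StrictMono φ ∧ Function.Surjective φ := by
  have hint : ∀ t, ∃ m : ℤ, φ (t + 1) - φ t = m := fun t => by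
    obtain ⟨m, hm⟩ := (h (t + 1) t).2 ⟨1, by simp⟩
    exact ⟨m, by rw [hm]; ring⟩
  obtain ⟨k, hk⟩ := hint 0
  have hk' : ∀ t, φ (t + 1) = φ t + k := fun t => by
    have := exists_int_of_continuous Set.univ isPreconnected_univ
      (f := fun t => φ (t + 1) - φ t) (by fun_prop) (fun t _ => hint t)
      (Set.mem_univ t) (Set.mem_univ 0)
    rw [hk] at this
    linarith
  have hkn : ∀ (n : ℕ) t, φ (t + n) = φ t + n * k := fun n t => by
    induction n with
    | zero => simp
    | succ n ih =>
      push_cast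
      rw [← add_assoc, hk', ih]
      ring
  have hloc : ∀ t u, φ t = φ u → |t - u| < 1 → t = u := by
    intro t u htu hlt
    obtain ⟨m, hm⟩ := (h t u).1 ⟨0, by simp [htu]⟩
    rw [hm, add_sub_cancel_left, ← Int.cast_abs] at hlt
    have : m = 0 := Int.abs_lt_one_iff.1 (by exact_mod_cast hlt)
    simp [hm, this]
  -- The degree `k` cannot vanish: otherwise `φ 0 = φ 1`, and the value midway between `φ 0` and `φ
  -- (1 / 2)` is taken in both halves of `[0, 1]`. Injectivity on the circle then forces both points
  -- to be `1 / 2`.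
  have hk0 : k ≠ 0 := by
    rintro rfl
    have h1 : φ 1 = φ 0 := by simpa using hk' 0
    obtain ⟨x, hx, hx'⟩ := intermediate_value_uIcc (a := 0) (b := (1 : ℝ) / 2) hφ.continuousOn
      (show (φ 0 + φ (1 / 2)) / 2 ∈ _ by
        rw [Set.mem_uIcc]
        rcases le_total (φ 0) (φ (1 / 2)) with h | h
        · left; constructor <;> linarith
        · right; constructor <;> linarith)
    obtain ⟨y, hy, hy'⟩ := intermediate_value_uIcc (a := 1 / 2) (b := (1 : ℝ)) hφ.continuousOn
      (show (φ 0 + φ (1 / 2)) / 2 ∈ _ by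
        rw [Set.mem_uIcc, h1]
        rcases le_total (φ 0) (φ (1 / 2)) with h | h
        · right; constructor <;> linarith
        · left; constructor <;> linarith)
    have hne : φ 0 ≠ φ (1 / 2) := fun h => by
      have := hloc 0 (1 / 2) h (by norm_num [abs_lt])
      norm_num at this
    rw [Set.uIcc_of_le (by norm_num)] at hx hy
    have hx0 : x ≠ 0 := by
      rintro rfl
      exact hne (by linarith)
    have hx1 : 0 < x := lt_of_le_of_ne hx.1 hx0.symm
    have hxy : x = y := hloc x y (hx'.trans hy'.symm) (by
      rw [abs_lt]; constructor <;> linarith [hx.2, hy.1, hy.2])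
    have : x = 1 / 2 := le_antisymm hx.2 (hxy ▸ hy.1)
    rw [this] at hx'
    exact hne (by linarith)
  -- Equal values occur only at parameters differing by an integer `m`, and there the values differ
  -- by `m * k` with `k ≠ 0`.
  have hinj : Function.Injective φ := by
    have key : ∀ t u, t ≤ u → φ t = φ u → t = u := by
      intro t u htu he
      obtain ⟨m, hm⟩ := (h u t).1 ⟨0, by simp [he]⟩
      have hm0 : 0 ≤ m := by
        have : (0 : ℝ) ≤ m := by linarith
        exact_mod_cast this
      lift m to ℕ using hm0
      have := hkn m t
      rw [Int.cast_natCast] at hm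
      rw [← hm, ← he] at this
      have h0 : (m : ℝ) * k = 0 := by linarith
      rcases mul_eq_zero.1 h0 with h0 | h0
      · rw [hm, h0, add_zero]
      · exact absurd (by exact_mod_cast h0) hk0
    intro t u he
    rcases le_total t u with h | h
    · exact key t u h he
    · exact (key u t h he.symm).symm
  have hmono : StrictMono φ := by
    rcases hφ.strictMono_of_inj hinj with h | h
    · exact h
    · exact absurd (h hab) (by linarith)
  refine ⟨hmono, fun y => ?_⟩
  have hkpos : (1 : ℝ) ≤ k := by
    have : (0 : ℝ) < k := by linarith [hmono (show (0 : ℝ) < 0 + 1 by norm_num), hk' 0]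
    exact_mod_cast (show 1 ≤ k by
      have : 0 < k := by exact_mod_cast this
      omega)
  obtain ⟨n, hn⟩ := exists_nat_ge |y - φ 0|
  have hnk : (n : ℝ) ≤ n * k := le_mul_of_one_le_right (Nat.cast_nonneg n) hkpos
  rw [abs_le] at hn
  refine mem_range_of_exists_le_of_exists_ge hφ ⟨-n, ?_⟩ ⟨n, ?_⟩
  · have := hkn n (-n)
    rw [neg_add_cancel] at this
    linarith
  · have := hkn n 0
    rw [zero_add] at this
    linarith

/-- A map into the image of an oriented link lifts to a parameter on one component. -/
theorem OrientedLink.exists_lift (L : OrientedLink) {f : ℝ → EuclideanSpace ℝ (Fin 3)}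
    (hf : Continuous f) (h : ∀ t, ∃ i u, f t = L.curve i u) :
    ∃ (i : L.ι) (φ : ℝ → ℝ), Continuous φ ∧ ∀ t, f t = L.curve i (φ t) := by
  have := L.finite_ι
  let _ : TopologicalSpace L.ι := ⊥
  have : DiscreteTopology L.ι := ⟨rfl⟩
  have : Fact ((0 : ℝ) < 1) := ⟨one_pos⟩
  have hper : ∀ i, Function.Periodic (L.curve i) 1 := fun i t =>
    (L.curve_eq_iff i i _ _).2 ⟨rfl, 1, by simp⟩
  -- The link as an injective continuous map from a compact disjoint union of circles, hence a
  -- closed embedding. So `f` factors continuously through it, stays on one circle, and lifts along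
  -- the covering of that circle by `ℝ`.
  let P : L.ι × AddCircle (1 : ℝ) → EuclideanSpace ℝ (Fin 3) := fun x => (hper x.1).lift x.2
  have hP : Continuous P := by
    rw [continuous_prod_of_discrete_left]
    intro i
    have hq : Topology.IsQuotientMap ((↑) : ℝ → AddCircle (1 : ℝ)) := isQuotientMap_quotient_mk'
    exact hq.continuous_iff.2 (L.continuous_curve i)
  have hPi : Function.Injective P := by
    rintro ⟨i, x⟩ ⟨j, y⟩ hxy
    induction x using QuotientAddGroup.induction_on with | _ t =>
    induction y using QuotientAddGroup.induction_on with | _ u =>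
    have h1 : L.curve i t = L.curve j u := hxy
    obtain ⟨rfl, m, rfl⟩ := (L.curve_eq_iff i j t u).1 h1
    refine Prod.ext rfl ?_
    change ((u + m : ℝ) : AddCircle (1 : ℝ)) = (u : AddCircle (1 : ℝ))
    rw [AddCircle.coe_add, add_eq_left, AddCircle.coe_eq_zero_iff]
    exact ⟨m, by simp⟩
  have hPe := hP.isClosedEmbedding hPi
  have hg : ∀ t, ∃ x, P x = f t := fun t => by
    obtain ⟨i, u, hu⟩ := h t
    exact ⟨(i, (u : AddCircle (1 : ℝ))), hu.symm⟩
  choose g hg using hg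
  have hgc : Continuous g := by
    rw [hPe.isEmbedding.continuous_iff]
    exact hf.congr fun t => (hg t).symm
  have hconst : ∀ t, (g t).1 = (g 0).1 := fun t =>
    PreconnectedSpace.constant inferInstance (continuous_fst.comp hgc)
  obtain ⟨u₀, hu₀⟩ := QuotientAddGroup.mk_surjective (g 0).2
  obtain ⟨Φ, ⟨-, hΦ⟩, -⟩ := (AddCircle.isCoveringMap_coe (1 : ℝ)).existsUnique_continuousMap_lifts
    (⟨fun t => (g t).2, continuous_snd.comp hgc⟩ : C(ℝ, AddCircle (1 : ℝ))) 0 u₀ hu₀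
  refine ⟨(g 0).1, Φ, Φ.continuous, fun t => ?_⟩
  have h2 : ((Φ t : ℝ) : AddCircle (1 : ℝ)) = (g t).2 := congrFun hΦ t
  rw [← hg t]
  change (hper (g t).1).lift (g t).2 = _
  rw [← h2, hconst t]
  rfl

/-- Two oriented links are isotopic if an ambient isotopy carries the image of the first onto that
of the second and respects the orientation somewhere on each component. -/
theorem OrientedLink.isotopic_of_image {L L' : OrientedLink}
    {T : EuclideanSpace ℝ (Fin 3) → EuclideanSpace ℝ (Fin 3)} (hT : IsIsotopicToId T)
    (hmaps : ∀ i t, ∃ i' u, T (L.curve i t) = L'.curve i' u)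
    (hsurj : ∀ i', ∃ i t u, T (L.curve i t) = L'.curve i' u)
    (hor : ∀ i, ∃ t₀ t₁ : ℝ, t₀ < t₁ ∧ ∃ (i' : L'.ι) (ψ : ℝ → ℝ), Continuous ψ ∧ StrictMono ψ ∧
      ∀ t ∈ Set.Icc t₀ t₁, T (L.curve i t) = L'.curve i' (ψ t)) : L.Isotopic L' := by
  obtain ⟨H, hc, h0, h1⟩ := hT
  have hTi : Function.Injective T := fun x y hxy => (H 1).injective (by rw [h1, h1, hxy])
  have hTc : Continuous T := (H 1).continuous.congr h1
  choose e φ hφc hφ using fun i => L'.exists_lift (hTc.comp (L.continuous_curve i)) (hmaps i)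
  simp only [Function.comp_apply] at hφ
  have hms : ∀ i, StrictMono (φ i) ∧ Function.Surjective (φ i) := by
    intro i
    obtain ⟨t₀, t₁, hlt, i', ψ, hψc, hψm, hψ⟩ := hor i
    -- On the arc where the orientation is known, the lift and `ψ` differ by a constant integer, so
    -- the lift increases there; the degree argument then makes it increase everywhere.
    have hint : ∀ t ∈ Set.Icc t₀ t₁, ∃ m : ℤ, φ i t - ψ t = m := fun t ht => by
      have := hψ t ht
      rw [hφ] at this
      obtain ⟨-, m, hm⟩ := (L'.curve_eq_iff _ _ _ _).1 this
      exact ⟨m, by rw [hm]; ring⟩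
    have hcst := exists_int_of_continuous (Set.Icc t₀ t₁) isPreconnected_Icc
      ((hφc i).sub hψc).continuousOn hint (Set.left_mem_Icc.2 hlt.le) (Set.right_mem_Icc.2 hlt.le)
    refine strictMono_surjective_of_lift (hφc i) (fun t u => ?_) hlt ?_
    · have e1 := L'.curve_eq_iff (e i) (e i) (φ i t) (φ i u)
      have e2 := L.curve_eq_iff i i t u
      rw [← hφ, ← hφ, hTi.eq_iff, e2] at e1
      simpa using e1.symm
    · simp only [Pi.sub_apply] at hcst
      linarith [hψm hlt]
  have heinj : Function.Injective e := by
    intro i j hij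
    obtain ⟨t, ht⟩ := (hms i).2 (φ j 0)
    have : T (L.curve i t) = T (L.curve j 0) := by rw [hφ, hφ, ht, hij]
    exact ((L.curve_eq_iff _ _ _ _).1 (hTi this)).1
  have hesurj : Function.Surjective e := by
    intro i'
    obtain ⟨i, t, u, h⟩ := hsurj i'
    rw [hφ] at h
    exact ⟨i, ((L'.curve_eq_iff _ _ _ _).1 h).1⟩
  refine ⟨H, hc, h0, Equiv.ofBijective e ⟨heinj, hesurj⟩, fun i =>
    ⟨StrictMono.orderIsoOfSurjective (φ i) (hms i).1 (hms i).2, fun t => ?_⟩⟩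
  rw [h1, hφ]
  rfl

/-! ### Recognising isotopic closed braids. -/

theorem closedStrand_of_mem_Ico {n : ℕ} {π : Equiv.Perm (Fin n)}
    (b : Path (Conf.base n) (Conf.permute π (Conf.base n))) (j : Fin n) {t : ℝ}
    (ht : t ∈ Set.Ico (0 : ℝ) 1) : closedStrand b j t = axisPoint t ((b.extend t).1 j) := by
  have h1 : ⌊t⌋ = 0 := Int.floor_eq_zero_iff.2 ht
  rw [closedStrand, h1, Int.fract_eq_self.2 ht]
  rfl

theorem closedStrand_eq_fract {n : ℕ} {π : Equiv.Perm (Fin n)}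
    (b : Path (Conf.base n) (Conf.permute π (Conf.base n))) (j : Fin n) (t : ℝ) :
    closedStrand b j t =
      axisPoint (Int.fract t) ((b.extend (Int.fract t)).1 ((π ^ ⌊t⌋) j)) := by
  rw [closedStrand, axisPoint_eq_iff]
  exact ⟨⟨⌊t⌋, (Int.fract_add_floor t).symm⟩, rfl⟩

/-- Every strand of a closed braid runs along a component. -/
theorem exists_closedStrand_eq_curve {n : ℕ} {π : Equiv.Perm (Fin n)}
    (b : Path (Conf.base n) (Conf.permute π (Conf.base n))) (j : Fin n) :
    ∃ ψ : ℝ → ℝ, Continuous ψ ∧ StrictMono ψ ∧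
      ∀ t, closedStrand b j t = (closedBraid b).curve (Quotient.mk _ j) (ψ t) := by
  set q : Quotient (Equiv.Perm.SameCycle.setoid π) := Quotient.mk _ j with hq
  obtain ⟨m, hm⟩ : Equiv.Perm.SameCycle π j q.out :=
    Quotient.exact (s := Equiv.Perm.SameCycle.setoid π) (by rw [Quotient.out_eq])
  have hp : (0 : ℝ) < Function.minimalPeriod π q.out := by
    exact_mod_cast minimalPeriod_perm_pos π q.out
  refine ⟨fun t => (t - m) / Function.minimalPeriod π q.out, by fun_prop, fun t u htu => ?_,
    fun t => ?_⟩
  · exact div_lt_div_of_pos_right (by linarith) hp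
  · change _ = closedStrand b q.out _
    rw [closedStrand_eq_iff]
    exact ⟨m, by rw [mul_div_cancel₀ _ hp.ne']; ring, hm⟩

/-- The closures of two geometric braids are isotopic if an ambient isotopy carries the image of
the first onto that of the second and fixes the time on a part of each strand. -/
theorem closedBraid_isotopic_of_image {n n' : ℕ} {π : Equiv.Perm (Fin n)}
    {π' : Equiv.Perm (Fin n')} (b : Path (Conf.base n) (Conf.permute π (Conf.base n)))
    (b' : Path (Conf.base n') (Conf.permute π' (Conf.base n')))
    {T : EuclideanSpace ℝ (Fin 3) → EuclideanSpace ℝ (Fin 3)} (hT : IsIsotopicToId T)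
    (hmaps : ∀ t ∈ Set.Icc (0 : ℝ) 1, ∀ j, ∃ u ∈ Set.Icc (0 : ℝ) 1, ∃ j',
      T (axisPoint t ((b.extend t).1 j)) = axisPoint u ((b'.extend u).1 j'))
    (hsurj : ∀ j', ∃ t ∈ Set.Icc (0 : ℝ) 1, ∃ j, ∃ u ∈ Set.Ico (0 : ℝ) 1,
      T (axisPoint t ((b.extend t).1 j)) = axisPoint u ((b'.extend u).1 j'))
    (hor : ∀ j, ∃ t₀ t₁ : ℝ, 0 ≤ t₀ ∧ t₀ < t₁ ∧ t₁ < 1 ∧ ∃ j', ∀ t ∈ Set.Icc t₀ t₁,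
      T (axisPoint t ((b.extend t).1 j)) = axisPoint t ((b'.extend t).1 j')) :
    (closedBraid b).Isotopic (closedBraid b') := by
  -- Time `1` needs separate care: there the point belongs to the strand through `σ j`, at its time
  -- `0`.
  have hpt : ∀ {m : ℕ} {σ : Equiv.Perm (Fin m)}
      (c : Path (Conf.base m) (Conf.permute σ (Conf.base m))) (j : Fin m),
      ∀ t ∈ Set.Icc (0 : ℝ) 1, ∃ q u, axisPoint t ((c.extend t).1 j) = (closedBraid c).curve q u := by
    intro m σ c j t ht
    rcases ht.2.lt_or_eq with h | rfl
    · obtain ⟨ψ, -, -, hψ⟩ := exists_closedStrand_eq_curve c j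
      exact ⟨_, ψ t, (closedStrand_of_mem_Ico c j ⟨ht.1, h⟩).symm.trans (hψ t)⟩
    · obtain ⟨ψ, -, -, hψ⟩ := exists_closedStrand_eq_curve c (σ j)
      refine ⟨_, ψ 0, Eq.trans ?_ (hψ 0)⟩
      rw [closedStrand_of_mem_Ico c _ ⟨le_rfl, one_pos⟩, axisPoint_eq_iff,
        Path.extend_one, Path.extend_zero]
      exact ⟨⟨1, by simp⟩, rfl⟩
  refine OrientedLink.isotopic_of_image hT (fun q t => ?_) (fun q' => ?_) (fun q => ?_)
  · change ∃ i' u, T (closedStrand b (Quotient.out q) _) = _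
    rw [closedStrand_eq_fract]
    obtain ⟨u, hu, j', h⟩ := hmaps _ ⟨Int.fract_nonneg _, (Int.fract_lt_one _).le⟩ _
    rw [h]
    exact hpt b' j' u hu
  · obtain ⟨t, ht, j, u, hu, h⟩ := hsurj (Quotient.out q')
    obtain ⟨q, v, hv⟩ := hpt b j t ht
    obtain ⟨ψ, -, -, hψ⟩ := exists_closedStrand_eq_curve b' (Quotient.out q')
    refine ⟨q, v, ψ u, ?_⟩
    rw [← hv, h]
    refine ((closedStrand_of_mem_Ico b' _ hu).symm.trans (hψ u)).trans ?_
    exact congrArg (fun q => (closedBraid b').curve q (ψ u)) (Quotient.out_eq q')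
  · obtain ⟨t₀, t₁, ht₀, hlt, ht₁, j', h⟩ := hor (Quotient.out q)
    obtain ⟨ψ, hψc, hψm, hψ⟩ := exists_closedStrand_eq_curve b' j'
    have hp : (0 : ℝ) < Function.minimalPeriod π (Quotient.out q) := by
      exact_mod_cast minimalPeriod_perm_pos π (Quotient.out q)
    refine ⟨t₀ / Function.minimalPeriod π (Quotient.out q),
      t₁ / Function.minimalPeriod π (Quotient.out q), div_lt_div_of_pos_right hlt hp,
      Quotient.mk (Equiv.Perm.SameCycle.setoid π') j',
      fun t => ψ (Function.minimalPeriod π (Quotient.out q) * t), hψc.comp (by fun_prop),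
      fun t u htu => hψm (mul_lt_mul_of_pos_left htu hp), fun t ht => ?_⟩
    rw [Set.mem_Icc, div_le_iff₀ hp, le_div_iff₀ hp, mul_comm t] at ht
    have hI : (Function.minimalPeriod π (Quotient.out q) : ℝ) * t ∈ Set.Ico (0 : ℝ) 1 :=
      ⟨ht₀.trans ht.1, ht.2.trans_lt ht₁⟩
    refine Eq.trans ?_ (hψ _)
    rw [closedStrand_of_mem_Ico b' j' hI, ← h _ ht, ← closedStrand_of_mem_Ico b _ hI]
    rfl

/-! ### Pushing points of the pages of the open book -/

/-- The point of `ℝ³` with horizontal coordinate `ξ` and height `h`. -/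
noncomputable def cylPoint (ξ : ℂ) (h : ℝ) : EuclideanSpace ℝ (Fin 3) := !₂[ξ.re, ξ.im, h]

/-- The horizontal coordinate of a point of `ℝ³`. -/
noncomputable def horiz (x : EuclideanSpace ℝ (Fin 3)) : ℂ := ⟨x 0, x 1⟩

@[simp] theorem horiz_cylPoint (ξ : ℂ) (h : ℝ) : horiz (cylPoint ξ h) = ξ := by
  simp [horiz, cylPoint]

@[simp] theorem cylPoint_apply_two (ξ : ℂ) (h : ℝ) : cylPoint ξ h 2 = h := by
  simp [cylPoint]

theorem cylPoint_horiz (x : EuclideanSpace ℝ (Fin 3)) : cylPoint (horiz x) (x 2) = x := by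
  ext c
  fin_cases c <;> simp [horiz, cylPoint]

theorem continuous_horiz : Continuous horiz := by
  have : horiz = fun x => ((x 0 : ℝ) : ℂ) + ((x 1 : ℝ) : ℂ) * Complex.I := by
    funext x
    apply Complex.ext <;> simp [horiz]
  rw [this]
  fun_prop

theorem continuous_cylPoint : Continuous fun p : ℂ × ℝ => cylPoint p.1 p.2 := by
  unfold cylPoint
  refine (PiLp.continuous_toLp 2 _).comp (continuous_pi fun c => ?_)
  fin_cases c
  · exact Complex.continuous_re.comp continuous_fst
  · exact Complex.continuous_im.comp continuous_fst
  · exact continuous_snd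

theorem axisPoint_eq_cylPoint (t : ℝ) (z : ℂ) :
    axisPoint t z =
      cylPoint (Real.exp (-z.re) * Complex.exp ((2 * Real.pi * t : ℝ) * Complex.I)) z.im := by
  simp only [axisPoint, cylPoint, Complex.re_ofReal_mul, Complex.im_ofReal_mul,
    Complex.exp_ofReal_mul_I_re, Complex.exp_ofReal_mul_I_im]

theorem horiz_axisPoint (t : ℝ) (z : ℂ) : horiz (axisPoint t z) =
    Real.exp (-z.re) * Complex.exp ((2 * Real.pi * t : ℝ) * Complex.I) := by
  rw [axisPoint_eq_cylPoint, horiz_cylPoint]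

theorem horiz_axisPoint_ne_zero (t : ℝ) (z : ℂ) : horiz (axisPoint t z) ≠ 0 := by
  rw [horiz_axisPoint]
  exact mul_ne_zero (by exact_mod_cast (Real.exp_pos _).ne') (Complex.exp_ne_zero _)

theorem norm_horiz_axisPoint (t : ℝ) (z : ℂ) : ‖horiz (axisPoint t z)‖ = Real.exp (-z.re) := by
  rw [horiz_axisPoint, norm_mul, Complex.norm_exp_ofReal_mul_I, Complex.norm_real, mul_one,
    Real.norm_of_nonneg (Real.exp_pos _).le]

/-- The page of a point off the axis. -/
noncomputable def pageTime (ξ : ℂ) : ℝ := Complex.arg ξ / (2 * Real.pi)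

/-- The position in its page of the point with horizontal coordinate `ξ` and height `h`. -/
noncomputable def pagePos (ξ : ℂ) (h : ℝ) : ℂ := ⟨-Real.log ‖ξ‖, h⟩

theorem axisPoint_page {ξ : ℂ} (hξ : ξ ≠ 0) (h : ℝ) :
    axisPoint (pageTime ξ) (pagePos ξ h) = cylPoint ξ h := by
  rw [axisPoint_eq_cylPoint]
  congr 1
  simp only [pagePos, neg_neg, pageTime]
  rw [Real.exp_log (norm_pos_iff.2 hξ), mul_div_cancel₀ _ Real.two_pi_pos.ne']
  exact Complex.norm_mul_exp_arg_mul_I ξ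

theorem exists_axisPoint_eq {x : EuclideanSpace ℝ (Fin 3)} (hx : horiz x ≠ 0) :
    ∃ t z, x = axisPoint t z :=
  ⟨_, _, by rw [axisPoint_page hx (x 2), cylPoint_horiz]⟩

theorem continuous_axisPoint : Continuous fun p : ℝ × ℂ => axisPoint p.1 p.2 := by
  simp only [axisPoint_eq_cylPoint]
  refine continuous_cylPoint.comp (Continuous.prodMk ?_ (by fun_prop))
  fun_prop

/-- A displacement of the pages, as a function on `ℝ³`. -/
noncomputable def pageField (δ : ℝ → ℂ → ℂ) (x : EuclideanSpace ℝ (Fin 3)) : ℂ :=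
  if horiz x = 0 then 0 else δ (pageTime (horiz x)) (pagePos (horiz x) (x 2))

theorem eq_of_periodic {δ : ℝ → ℂ → ℂ} (hper : ∀ t z, δ (t + 1) z = δ t z) (t : ℝ) (m : ℤ)
    (z : ℂ) : δ (t + m) z = δ t z := by
  have h : Function.Periodic (fun t => δ t z) 1 := fun t => hper t z
  simpa using h.int_mul m t

theorem pageField_axisPoint {δ : ℝ → ℂ → ℂ} (hper : ∀ t z, δ (t + 1) z = δ t z) (t : ℝ) (z : ℂ) :
    pageField δ (axisPoint t z) = δ t z := by
  have h0 := horiz_axisPoint_ne_zero t z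
  rw [pageField, if_neg h0]
  have h1 := axisPoint_page h0 (axisPoint t z 2)
  rw [cylPoint_horiz, axisPoint_eq_iff] at h1
  obtain ⟨⟨m, hm⟩, hz⟩ := h1
  rw [hz, hm, eq_of_periodic hper]

/-- Near the axis the page coordinate is large and the field vanishes. Off the axis the jump of
`arg` is avoided by measuring the angle from a nearby point `ξ₀`; the resulting time differs from
`pageTime` by an integer, which periodicity ignores. -/
theorem continuous_pageField {δ : ℝ → ℂ → ℂ} (hδ : Continuous fun p : ℝ × ℂ => δ p.1 p.2)
    (hper : ∀ t z, δ (t + 1) z = δ t z) {M : ℝ} (hM : ∀ t z, M ≤ ‖z‖ → δ t z = 0) :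
    Continuous (pageField δ) := by
  rw [continuous_iff_continuousAt]
  intro x
  by_cases hx : horiz x = 0
  · have h1 : ∀ᶠ y in nhds x, pageField δ y = 0 := by
      have h2 : ∀ᶠ y in nhds x, ‖horiz y‖ < Real.exp (-M) := by
        refine (continuous_horiz.norm.continuousAt (x := x)).eventually_lt_const ?_
        simpa [hx] using Real.exp_pos (-M)
      filter_upwards [h2] with y hy
      rw [pageField]
      split_ifs with h
      · rfl
      · refine hM _ _ ?_
        have h3 : Real.log ‖horiz y‖ < -M := (Real.log_lt_iff_lt_exp (norm_pos_iff.2 h)).2 hy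
        calc M ≤ (pagePos (horiz y) (y 2)).re := by simp only [pagePos]; linarith
          _ ≤ _ := Complex.re_le_norm _
    have h0 : pageField δ x = 0 := h1.self_of_nhds
    rw [ContinuousAt, h0]
    exact tendsto_const_nhds.congr' (h1.mono fun y hy => hy.symm)
  · set ξ₀ := horiz x with hξ₀
    have hne : ∀ᶠ y in nhds x, horiz y ≠ 0 := continuous_horiz.continuousAt.eventually_ne hx
    have heq : ∀ᶠ y in nhds x, δ (pageTime ξ₀ + pageTime (horiz y / ξ₀))
        (((-Real.log ‖horiz y‖ : ℝ) : ℂ) + ((y 2 : ℝ) : ℂ) * Complex.I) = pageField δ y := by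
      filter_upwards [hne] with y hy
      rw [pageField, if_neg hy]
      have hz : ((-Real.log ‖horiz y‖ : ℝ) : ℂ) + ((y 2 : ℝ) : ℂ) * Complex.I
          = pagePos (horiz y) (y 2) := by
        apply Complex.ext <;> simp [pagePos]
      have hq : horiz y / ξ₀ ≠ 0 := div_ne_zero hy hx
      have h1 : ((Complex.arg ξ₀ + Complex.arg (horiz y / ξ₀) : ℝ) : Real.Angle)
          = ((Complex.arg (horiz y) : ℝ) : Real.Angle) := by
        rw [Real.Angle.coe_add, ← Complex.arg_mul_coe_angle hx hq, mul_div_cancel₀ _ hx]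
      obtain ⟨m, hm⟩ := Real.Angle.angle_eq_iff_two_pi_dvd_sub.1 h1
      rw [hz, ← eq_of_periodic hper _ (-m)]
      congr 1
      have := Real.pi_pos
      simp only [pageTime, Int.cast_neg]
      field_simp
      linarith
    refine ContinuousAt.congr ?_ heq
    have hc : ContinuousAt horiz x := continuous_horiz.continuousAt
    refine ContinuousAt.comp (g := fun p : ℝ × ℂ => δ p.1 p.2)
      (f := fun y => (pageTime ξ₀ + pageTime (horiz y / ξ₀),
        ((-Real.log ‖horiz y‖ : ℝ) : ℂ) + ((y 2 : ℝ) : ℂ) * Complex.I)) hδ.continuousAt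
      (ContinuousAt.prodMk ?_ ?_)
    · refine continuousAt_const.add (ContinuousAt.div_const ?_ _)
      refine ContinuousAt.comp (g := Complex.arg) (Complex.continuousAt_arg ?_) (hc.div_const ξ₀)
      rw [← hξ₀, div_self hx]
      exact Complex.one_mem_slitPlane
    · refine ContinuousAt.add ?_ (by fun_prop)
      refine Complex.continuous_ofReal.continuousAt.comp (ContinuousAt.neg ?_)
      exact hc.norm.log (norm_ne_zero_iff.2 hx)

/-- Displace every point within its page. -/
noncomputable def pagePush (δ : ℝ → ℂ → ℂ) (s : ℝ) (x : EuclideanSpace ℝ (Fin 3)) :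
    EuclideanSpace ℝ (Fin 3) :=
  cylPoint (horiz x * Real.exp (-(s * (pageField δ x).re))) (x 2 + s * (pageField δ x).im)

theorem pagePush_axisPoint {δ : ℝ → ℂ → ℂ} (hper : ∀ t z, δ (t + 1) z = δ t z) (s t : ℝ) (z : ℂ) :
    pagePush δ s (axisPoint t z) = axisPoint t (z + s * δ t z) := by
  rw [pagePush, pageField_axisPoint hper, horiz_axisPoint, axisPoint_eq_cylPoint t (z + _)]
  have h2 : (axisPoint t z) 2 = z.im := by rw [axisPoint_eq_cylPoint, cylPoint_apply_two]
  rw [h2]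
  congr 1
  · rw [mul_right_comm, ← Complex.ofReal_mul, ← Real.exp_add]
    congr 3
    simp
    ring
  · simp

theorem pagePush_of_horiz_eq_zero (δ : ℝ → ℂ → ℂ) (s : ℝ) {x : EuclideanSpace ℝ (Fin 3)}
    (hx : horiz x = 0) : pagePush δ s x = x := by
  have : pageField δ x = 0 := if_pos hx
  rw [pagePush, this]
  conv_rhs => rw [← cylPoint_horiz x]
  simp

/-- A contraction cannot undo the difference of two points, which gives injectivity; a preimage of
`y` is the Banach fixed point of `x ↦ y - k x`. -/
theorem bijective_id_add_of_lipschitz {E : Type*} [NormedAddCommGroup E] [CompleteSpace E]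
    {k : E → E} {K : NNReal} (hK : K < 1) (hk : LipschitzWith K k) :
    Function.Bijective fun x => x + k x := by
  constructor
  · intro x y hxy
    have h1 : dist x y = dist (k x) (k y) := by
      have : x - y = k y - k x := by
        have hxy : x + k x = y + k y := hxy
        rw [sub_eq_sub_iff_add_eq_add, hxy, add_comm]
      rw [dist_eq_norm, this, dist_comm (k x), dist_eq_norm]
    have h2 := hk.dist_le_mul x y
    rw [← h1] at h2
    have hK' : (K : ℝ) < 1 := by exact_mod_cast hK
    have : dist x y ≤ 0 := by nlinarith [dist_nonneg (x := x) (y := y)]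
    exact dist_le_zero.1 this
  · intro y
    have hc : ContractingWith K fun x => y - k x := by
      refine ⟨hK, LipschitzWith.of_dist_le_mul fun a b => ?_⟩
      rw [dist_sub_left]
      exact hk.dist_le_mul a b
    have : Nonempty E := ⟨0⟩
    refine ⟨ContractingWith.fixedPoint _ hc, ?_⟩
    have := hc.fixedPoint_isFixedPt
    rw [Function.IsFixedPt] at this
    exact (sub_eq_iff_eq_add.1 this).symm

/-- The push fixes the axis and preserves each page, acting there as the identity plus a
contraction. The displacement in space is bounded because, up to periodicity, the field lives on a
compact set of times and positions. -/
theorem isIsotopicToId_pagePush {δ : ℝ → ℂ → ℂ} (hδ : Continuous fun p : ℝ × ℂ => δ p.1 p.2)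
    (hper : ∀ t z, δ (t + 1) z = δ t z) {M : ℝ} (hM : ∀ t z, M ≤ ‖z‖ → δ t z = 0)
    {K : NNReal} (hK : K < 1) (hlip : ∀ t, LipschitzWith K (δ t)) :
    IsIsotopicToId (pagePush δ 1) := by
  have hcont : Continuous fun p : ℝ × EuclideanSpace ℝ (Fin 3) => pagePush δ p.1 p.2 := by
    have hf := (continuous_pageField hδ hper hM).comp
      (continuous_snd (X := ℝ) (Y := EuclideanSpace ℝ (Fin 3)))
    have hh := continuous_horiz.comp (continuous_snd (X := ℝ) (Y := EuclideanSpace ℝ (Fin 3)))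
    simp only [Function.comp_def] at hf hh
    unfold pagePush
    refine continuous_cylPoint.comp (Continuous.prodMk ?_ ?_)
    · fun_prop
    · fun_prop
  have hbij : ∀ s ∈ Set.Icc (0 : ℝ) 1, ∀ t, Function.Bijective fun z : ℂ => z + s * δ t z := by
    intro s hs t
    refine bijective_id_add_of_lipschitz hK (LipschitzWith.of_dist_le_mul fun a b => ?_)
    rw [dist_eq_norm, ← mul_sub, norm_mul, Complex.norm_real, Real.norm_of_nonneg hs.1,
      ← dist_eq_norm]
    calc s * dist (δ t a) (δ t b) ≤ 1 * dist (δ t a) (δ t b) :=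
          mul_le_mul_of_nonneg_right hs.2 dist_nonneg
      _ ≤ _ := by rw [one_mul]; exact (hlip t).dist_le_mul a b
  have hcpt : IsCompact (Set.Icc (0 : ℝ) 1 ×ˢ Set.Icc (0 : ℝ) 1 ×ˢ Metric.closedBall (0 : ℂ) M) :=
    isCompact_Icc.prod (isCompact_Icc.prod (isCompact_closedBall _ _))
  obtain ⟨C, hC⟩ := hcpt.exists_bound_of_continuousOn
    (f := fun p : ℝ × ℝ × ℂ => pagePush δ p.1 (axisPoint p.2.1 p.2.2) - axisPoint p.2.1 p.2.2) (by
      have h1 := continuous_axisPoint.comp (continuous_snd (X := ℝ) (Y := ℝ × ℂ))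
      exact ((hcont.comp (continuous_fst.prodMk h1)).sub h1).continuousOn)
  refine isIsotopicToId_of_bijective (pagePush δ) hcont (fun s hs => ⟨?_, ?_⟩) (fun x => ?_)
    (max C 0) (fun s hs x => ?_)
  · intro x y hxy
    have hz : ∀ x, horiz (pagePush δ s x) = 0 ↔ horiz x = 0 := fun x => by
      rw [pagePush, horiz_cylPoint, mul_eq_zero]
      simp
    by_cases hx : horiz x = 0
    · have hy : horiz y = 0 := by rwa [← hz y, ← hxy, hz]
      rwa [pagePush_of_horiz_eq_zero δ s hx, pagePush_of_horiz_eq_zero δ s hy] at hxy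
    · have hy : horiz y ≠ 0 := by rwa [Ne, ← hz y, ← hxy, hz]
      obtain ⟨t, z, rfl⟩ := exists_axisPoint_eq hx
      obtain ⟨u, v, rfl⟩ := exists_axisPoint_eq hy
      rw [pagePush_axisPoint hper, pagePush_axisPoint hper, axisPoint_eq_iff] at hxy
      obtain ⟨⟨m, rfl⟩, h⟩ := hxy
      rw [eq_of_periodic hper] at h
      rw [axisPoint_eq_iff]
      exact ⟨⟨m, rfl⟩, (hbij s hs u).1 h⟩
  · intro y
    by_cases hy : horiz y = 0
    · exact ⟨y, pagePush_of_horiz_eq_zero δ s hy⟩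
    · obtain ⟨u, v, rfl⟩ := exists_axisPoint_eq hy
      obtain ⟨z, hz⟩ := (hbij s hs u).2 v
      exact ⟨axisPoint u z, by rw [pagePush_axisPoint hper]; exact congrArg _ hz⟩
  · rw [pagePush]
    conv_rhs => rw [← cylPoint_horiz x]
    simp
  · by_cases hx : horiz x = 0
    · rw [pagePush_of_horiz_eq_zero δ s hx, dist_self]
      exact le_max_right _ _
    · obtain ⟨t, z, rfl⟩ := exists_axisPoint_eq hx
      have hfr : axisPoint t z = axisPoint (Int.fract t) z :=
        axisPoint_eq_iff.2 ⟨⟨⌊t⌋, (Int.fract_add_floor t).symm⟩, rfl⟩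
      rcases le_total M ‖z‖ with h | h
      · rw [pagePush_axisPoint hper, hM t z h, mul_zero, add_zero, dist_self]
        exact le_max_right _ _
      · rw [hfr, dist_eq_norm]
        refine (hC (s, Int.fract t, z) ⟨hs, ⟨Int.fract_nonneg _, (Int.fract_lt_one _).le⟩, ?_⟩).trans
          (le_max_left _ _)
        simpa using h

/-! ### Homotopic closed braids -/

/-- An ambient isotopy carries the closed braid `f` to `g`, strand by strand and page by page. -/
def Push {n : ℕ} (f g : ℝ → Fin n → ℂ) : Prop :=
  ∃ T, IsIsotopicToId T ∧ ∀ t ∈ Set.Icc (0 : ℝ) 1, ∀ j, T (axisPoint t (f t j)) = axisPoint t (g t j)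

theorem Push.refl {n : ℕ} (f : ℝ → Fin n → ℂ) : Push f f := ⟨_, .id, fun _ _ _ => rfl⟩

theorem Push.trans {n : ℕ} {f g h : ℝ → Fin n → ℂ} (hfg : Push f g) (hgh : Push g h) :
    Push f h := by
  obtain ⟨T, hT, h1⟩ := hfg
  obtain ⟨T', hT', h2⟩ := hgh
  exact ⟨_, hT'.comp hT, fun t ht j => by rw [h1 t ht, h2 t ht]⟩

theorem Push.symm {n : ℕ} {f g : ℝ → Fin n → ℂ} (hfg : Push f g) : Push g f := by
  obtain ⟨T, hT, h1⟩ := hfg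
  obtain ⟨H, hc, h0, hH⟩ := id hT
  have hr : Function.RightInverse (H 1).symm T := fun x => by rw [← hH]; simp
  refine ⟨_, hT.symm hr, fun t ht j => ?_⟩
  rw [Homeomorph.symm_apply_eq, hH, h1 t ht]

theorem Push.congr {n : ℕ} {f f' g g' : ℝ → Fin n → ℂ} (h : Push f g)
    (hf : ∀ t ∈ Set.Icc (0 : ℝ) 1, f t = f' t) (hg : ∀ t ∈ Set.Icc (0 : ℝ) 1, g t = g' t) :
    Push f' g' := by
  obtain ⟨T, hT, h1⟩ := h
  exact ⟨T, hT, fun t ht j => by rw [← hf t ht, ← hg t ht, h1 t ht]⟩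

/-- The displacement field carrying the strands of `f` to those of `g`. -/
noncomputable def strandField {n : ℕ} (f g : ℝ → Fin n → ℂ) (ρ : ℝ) (t : ℝ) (z : ℂ) : ℂ :=
  ∑ j, ((max 0 (1 - ‖z - f t j‖ / ρ) : ℝ) : ℂ) * (g t j - f t j)

/-- Tent functions of radius `ρ` around the strands do not reach the other strands, so the field
moves `f t j` exactly to `g t j`. Each of the `n` terms has Lipschitz constant at most `1 / (n +
1)`, so the sum has constant below `1`. At times `0` and `1` the sums agree, since both braids are
relabelled by the same `π`. -/
theorem push_of_close {n : ℕ} {f g : ℝ → Fin n → ℂ} (hf : ContinuousOn f (Set.Icc 0 1))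
    (hg : ContinuousOn g (Set.Icc 0 1)) {π : Equiv.Perm (Fin n)} (hf1 : f 1 = f 0 ∘ π)
    (hg1 : g 1 = g 0 ∘ π) {ρ : ℝ} (hρ : 0 < ρ)
    (hsep : ∀ t ∈ Set.Icc (0 : ℝ) 1, ∀ j k, j ≠ k → ρ ≤ ‖f t j - f t k‖)
    (hclose : ∀ t ∈ Set.Icc (0 : ℝ) 1, ∀ j, ‖g t j - f t j‖ ≤ ρ / (n + 1)) : Push f g := by
  have hfr : ∀ t : ℝ, Int.fract t ∈ Set.Icc (0 : ℝ) 1 :=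
    fun t => ⟨Int.fract_nonneg _, (Int.fract_lt_one _).le⟩
  obtain ⟨B, hB⟩ := isCompact_Icc.exists_bound_of_continuousOn hf
  have hfj : ∀ j, ContinuousOn (fun t => f t j) (Set.Icc 0 1) := fun j =>
    (continuous_apply j).comp_continuousOn hf
  have hgj : ∀ j, ContinuousOn (fun t => g t j) (Set.Icc 0 1) := fun j =>
    (continuous_apply j).comp_continuousOn hg
  set δ : ℝ → ℂ → ℂ := fun t z => strandField f g ρ (Int.fract t) z with hδ
  have hend : ∀ z, strandField f g ρ 0 z = strandField f g ρ 1 z := fun z => by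
    simp only [strandField, hf1, hg1, Function.comp_apply]
    exact (Equiv.sum_comp π fun j =>
      ((max 0 (1 - ‖z - f 0 j‖ / ρ) : ℝ) : ℂ) * (g 0 j - f 0 j)).symm
  have hcont : Continuous fun p : ℝ × ℂ => δ p.1 p.2 := by
    refine ContinuousOn.comp_fract (β := ℝ × ℂ) (s := fun p => p.1)
      (f := fun p t => strandField f g ρ t p.2) ?_ continuous_fst (fun p => hend p.2)
    simp only [Function.uncurry_def, strandField]
    refine continuousOn_finsetSum _ fun j _ => ?_
    have h1 : ContinuousOn (fun x : (ℝ × ℂ) × ℝ => f x.2 j) (Set.univ ×ˢ Set.Icc 0 1) :=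
      (hfj j).comp continuousOn_snd fun x hx => hx.2
    have h2 : ContinuousOn (fun x : (ℝ × ℂ) × ℝ => g x.2 j) (Set.univ ×ˢ Set.Icc 0 1) :=
      (hgj j).comp continuousOn_snd fun x hx => hx.2
    have h3 : ContinuousOn (fun x : (ℝ × ℂ) × ℝ => x.1.2) (Set.univ ×ˢ Set.Icc (0 : ℝ) 1) := by
      fun_prop
    refine ContinuousOn.mul (Complex.continuous_ofReal.comp_continuousOn ?_) (h2.sub h1)
    exact continuousOn_const.sup (continuousOn_const.sub ((h3.sub h1).norm.div_const ρ))
  have hper : ∀ t z, δ (t + 1) z = δ t z := fun t z => by simp only [hδ, Int.fract_add_one]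
  have hM : ∀ t z, B + ρ ≤ ‖z‖ → δ t z = 0 := by
    intro t z hz
    simp only [hδ, strandField]
    refine Finset.sum_eq_zero fun j _ => ?_
    have h1 : ‖f (Int.fract t) j‖ ≤ B := (norm_le_pi_norm _ j).trans (hB _ (hfr t))
    have h2 : ρ ≤ ‖z - f (Int.fract t) j‖ := by
      have := norm_sub_norm_le z (f (Int.fract t) j)
      linarith
    have h3 : 1 ≤ ‖z - f (Int.fract t) j‖ / ρ := (one_le_div hρ).2 h2
    rw [max_eq_left (by linarith)]
    simp
  let K : NNReal := ⟨n / (n + 1), by positivity⟩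
  have hK : K < 1 := by
    rw [← NNReal.coe_lt_coe]
    change (n : ℝ) / (n + 1) < 1
    rw [div_lt_one (by positivity)]
    linarith
  have hlip : ∀ t, LipschitzWith K (δ t) := by
    intro t
    refine LipschitzWith.of_dist_le_mul fun a b => ?_
    simp only [hδ, strandField, dist_eq_norm]
    rw [← Finset.sum_sub_distrib]
    have hterm : ∀ j ∈ Finset.univ, ‖((max 0 (1 - ‖a - f (Int.fract t) j‖ / ρ) : ℝ) : ℂ) *
        (g (Int.fract t) j - f (Int.fract t) j) -
        ((max 0 (1 - ‖b - f (Int.fract t) j‖ / ρ) : ℝ) : ℂ) *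
        (g (Int.fract t) j - f (Int.fract t) j)‖ ≤ ‖a - b‖ / (n + 1) := by
      intro j _
      rw [← sub_mul, norm_mul, ← Complex.ofReal_sub, Complex.norm_real, Real.norm_eq_abs]
      have h1 : |max 0 (1 - ‖a - f (Int.fract t) j‖ / ρ) -
          max 0 (1 - ‖b - f (Int.fract t) j‖ / ρ)| ≤ ‖a - b‖ / ρ := by
        refine (abs_max_sub_max_le_max _ _ _ _).trans ?_
        rw [sub_self, abs_zero, max_eq_right (abs_nonneg _)]
        have h2 : (1 - ‖a - f (Int.fract t) j‖ / ρ) - (1 - ‖b - f (Int.fract t) j‖ / ρ)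
            = (‖b - f (Int.fract t) j‖ - ‖a - f (Int.fract t) j‖) / ρ := by ring
        rw [h2, abs_div, abs_of_pos hρ]
        refine div_le_div_of_nonneg_right ((abs_norm_sub_norm_le _ _).trans (le_of_eq ?_)) hρ.le
        rw [norm_sub_rev a b]
        congr 1
        ring
      calc _ ≤ ‖a - b‖ / ρ * (ρ / (n + 1)) :=
            mul_le_mul h1 (hclose _ (hfr t) j) (norm_nonneg _) (by positivity)
        _ = _ := by field_simp
    refine (norm_sum_le_of_le _ hterm).trans (le_of_eq ?_)
    rw [Finset.sum_const, Finset.card_univ, Fintype.card_fin, nsmul_eq_mul]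
    change _ = (n : ℝ) / (n + 1) * _
    ring
  refine ⟨_, isIsotopicToId_pagePush hcont hper hM hK hlip, ?_⟩
  have hval : ∀ t ∈ Set.Icc (0 : ℝ) 1, ∀ j, strandField f g ρ t (f t j) = g t j - f t j := by
    intro t ht j
    rw [strandField, Finset.sum_eq_single j]
    · simp
    · intro k _ hkj
      have h3 : 1 ≤ ‖f t j - f t k‖ / ρ := (one_le_div hρ).2 (hsep t ht j k hkj.symm)
      rw [max_eq_left (by linarith)]
      simp
    · simp
  intro t ht j
  rw [pagePush_axisPoint hper]
  have hδt : δ t (f t j) = strandField f g ρ t (f t j) := by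
    rcases ht.2.lt_or_eq with h | rfl
    · simp only [hδ, Int.fract_eq_self.2 ⟨ht.1, h⟩]
    · simp only [hδ, Int.fract_one, hend]
  rw [hδt, hval t ht]
  congr 1
  simp

/-- Closed braids that are homotopic through closed braids are ambient isotopic. -/
theorem push_of_homotopy {n : ℕ} (F : ℝ → ℝ → Fin n → ℂ)
    (hF : ContinuousOn (fun p : ℝ × ℝ => F p.1 p.2) (Set.Icc 0 1 ×ˢ Set.Icc 0 1))
    (hinj : ∀ s ∈ Set.Icc (0 : ℝ) 1, ∀ t ∈ Set.Icc (0 : ℝ) 1, Function.Injective (F s t))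
    (π : Equiv.Perm (Fin n)) (hper : ∀ s ∈ Set.Icc (0 : ℝ) 1, F s 1 = F s 0 ∘ π) :
    Push (F 0) (F 1) := by
  have hcpt : IsCompact (Set.Icc (0 : ℝ) 1 ×ˢ Set.Icc (0 : ℝ) 1) := isCompact_Icc.prod isCompact_Icc
  have hFj : ∀ j, ContinuousOn (fun p : ℝ × ℝ => F p.1 p.2 j) (Set.Icc 0 1 ×ˢ Set.Icc 0 1) :=
    fun j => (continuous_apply j).comp_continuousOn hF
  -- Compactness gives one separation `ρ` for all stages of the homotopy; uniform continuity then
  -- cuts it into `N + 1` steps small enough for `push_of_close`.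
  obtain ⟨ρ, hρ, hsep⟩ : ∃ ρ : ℝ, 0 < ρ ∧ ∀ p ∈ Set.Icc (0 : ℝ) 1 ×ˢ Set.Icc (0 : ℝ) 1,
      ∀ j k, j ≠ k → ρ ≤ ‖F p.1 p.2 j - F p.1 p.2 k‖ := by
    have h1 : ∀ j k, ∀ᶠ ρ in nhdsWithin (0 : ℝ) (Set.Ioi 0), j ≠ k →
        ∀ p ∈ Set.Icc (0 : ℝ) 1 ×ˢ Set.Icc (0 : ℝ) 1, ρ ≤ ‖F p.1 p.2 j - F p.1 p.2 k‖ := by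
      intro j k
      by_cases hjk : j = k
      · exact .of_forall fun _ h => absurd hjk h
      obtain ⟨q, hq, hmin⟩ := hcpt.exists_isMinOn
        ⟨(0, 0), ⟨by simp, by simp⟩⟩ ((hFj j).sub (hFj k)).norm
      have hpos : 0 < ‖F q.1 q.2 j - F q.1 q.2 k‖ := by
        rw [norm_pos_iff, sub_ne_zero]
        exact fun h => hjk (hinj q.1 hq.1 q.2 hq.2 h)
      filter_upwards [nhdsWithin_le_nhds (Iio_mem_nhds hpos)] with ρ hρ _ p hp
      exact (le_of_lt hρ).trans (hmin hp)
    obtain ⟨ρ, h2, hρ⟩ := ((Filter.eventually_all.2 fun j => Filter.eventually_all.2 (h1 j)).and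
      self_mem_nhdsWithin).exists
    exact ⟨ρ, hρ, fun p hp j k hjk => h2 j k hjk p hp⟩
  have hunif := hcpt.uniformContinuousOn_of_continuous hF
  rw [Metric.uniformContinuousOn_iff_le] at hunif
  obtain ⟨d, hd, hclose⟩ := hunif (ρ / (n + 1)) (by positivity)
  obtain ⟨N, hN⟩ := exists_nat_one_div_lt hd
  have key : ∀ k : ℕ, k ≤ N + 1 → Push (F 0) (F (k / (N + 1))) := by
    intro k
    induction k with
    | zero => intro _; simpa using Push.refl (F 0)
    | succ k ih =>
      intro hk
      refine (ih (by omega)).trans ?_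
      have hNp : (0 : ℝ) < N + 1 := by positivity
      have hs : (k : ℝ) / (N + 1) ∈ Set.Icc (0 : ℝ) 1 := by
        refine ⟨by positivity, (div_le_one hNp).2 ?_⟩
        exact_mod_cast (by omega : k ≤ N + 1)
      have hs' : ((k + 1 : ℕ) : ℝ) / (N + 1) ∈ Set.Icc (0 : ℝ) 1 := by
        refine ⟨by positivity, (div_le_one hNp).2 ?_⟩
        exact_mod_cast hk
      have hslice : ∀ s ∈ Set.Icc (0 : ℝ) 1, ContinuousOn (F s) (Set.Icc 0 1) := fun s hs =>
        hF.comp (f := fun t => (s, t)) (by fun_prop) fun t ht => ⟨hs, ht⟩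
      refine push_of_close (hslice _ hs) (hslice _ hs') (hper _ hs) (hper _ hs') hρ
        (fun t ht => hsep (_, t) ⟨hs, ht⟩) (fun t ht j => ?_)
      refine (norm_le_pi_norm (F _ t - F _ t) j).trans ?_
      rw [← dist_eq_norm]
      refine hclose (_, t) ⟨hs', ht⟩ (_, t) ⟨hs, ht⟩ ?_
      rw [Prod.dist_eq, dist_self, max_eq_left dist_nonneg, Real.dist_eq, ← sub_div]
      push_cast
      rw [add_sub_cancel_left, abs_of_pos (by positivity)]
      exact hN.le
  have := key (N + 1) le_rfl
  rwa [Nat.cast_add_one, div_self (by positivity)] at this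

/-! ### Braid words as motions with uniform speed -/

theorem halfTwist_zero (i : ℕ) (ε : Bool) (j : ℕ) : halfTwist i ε 0 j = j := by
  simp [halfTwist]

theorem coe_letterPerm {n : ℕ} (i : Fin (n - 1)) (j : Fin n) :
    (letterPerm i j : ℕ) = if (j : ℕ) = i then (i : ℕ) + 1 else if (j : ℕ) = i + 1 then i else j := by
  unfold letterPerm
  rw [Equiv.swap_apply_def]
  simp only [Fin.ext_iff]
  split_ifs <;> rfl

theorem letterPerm_letterPerm {n : ℕ} (i : Fin (n - 1)) (j : Fin n) :
    letterPerm i (letterPerm i j) = j :=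
  Equiv.swap_apply_self _ _ _

theorem halfTwist_one {n : ℕ} (i : Fin (n - 1)) (ε : Bool) (j : Fin n) :
    halfTwist i ε 1 j = ((letterPerm i j : ℕ) : ℂ) := by
  have h : halfTwist i ε ((1 : unitInterval) : ℝ) j = ((letterPerm i j : ℕ) : ℂ) :=
    congrFun (congrArg Subtype.val (letterPath (i, ε)).target) j
  simpa using h

theorem continuous_halfTwist (i : ℕ) (ε : Bool) (j : ℕ) : Continuous fun t => halfTwist i ε t j := by
  unfold halfTwist
  split_ifs <;> fun_prop

/-- The motion of the points along a braid word: the letter at place `k` is run through during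
`[k, k + 1]`. -/
noncomputable def BraidWord.motion {n : ℕ} : BraidWord n → ℝ → Fin n → ℂ
  | [], _, j => ((j : ℕ) : ℂ)
  | l :: w, τ, j =>
    if τ ≤ 1 then halfTwist l.1 l.2 (max τ 0) j else BraidWord.motion w (τ - 1) (letterPerm l.1 j)

namespace BraidWord

variable {n : ℕ}

theorem motion_of_nonpos (w : BraidWord n) {τ : ℝ} (hτ : τ ≤ 0) (j : Fin n) :
    w.motion τ j = ((j : ℕ) : ℂ) := by
  cases w with
  | nil => rfl
  | cons l w => rw [motion, if_pos (by linarith), max_eq_right hτ, halfTwist_zero]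

theorem motion_cons_of_le (l : Fin (n - 1) × Bool) (w : BraidWord n) {τ : ℝ} (h0 : 0 ≤ τ)
    (h1 : τ ≤ 1) (j : Fin n) : motion (l :: w) τ j = halfTwist l.1 l.2 τ j := by
  rw [motion, if_pos h1, max_eq_left h0]

theorem motion_cons_of_ge (l : Fin (n - 1) × Bool) (w : BraidWord n) {τ : ℝ} (h1 : 1 ≤ τ)
    (j : Fin n) : motion (l :: w) τ j = w.motion (τ - 1) (letterPerm l.1 j) := by
  rcases h1.lt_or_eq with h | rfl
  · rw [motion, if_neg (by linarith)]
  · rw [motion_cons_of_le l w zero_le_one le_rfl, sub_self, motion_of_nonpos w le_rfl,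
      halfTwist_one]

theorem continuous_motion_apply (w : BraidWord n) (j : Fin n) :
    Continuous fun τ => w.motion τ j := by
  induction w generalizing j with
  | nil => exact continuous_const
  | cons l w ih =>
    unfold motion
    refine Continuous.if_le ?_ ?_ continuous_id continuous_const ?_
    · exact (continuous_halfTwist _ _ _).comp (by fun_prop)
    · exact (ih _).comp (by fun_prop)
    · rintro τ rfl
      rw [max_eq_left zero_le_one, sub_self, motion_of_nonpos w le_rfl, halfTwist_one]

theorem continuous_motion (w : BraidWord n) : Continuous w.motion :=
  continuous_pi fun j => w.continuous_motion_apply j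

theorem motion_injective (w : BraidWord n) (τ : ℝ) : Function.Injective (w.motion τ) := by
  induction w generalizing τ with
  | nil => exact fun j k h => Fin.ext (Nat.cast_injective (R := ℂ) h)
  | cons l w ih =>
    intro j k h
    rw [motion, motion] at h
    split_ifs at h
    · exact Fin.ext (halfTwist_injective _ _ _ h)
    · exact (letterPerm l.1).injective (ih _ h)

theorem motion_append_of_le (u v : BraidWord n) {τ : ℝ} (hτ : τ ≤ u.length) (j : Fin n) :
    motion (u ++ v) τ j = u.motion τ j := by
  induction u generalizing τ j with
  | nil => exact motion_of_nonpos _ (by simpa using hτ) j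
  | cons l u ih =>
    rw [List.cons_append, motion, motion]
    split_ifs with h
    · rfl
    · refine ih ?_ _
      rw [List.length_cons, Nat.cast_add_one] at hτ
      linarith

theorem motion_append_of_ge (u v : BraidWord n) {τ : ℝ} (hτ : u.length ≤ τ) (j : Fin n) :
    motion (u ++ v) τ j = v.motion (τ - u.length) (u.perm j) := by
  induction u generalizing τ j with
  | nil => simp [perm]
  | cons l u ih =>
    rw [List.length_cons, Nat.cast_add_one] at hτ
    rw [List.cons_append, motion_cons_of_ge _ _ (by linarith [Nat.cast_nonneg (α := ℝ) u.length]),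
      ih (by linarith), List.length_cons, Nat.cast_add_one, sub_sub, add_comm (1 : ℝ)]
    rfl

theorem motion_of_ge (w : BraidWord n) {τ : ℝ} (hτ : w.length ≤ τ) (j : Fin n) :
    w.motion τ j = ((w.perm j : ℕ) : ℂ) := by
  simpa [motion] using motion_append_of_ge w [] hτ j

theorem perm_append (u v : BraidWord n) : perm (u ++ v) = v.perm * u.perm := by
  induction u with
  | nil => simp [perm]
  | cons l u ih => rw [List.cons_append, perm, perm, ih, mul_assoc]

/-- Concatenation of paths halves the time at every letter, so the geometric braid is the uniform
motion after a change of time. Nonnegativity of `ρ` keeps the induction in the branch after the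
first letter. -/
theorem exists_path_eq_motion (w : BraidWord n) : ∃ ρ : ℝ → ℝ, Continuous ρ ∧ ρ 0 = 0 ∧
    ρ 1 = w.length ∧ (∀ t ∈ Set.Icc (0 : ℝ) 1, 0 ≤ ρ t) ∧
    ∀ (t : unitInterval) (j : Fin n), (w.path t).1 j = w.motion (ρ t) j := by
  induction w with
  | nil => exact ⟨fun _ => 0, continuous_const, rfl, by simp, fun _ _ => le_rfl, fun t j => rfl⟩
  | cons l w ih =>
    obtain ⟨ρ, hρ, h0, h1, hp, h⟩ := ih
    refine ⟨fun t => if t ≤ 1 / 2 then 2 * t else 1 + ρ (2 * t - 1), ?_, ?_, ?_, fun t ht => ?_,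
      fun t j => ?_⟩
    · refine Continuous.if_le (by fun_prop) (by fun_prop) continuous_id continuous_const ?_
      rintro t rfl
      norm_num [h0]
    · norm_num
    · norm_num [h1]
      ring
    · simp only []
      split_ifs with hle
      · linarith [ht.1]
      · linarith [hp (2 * t - 1) ⟨by linarith, by linarith [ht.2]⟩]
    · refine (congrArg (fun c : Conf n => c.1 j) (Path.trans_apply _ _ t)).trans ?_
      have ht0 := t.2.1
      have ht1 := t.2.2
      simp only []
      by_cases ht : (t : ℝ) ≤ 1 / 2
      · rw [dif_pos ht, if_pos ht, motion_cons_of_le _ _ (by linarith) (by linarith)]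
        rfl
      · rw [dif_neg ht, if_neg ht, motion_cons_of_ge _ _ (by
          linarith [hp (2 * t - 1) ⟨by linarith, by linarith⟩]), add_sub_cancel_left]
        exact h ⟨2 * t - 1, by linarith, by linarith⟩ (letterPerm l.1 j)

/-! ### Isotopies of closed braid words -/

/-- Two changes of time are joined by linear interpolation. The motion rests before `0` and after
`w.length`, so inequalities at the ends suffice to keep the braid closed. -/
theorem push_motion_comp (w : BraidWord n) {θ θ' : ℝ → ℝ} (hθ : Continuous θ) (hθ' : Continuous θ')
    (h0 : θ 0 ≤ 0) (h0' : θ' 0 ≤ 0) (h1 : w.length ≤ θ 1) (h1' : w.length ≤ θ' 1) :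
    Push (fun t => w.motion (θ t)) (fun t => w.motion (θ' t)) := by
  have := push_of_homotopy (fun s t => w.motion ((1 - s) * θ t + s * θ' t))
    (Continuous.continuousOn (w.continuous_motion.comp (by fun_prop)))
    (fun s _ t _ => w.motion_injective _) w.perm (fun s hs => by
      funext j
      refine (motion_of_ge _ ?_ j).trans (motion_of_nonpos _ ?_ _).symm
      · nlinarith [hs.1, hs.2]
      · nlinarith [hs.1, hs.2])
  simpa using this

/-- The motion along a braid word, in unit time. -/
noncomputable def loop (w : BraidWord n) (t : ℝ) : Fin n → ℂ := w.motion (w.length * t)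

/-- The closures of two braid words are isotopic. -/
def SameLink {m : ℕ} (w : BraidWord n) (w' : BraidWord m) : Prop :=
  (closedBraid w.path).Isotopic (closedBraid w'.path)

theorem SameLink.trans {m k : ℕ} {u : BraidWord n} {v : BraidWord m} {w : BraidWord k}
    (h : SameLink u v) (h' : SameLink v w) : SameLink u w :=
  OrientedLink.Isotopic.trans h h'

theorem SameLink.symm {m : ℕ} {u : BraidWord n} {v : BraidWord m} (h : SameLink u v) :
    SameLink v u :=
  OrientedLink.Isotopic.symm h

theorem push_path_loop (w : BraidWord n) :
    Push (fun t => (w.path.extend t).1) w.loop := by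
  obtain ⟨ρ, hρ, h0, h1, -, h⟩ := w.exists_path_eq_motion
  refine (w.push_motion_comp hρ (by fun_prop) h0.le (by simp) h1.ge (by simp)).congr
    (fun t ht => ?_) (fun t _ => rfl)
  funext j
  rw [Path.extend_apply _ ht, h]

theorem sameLink_of_push {w w' : BraidWord n} (σ : Equiv.Perm (Fin n))
    (h : Push w.loop (fun t => w'.loop t ∘ σ)) : SameLink w w' := by
  have h' : Push (fun t => w'.loop t ∘ σ) (fun t => (w'.path.extend t).1 ∘ σ) := by
    obtain ⟨T, hT, h1⟩ := (push_path_loop w').symm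
    exact ⟨T, hT, fun t ht j => h1 t ht (σ j)⟩
  obtain ⟨T, hT, hp⟩ := ((push_path_loop w).trans h).trans h'
  refine closedBraid_isotopic_of_image _ _ hT (fun t ht j => ⟨t, ht, σ j, hp t ht j⟩)
    (fun j' => ⟨0, by simp, σ.symm j', 0, by simp, ?_⟩)
    (fun j => ⟨0, 1 / 2, le_rfl, by norm_num, by norm_num, σ j, fun t ht =>
      hp t ⟨ht.1, ht.2.trans (by norm_num)⟩ j⟩)
  rw [hp 0 (by simp)]
  simp

theorem sameLink_refl (w : BraidWord n) : SameLink w w :=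
  sameLink_of_push 1 (Push.refl _)

/-- A window of length `|u| + |v|` slides along the motion of `u ++ v ++ u`, from `u ++ v` to `v ++
u`. Its final strands carry the labels they had before `u`, whence the relabelling by `u.perm`. -/
theorem sameLink_append_comm (u v : BraidWord n) : SameLink (u ++ v) (v ++ u) := by
  refine sameLink_of_push u.perm ?_
  have hl : ((u ++ v).length : ℝ) = u.length + v.length := by push_cast [List.length_append]; rfl
  have hl' : ((v ++ u).length : ℝ) = u.length + v.length := by
    push_cast [List.length_append]; ring
  have hu := Nat.cast_nonneg (α := ℝ) u.length
  have hv := Nat.cast_nonneg (α := ℝ) v.length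
  have := push_of_homotopy
    (fun s t => motion (u ++ v ++ u) (s * u.length + (u.length + v.length) * t))
    (Continuous.continuousOn ((continuous_motion _).comp (by fun_prop)))
    (fun s _ t _ => motion_injective _ _) (perm (u ++ v)) (fun s hs => by
      funext j
      have hs1 : s * u.length ≤ u.length := mul_le_of_le_one_left hu hs.2
      have hs0 : 0 ≤ s * u.length := mul_nonneg hs.1 hu
      rw [Function.comp_apply, motion_append_of_ge _ _ (by rw [hl]; linarith), hl,
        List.append_assoc, motion_append_of_le _ _ (by linarith)]
      congr 1
      ring)
  refine this.congr (fun t ht => ?_) (fun t ht => ?_)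
  · funext j
    rw [loop, motion_append_of_le _ _ (by rw [hl]; nlinarith [ht.2]), hl, zero_mul, zero_add]
  · funext j
    rw [loop, List.append_assoc, motion_append_of_ge _ _ (by nlinarith [ht.1]), hl']
    simp

/-- The inverse letter, seen from the exchanged positions, is the letter run backwards. -/
theorem halfTwist_not_sub (i : Fin (n - 1)) (ε : Bool) (t : ℝ) (j : Fin n) :
    halfTwist i (!ε) t (letterPerm i j) = halfTwist i ε (1 - t) j := by
  have he : Complex.exp ((if ε then 1 else -1) * Real.pi * (1 - t : ℝ) * Complex.I) =
      -Complex.exp ((if (!ε) then 1 else -1) * Real.pi * t * Complex.I) := by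
    cases ε
    · simp only [Bool.false_eq_true, if_false, Bool.not_false, if_true]
      have : (-1 * Real.pi * ((1 - t : ℝ) : ℂ) * Complex.I) =
          1 * Real.pi * t * Complex.I - Real.pi * Complex.I := by push_cast; ring
      rw [this, Complex.exp_sub_pi_mul_I]
    · simp only [if_true, Bool.not_true, Bool.false_eq_true, if_false]
      have : (1 * Real.pi * ((1 - t : ℝ) : ℂ) * Complex.I) =
          -1 * Real.pi * t * Complex.I + Real.pi * Complex.I := by push_cast; ring
      rw [this, Complex.exp_add_pi_mul_I]
  unfold halfTwist
  rw [he, coe_letterPerm]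
  by_cases h0 : (j : ℕ) = i
  · simp [h0]
    ring
  · by_cases h1 : (j : ℕ) = i + 1
    · simp [h1]
      ring
    · simp [h0, h1]

theorem sameLink_cancel (i : Fin (n - 1)) (ε : Bool) (w : BraidWord n) :
    SameLink ((i, ε) :: (i, !ε) :: w) w := by
  refine sameLink_of_push 1 ?_
  set F : ℝ → ℝ → Fin n → ℂ := fun s t j =>
    if (w.length + 2) * t ≤ 2 then
      halfTwist i ε ((1 - s) * max 0 (min ((w.length + 2) * t) (2 - (w.length + 2) * t))) j
    else w.motion ((w.length + 2) * t - 2) j with hF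
  have hge : ∀ s t : ℝ, 2 ≤ ((w.length : ℝ) + 2) * t → F s t = w.motion ((w.length + 2) * t - 2) := by
    intro s t ht
    funext j
    simp only [hF]
    split_ifs with h
    · have h2 : (w.length + 2) * t = 2 := le_antisymm h ht
      rw [h2, sub_self, min_eq_right (by norm_num), max_self, mul_zero, halfTwist_zero,
        motion_of_nonpos _ le_rfl]
    · rfl
  have hcont : Continuous fun p : ℝ × ℝ => F p.1 p.2 := by
    refine continuous_pi fun j => ?_
    refine Continuous.if_le ?_ ?_ (by fun_prop) continuous_const ?_
    · exact (continuous_halfTwist _ _ _).comp (by fun_prop)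
    · exact (w.continuous_motion_apply j).comp (by fun_prop)
    · intro p hp
      rw [hp, sub_self, min_eq_right (by norm_num), max_self, mul_zero, halfTwist_zero,
        motion_of_nonpos _ le_rfl]
  have hN := Nat.cast_nonneg (α := ℝ) w.length
  have h1 := push_of_homotopy F hcont.continuousOn (fun s _ t _ j k h => by
      simp only [hF] at h
      split_ifs at h
      · exact Fin.ext (halfTwist_injective _ _ _ h)
      · exact w.motion_injective _ h) w.perm (fun s _ => by
      funext j
      rw [hge s 1 (by linarith), motion_of_ge _ (by linarith)]
      simp [hF, halfTwist_zero])
  have h2 := w.push_motion_comp (θ := fun t => (w.length + 2) * t - 2)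
    (θ' := fun t => w.length * t) (by fun_prop) (by fun_prop) (by norm_num) (by simp)
    (by simp) (by simp)
  have hl : ((((i, ε) :: (i, !ε) :: w : List (Fin (n - 1) × Bool)).length : ℕ) : ℝ)
      = w.length + 2 := by
    push_cast [List.length_cons]; ring
  refine (h1.congr (fun t ht => ?_) (fun t ht => ?_)).trans h2
  · rw [loop, hl]
    have h0 : 0 ≤ (w.length + 2) * t := mul_nonneg (by positivity) ht.1
    rcases le_total 2 ((w.length + 2) * t) with h | h
    · funext j
      rw [hge 0 t h, motion_cons_of_ge _ _ (by linarith), motion_cons_of_ge _ _ (by linarith)]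
      simp only [letterPerm_letterPerm]
      congr 1
      ring
    · funext j
      simp only [hF]
      rw [if_pos h, sub_zero, one_mul, max_eq_right (le_min h0 (by linarith))]
      rcases le_total 1 ((w.length + 2) * t) with h' | h'
      · rw [motion_cons_of_ge _ _ h', motion_cons_of_le _ _ (by linarith) (by linarith),
          min_eq_right (by linarith), halfTwist_not_sub]
        congr 1
        ring
      · rw [motion_cons_of_le _ _ h0 h', min_eq_left (by linarith)]
  · rcases le_total 2 ((w.length + 2) * t) with h | h
    · rw [hge 1 t h]
    · funext j
      simp only [hF]
      rw [if_pos h, sub_self, zero_mul, halfTwist_zero, motion_of_nonpos _ (by linarith)]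

/-! ### Braid relations -/

/-- Raising strand `j` by a multiple of `j` only widens the gaps when larger labels already pass
above smaller ones, so no collision occurs. -/
theorem push_of_lift_aux {f : ℝ → Fin n → ℂ} {H : ℝ → ℝ} (hf : Continuous f) (hH : Continuous H)
    {π : Equiv.Perm (Fin n)} (hf1 : f 1 = f 0 ∘ π) (h0 : H 0 = 0) (h1 : H 1 = 0)
    (hHn : ∀ t ∈ Set.Icc (0 : ℝ) 1, 0 ≤ H t)
    (h : ∀ t ∈ Set.Icc (0 : ℝ) 1, (H t = 0 ∧ Function.Injective (f t)) ∨
      ∀ j k, j < k → (f t k - f t j).re = 0 → 0 < (f t k - f t j).im) :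
    Push f (fun t j => f t j + (H t * (j : ℕ) : ℝ) * Complex.I) := by
  have := push_of_homotopy (fun s t j => f t j + (s * H t * (j : ℕ) : ℝ) * Complex.I)
    (Continuous.continuousOn (by fun_prop)) (fun s hs t ht => ?_) π (fun s _ => ?_)
  · simpa using this
  · rcases h t ht with ⟨hz, hi⟩ | hl
    · simpa [hz] using hi
    · have key : ∀ j k, j < k → f t j + (s * H t * (j : ℕ) : ℝ) * Complex.I ≠
          f t k + (s * H t * (k : ℕ) : ℝ) * Complex.I := by
        intro j k hjk he
        have hre := congrArg Complex.re he
        have him := congrArg Complex.im he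
        simp only [Complex.add_re, Complex.add_im, Complex.re_ofReal_mul, Complex.im_ofReal_mul,
          Complex.I_re, Complex.I_im, mul_zero, mul_one, add_zero] at hre him
        have h2 := hl j k hjk (by rw [Complex.sub_re]; linarith)
        rw [Complex.sub_im] at h2
        have h3 : (j : ℝ) < k := by exact_mod_cast hjk
        have h4 := mul_nonneg hs.1 (hHn t ht)
        nlinarith
      intro j k he
      rcases lt_trichotomy j k with hjk | hjk | hjk
      · exact absurd he (key j k hjk)
      · exact hjk
      · exact absurd he.symm (key k j hjk)
  · funext j
    simp [h0, h1, hf1]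

/-- Two closed braids are isotopic if, where they differ, every strand with a larger label passes
above the strands with smaller labels. -/
theorem push_of_layered {f g : ℝ → Fin n → ℂ} {H : ℝ → ℝ} (hf : Continuous f) (hg : Continuous g)
    (hH : Continuous H) {π : Equiv.Perm (Fin n)} (hf1 : f 1 = f 0 ∘ π) (hg1 : g 1 = g 0 ∘ π)
    (h0 : H 0 = 0) (h1 : H 1 = 0)
    (h : ∀ t ∈ Set.Icc (0 : ℝ) 1, (f t = g t ∧ H t = 0 ∧ Function.Injective (f t)) ∨
      (0 < H t ∧ ∀ j k, j < k →
        ((f t k - f t j).re = 0 → 0 < (f t k - f t j).im) ∧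
        ((g t k - g t j).re = 0 → 0 < (g t k - g t j).im) ∧
        |(f t k - f t j).im| < H t ∧ |(g t k - g t j).im| < H t)) : Push f g := by
  have hHn : ∀ t ∈ Set.Icc (0 : ℝ) 1, 0 ≤ H t := fun t ht => by
    rcases h t ht with h | h
    · exact h.2.1.ge
    · exact h.1.le
  have hF := push_of_lift_aux hf hH hf1 h0 h1 hHn (fun t ht => by
    rcases h t ht with h | h
    · exact .inl h.2
    · exact .inr fun j k hjk => (h.2 j k hjk).1)
  have hG := push_of_lift_aux hg hH hg1 h0 h1 hHn (fun t ht => by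
    rcases h t ht with h | h
    · exact .inl ⟨h.2.1, h.1 ▸ h.2.2⟩
    · exact .inr fun j k hjk => (h.2 j k hjk).2.1)
  refine hF.trans (Push.trans ?_ hG.symm)
  -- After lifting, consecutive labels are `H t` apart in height, more than the original heights
  -- differ, so linear interpolation between the two lifted braids is free of collisions.
  have := push_of_homotopy (fun s t j => (1 - s : ℝ) * f t j + (s : ℝ) * g t j +
      (H t * (j : ℕ) : ℝ) * Complex.I) (Continuous.continuousOn (by fun_prop))
      (fun s hs t ht => ?_) π (fun s _ => ?_)
  · simpa using this
  · rcases h t ht with ⟨hfg, hz, hi⟩ | ⟨hpos, hl⟩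
    · have : ∀ j, ((1 - s : ℝ) : ℂ) * f t j + (s : ℝ) * g t j + (H t * (j : ℕ) : ℝ) * Complex.I
          = f t j := fun j => by
        rw [← hfg, hz]
        push_cast
        ring
      simpa only [this] using hi
    · have key : ∀ j k, j < k →
          ((1 - s : ℝ) : ℂ) * f t j + (s : ℝ) * g t j + (H t * (j : ℕ) : ℝ) * Complex.I ≠
          ((1 - s : ℝ) : ℂ) * f t k + (s : ℝ) * g t k + (H t * (k : ℕ) : ℝ) * Complex.I := by
        intro j k hjk he
        have him := congrArg Complex.im he
        simp only [Complex.add_im, Complex.im_ofReal_mul, Complex.I_im, mul_one] at him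
        obtain ⟨-, -, h2, h3⟩ := hl j k hjk
        rw [Complex.sub_im, abs_lt] at h2 h3
        have h4 : (j : ℝ) + 1 ≤ k := by exact_mod_cast hjk
        have h5 : H t ≤ H t * k - H t * j := by nlinarith
        nlinarith [hs.1, hs.2, mul_nonneg hs.1 (sub_nonneg.2 h3.1.le),
          mul_nonneg (sub_nonneg.2 hs.2) (sub_nonneg.2 h2.1.le)]
      intro j k he
      rcases lt_trichotomy j k with hjk | hjk | hjk
      · exact absurd he (key j k hjk)
      · exact hjk
      · exact absurd he.symm (key k j hjk)
  · funext j
    simp [h0, h1, hf1, hg1]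

/-! ### Positive half twists in coordinates, and layered words. -/

theorem halfTwist_true_left (i : ℕ) (t : ℝ) : halfTwist i true t i =
    ((i + 1 / 2 - Real.cos (Real.pi * t) / 2 : ℝ) : ℂ) +
      ((-Real.sin (Real.pi * t) / 2 : ℝ) : ℂ) * Complex.I := by
  rw [halfTwist, if_pos (Or.inl rfl), if_pos rfl, one_mul, ← Complex.ofReal_mul, Complex.exp_mul_I]
  push_cast
  ring

theorem halfTwist_true_right (i : ℕ) (t : ℝ) : halfTwist i true t (i + 1) =
    ((i + 1 / 2 + Real.cos (Real.pi * t) / 2 : ℝ) : ℂ) +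
      ((Real.sin (Real.pi * t) / 2 : ℝ) : ℂ) * Complex.I := by
  have : ((i + 1 : ℕ) : ℂ) = i + 1 := by push_cast; rfl
  rw [halfTwist, if_pos (Or.inr rfl), if_pos rfl, one_mul, ← Complex.ofReal_mul, Complex.exp_mul_I,
    this]
  push_cast
  ring

theorem halfTwist_re_mem (i : ℕ) (ε : Bool) (t : ℝ) {j : ℕ} (hj : j = i ∨ j = i + 1) :
    (i : ℝ) ≤ (halfTwist i ε t j).re ∧ (halfTwist i ε t j).re ≤ i + 1 := by
  set x : ℂ := Complex.exp ((if ε then 1 else -1) * Real.pi * t * Complex.I) with hx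
  have hn : ‖x‖ = 1 := by
    have : ((if ε then 1 else -1) * Real.pi * t * Complex.I : ℂ)
        = (((if ε then 1 else -1) * Real.pi * t : ℝ) : ℂ) * Complex.I := by
      push_cast; split_ifs <;> simp
    rw [hx, this, Complex.norm_exp_ofReal_mul_I]
  have h1 := abs_le.1 ((Complex.abs_re_le_norm x).trans hn.le)
  have h2 : halfTwist i ε t j = ((i + 1 / 2 : ℝ) : ℂ) + ((j - (i + 1 / 2) : ℝ) : ℂ) * x := by
    rw [halfTwist, if_pos hj]
    push_cast
    ring
  rw [h2, Complex.add_re, Complex.ofReal_re, Complex.re_ofReal_mul]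
  rcases hj with rfl | rfl
  · constructor <;> linarith
  · push_cast
    constructor <;> linarith

theorem halfTwist_of_ne {i j : ℕ} (ε : Bool) (t : ℝ) (hj : ¬ (j = i ∨ j = i + 1)) :
    halfTwist i ε t j = j := if_neg hj

theorem halfTwist_re_lt (i : ℕ) (t : ℝ) {j k : ℕ} (hjk : j < k) (h : ¬ (j = i ∧ k = i + 1)) :
    (halfTwist i true t j).re < (halfTwist i true t k).re := by
  by_cases hj : j = i ∨ j = i + 1 <;> by_cases hk : k = i ∨ k = i + 1
  · omega
  · have h1 := (halfTwist_re_mem i true t hj).2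
    rw [halfTwist_of_ne true t hk, Complex.natCast_re]
    have : (i : ℝ) + 1 < k := by exact_mod_cast (by omega : i + 1 < k)
    linarith
  · have h1 := (halfTwist_re_mem i true t hk).1
    rw [halfTwist_of_ne true t hj, Complex.natCast_re]
    have : (j : ℝ) < i := by exact_mod_cast (by omega : j < i)
    linarith
  · rw [halfTwist_of_ne true t hj, halfTwist_of_ne true t hk, Complex.natCast_re,
      Complex.natCast_re]
    exact_mod_cast hjk

theorem halfTwist_im_lt (i : ℕ) {t : ℝ} (ht : t ∈ Set.Icc (0 : ℝ) 1)
    (h : (halfTwist i true t (i + 1)).re = (halfTwist i true t i).re) :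
    (halfTwist i true t i).im < (halfTwist i true t (i + 1)).im := by
  rw [halfTwist_true_left, halfTwist_true_right] at *
  simp only [Complex.add_re, Complex.re_ofReal_mul, Complex.ofReal_re, Complex.I_re,
    Complex.add_im, Complex.im_ofReal_mul, Complex.ofReal_im, Complex.I_im] at *
  have h0 : Real.cos (Real.pi * t) = 0 := by linarith
  have h1 := Real.sin_sq_add_cos_sq (Real.pi * t)
  have h2 : 0 ≤ Real.sin (Real.pi * t) := Real.sin_nonneg_of_nonneg_of_le_pi
    (mul_nonneg Real.pi_pos.le ht.1) (mul_le_of_le_one_right Real.pi_pos.le ht.2)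
  nlinarith

/-- Along the braid word the points `j` and `k` stay in this order. -/
def Separated (w : BraidWord n) (j k : Fin n) : Prop := ∀ τ, (w.motion τ j).re < (w.motion τ k).re

/-- Along the braid word points with larger labels pass above points with smaller labels. -/
def Layered (w : BraidWord n) : Prop := ∀ j k, j < k → ∀ τ,
  (w.motion τ k).re = (w.motion τ j).re → (w.motion τ j).im < (w.motion τ k).im

theorem separated_nil {j k : Fin n} (h : j < k) : Separated ([] : BraidWord n) j k := fun τ => by
  simpa [motion] using h

theorem layered_nil : Layered ([] : BraidWord n) := fun _ _ h τ he =>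
  absurd he (separated_nil h τ).ne'

theorem Separated.cons {i : Fin (n - 1)} {w : BraidWord n} {j k : Fin n}
    (h : w.Separated (letterPerm i j) (letterPerm i k)) (hjk : j < k)
    (hi : ¬ ((j : ℕ) = i ∧ (k : ℕ) = i + 1)) : Separated ((i, true) :: w : BraidWord n) j k := by
  intro τ
  rw [motion, motion]
  split_ifs
  · exact halfTwist_re_lt _ _ hjk hi
  · exact h _

/-- In a positive letter the right strand passes above the left one, as layering demands. Afterwards
this pair stands in reversed order, so a second crossing would be the wrong way round; `hs` excludes
it. All other pairs keep their order and are handled by `h`. -/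
theorem Layered.cons {i : Fin (n - 1)} {w : BraidWord n} (h : w.Layered)
    (hs : w.Separated ⟨i, by omega⟩ ⟨i + 1, by omega⟩) :
    Layered ((i, true) :: w : BraidWord n) := by
  intro j k hjk τ
  rw [motion, motion]
  by_cases hi : (j : ℕ) = i ∧ (k : ℕ) = i + 1
  · split_ifs with hτ
    · rw [hi.1, hi.2]
      exact halfTwist_im_lt i ⟨le_max_right _ _, max_le hτ zero_le_one⟩
    · have hj : letterPerm i j = ⟨i + 1, by omega⟩ := Fin.ext (by simp [coe_letterPerm, hi.1])
      have hk : letterPerm i k = ⟨i, by omega⟩ := Fin.ext (by simp [coe_letterPerm, hi.2])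
      rw [hj, hk]
      exact fun he => absurd he (hs _).ne
  · split_ifs with hτ
    · exact fun he => absurd he (halfTwist_re_lt _ _ hjk hi).ne'
    · refine h _ _ ?_ _
      rw [Fin.lt_def] at hjk ⊢
      rw [coe_letterPerm, coe_letterPerm]
      dsimp only
      split_ifs <;> omega

/-- Both prefixes consist of strands stacked by label, so only the permutation matters. The lifting
is confined to the time of the prefix; afterwards the two motions coincide. -/
theorem sameLink_append_of_layered {u v : BraidWord n} (hu : u.Layered) (hv : v.Layered)
    (hlen : u.length = v.length) (hperm : u.perm = v.perm) (w : BraidWord n) :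
    SameLink (u ++ w) (v ++ w) := by
  refine sameLink_of_push 1 ?_
  have hl : ((u ++ w).length : ℝ) = u.length + w.length := by push_cast [List.length_append]; rfl
  have hl' : ((v ++ w).length : ℝ) = u.length + w.length := by
    rw [hlen]; push_cast [List.length_append]; rfl
  have hN := Nat.cast_nonneg (α := ℝ) u.length
  have hM := Nat.cast_nonneg (α := ℝ) w.length
  -- The parabola makes `H` positive strictly inside the prefix; twice the sum bounds every
  -- difference of two heights. Both parts vanish outside, where all points rest on the real axis.
  set H : ℝ → ℝ := fun τ => max 0 (τ * (u.length - τ)) +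
    2 * ∑ j, (|(u.motion τ j).im| + |(v.motion τ j).im|) with hH
  have hHc : Continuous H := by
    have h1 : ∀ j, Continuous fun τ => (u.motion τ j).im := fun j =>
      Complex.continuous_im.comp (u.continuous_motion_apply j)
    have h2 : ∀ j, Continuous fun τ => (v.motion τ j).im := fun j =>
      Complex.continuous_im.comp (v.continuous_motion_apply j)
    refine Continuous.add (by fun_prop) (continuous_const.mul (continuous_finsetSum _ fun j _ => ?_))
    exact (h1 j).abs.add (h2 j).abs
  have hH0 : ∀ τ : ℝ, τ ≤ 0 ∨ u.length ≤ τ → H τ = 0 := by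
    intro τ hτ
    have h1 : τ * (u.length - τ) ≤ 0 := by
      rcases hτ with h | h
      · exact mul_nonpos_of_nonpos_of_nonneg h (by linarith)
      · exact mul_nonpos_of_nonneg_of_nonpos (by linarith) (by linarith)
    have h2 : ∀ j, (u.motion τ j).im = 0 ∧ (v.motion τ j).im = 0 := by
      intro j
      rcases hτ with h | h
      · simp [motion_of_nonpos _ h]
      · rw [motion_of_ge _ h, motion_of_ge _ (hlen ▸ h)]
        simp
    simp [hH, h1, h2]
  have hlt : ∀ (x : BraidWord n), (∀ τ j, |(x.motion τ j).im| ≤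
      |(u.motion τ j).im| + |(v.motion τ j).im|) → ∀ τ : ℝ, 0 < τ → τ < u.length → ∀ j k,
      |(x.motion τ k - x.motion τ j).im| < H τ := by
    intro x hx τ h0 h1 j k
    have h2 : ∀ j, |(x.motion τ j).im| ≤ ∑ j, (|(u.motion τ j).im| + |(v.motion τ j).im|) :=
      fun j => (hx τ j).trans (Finset.single_le_sum
        (f := fun j => |(u.motion τ j).im| + |(v.motion τ j).im|)
        (fun _ _ => by positivity) (Finset.mem_univ j))
    have h3 : 0 < τ * (u.length - τ) := mul_pos h0 (by linarith)
    have h4 := abs_sub (x.motion τ k).im (x.motion τ j).im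
    have h5 := h2 j
    have h6 := h2 k
    have h7 : H τ = τ * (u.length - τ) +
      2 * ∑ j, (|(u.motion τ j).im| + |(v.motion τ j).im|) := by
      simp only [hH]
      rw [max_eq_right h3.le]
    rw [Complex.sub_im, h7]
    linarith
  have hfu : ∀ τ : ℝ, τ ≤ u.length → motion (u ++ w) τ = u.motion τ := fun τ h =>
    funext fun j => motion_append_of_le u w h j
  have hfv : ∀ τ : ℝ, τ ≤ u.length → motion (v ++ w) τ = v.motion τ := fun τ h =>
    funext fun j => motion_append_of_le v w (hlen ▸ h) j
  have hend : ∀ x : BraidWord n, (x.length : ℝ) = u.length + w.length →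
      x.motion ((u.length + w.length) * 1) = x.motion ((u.length + w.length) * 0) ∘ x.perm := by
    intro x hx
    funext j
    rw [Function.comp_apply, motion_of_ge _ (by rw [hx]; linarith),
      motion_of_nonpos _ (by linarith)]
  have := push_of_layered (f := fun t => motion (u ++ w) ((u.length + w.length) * t))
    (g := fun t => motion (v ++ w) ((u.length + w.length) * t))
    (H := fun t => H ((u.length + w.length) * t)) (π := perm (u ++ w))
    ((continuous_motion _).comp (by fun_prop)) ((continuous_motion _).comp (by fun_prop))
    (hHc.comp (by fun_prop)) (hend _ hl) (by
      rw [perm_append, hperm, ← perm_append]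
      exact hend _ hl') (hH0 _ (Or.inl (by linarith))) (hH0 _ (Or.inr (by linarith)))
    (fun t ht => by
      generalize ((u.length : ℝ) + w.length) * t = τ
      rcases le_or_gt τ 0 with h0 | h0
      · refine .inl ⟨?_, hH0 _ (Or.inl h0), motion_injective _ _⟩
        funext j
        rw [motion_of_nonpos _ h0, motion_of_nonpos _ h0]
      rcases le_or_gt (u.length : ℝ) τ with h1 | h1
      · refine .inl ⟨?_, hH0 _ (Or.inr h1), motion_injective _ _⟩
        funext j
        rw [motion_append_of_ge _ _ h1, motion_append_of_ge _ _ (hlen ▸ h1), hperm, hlen]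
      have hu' := hlt u (fun τ j => le_add_of_nonneg_right (abs_nonneg _)) τ h0 h1
      have hv' := hlt v (fun τ j => le_add_of_nonneg_left (abs_nonneg _)) τ h0 h1
      rw [hfu τ h1.le, hfv τ h1.le]
      refine .inr ⟨?_, fun j k hjk => ⟨fun h => ?_, fun h => ?_, hu' j k, hv' j k⟩⟩
      · have : 0 < τ * (u.length - τ) := mul_pos h0 (by linarith)
        exact add_pos_of_pos_of_nonneg (lt_max_of_lt_right this) (by positivity)
      · rw [Complex.sub_im, sub_pos]
        exact hu j k hjk τ (by rwa [Complex.sub_re, sub_eq_zero] at h)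
      · rw [Complex.sub_im, sub_pos]
        exact hv j k hjk τ (by rwa [Complex.sub_re, sub_eq_zero] at h))
  refine this.congr (fun t _ => ?_) (fun t _ => ?_)
  · rw [loop, hl]
  · funext j
    rw [loop, hl']
    rfl

theorem sameLink_far_comm {i j : Fin (n - 1)} (h : (i : ℕ) + 2 ≤ j) (w : BraidWord n) :
    SameLink ([(i, true), (j, true)] ++ w) ([(j, true), (i, true)] ++ w) := by
  refine sameLink_append_of_layered (u := [(i, true), (j, true)]) (v := [(j, true), (i, true)])
    ?_ ?_ rfl ?_ w
  · refine (layered_nil.cons (separated_nil ?_)).cons (Separated.cons (separated_nil ?_) ?_ ?_) <;>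
      simp [Fin.lt_def, coe_letterPerm]
    all_goals first | omega | (split_ifs <;> omega)
  · refine (layered_nil.cons (separated_nil ?_)).cons (Separated.cons (separated_nil ?_) ?_ ?_) <;>
      simp [Fin.lt_def, coe_letterPerm]
    all_goals first | omega | (split_ifs <;> omega)
  · ext k
    simp only [perm, Equiv.Perm.mul_apply, Equiv.Perm.one_apply, coe_letterPerm]
    split_ifs <;> omega

/-- On each side every pair of the three strands crosses exactly once and positively, so both words
are layered, with equal length and permutation. -/
theorem sameLink_braid {i j : Fin (n - 1)} (h : (i : ℕ) + 1 = j) (w : BraidWord n) :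
    SameLink ([(i, true), (j, true), (i, true)] ++ w) ([(j, true), (i, true), (j, true)] ++ w) := by
  refine sameLink_append_of_layered (u := [(i, true), (j, true), (i, true)])
    (v := [(j, true), (i, true), (j, true)]) ?_ ?_ rfl ?_ w
  · refine ((layered_nil.cons (separated_nil ?_)).cons
      (Separated.cons (separated_nil ?_) ?_ ?_)).cons
      (Separated.cons (Separated.cons (separated_nil ?_) ?_ ?_) ?_ ?_) <;>
      simp [Fin.lt_def, coe_letterPerm]
    all_goals first | omega | (split_ifs <;> omega)
  · refine ((layered_nil.cons (separated_nil ?_)).cons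
      (Separated.cons (separated_nil ?_) ?_ ?_)).cons
      (Separated.cons (Separated.cons (separated_nil ?_) ?_ ?_) ?_ ?_) <;>
      simp [Fin.lt_def, coe_letterPerm]
    all_goals first | omega | (split_ifs <;> omega)
  · ext k
    have h1 := coe_letterPerm i k
    have h2 := coe_letterPerm j (letterPerm i k)
    have h3 := coe_letterPerm i (letterPerm j (letterPerm i k))
    have h4 := coe_letterPerm j k
    have h5 := coe_letterPerm i (letterPerm j k)
    have h6 := coe_letterPerm j (letterPerm i (letterPerm j k))
    simp only [perm, Equiv.Perm.mul_apply, Equiv.Perm.one_apply]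
    grind

end BraidWord

/-! ### The closure of an element of the braid group -/

namespace BraidWord

variable {n : ℕ}

/-- Two braid words can be exchanged in every closed braid word. -/
def interchangeable (n : ℕ) : Con (FreeMonoid (Fin (n - 1) × Bool)) where
  r u v := ∀ w : BraidWord n, SameLink (n := n) (FreeMonoid.toList u ++ w) (FreeMonoid.toList v ++ w)
  iseqv := ⟨fun u w => sameLink_refl (n := n) _, fun h w => (h w).symm,
    fun h h' w => (h w).trans (h' w)⟩
  mul' {u v u' v'} h h' w := by
    -- Interchange is only given at the front of a word, so the second factor is rotated to the
    -- front: `u u' w`, `v u' w`, `u' w v`, `v' w v`, `v v' w`.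
    have h1 := h (FreeMonoid.toList u' ++ w)
    have h2 := h' (w ++ FreeMonoid.toList v)
    have e1 : SameLink (n := n) (FreeMonoid.toList v ++ (FreeMonoid.toList u' ++ w))
        (FreeMonoid.toList u' ++ (w ++ FreeMonoid.toList v)) := by
      simpa using sameLink_append_comm (n := n) (FreeMonoid.toList v) (FreeMonoid.toList u' ++ w)
    have e2 : SameLink (n := n) (FreeMonoid.toList v' ++ (w ++ FreeMonoid.toList v))
        (FreeMonoid.toList v ++ (FreeMonoid.toList v' ++ w)) := by
      simpa using sameLink_append_comm (n := n) (FreeMonoid.toList v' ++ w) (FreeMonoid.toList v)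
    simpa using h1.trans (e1.trans (h2.trans e2))

/-- The class of a generator, as a unit. -/
def sigmaUnit (i : Fin (n - 1)) : (interchangeable n).Quotientˣ where
  val := ((FreeMonoid.of (i, true) : FreeMonoid (Fin (n - 1) × Bool)) : (interchangeable n).Quotient)
  inv := ((FreeMonoid.of (i, false) : FreeMonoid (Fin (n - 1) × Bool)) : (interchangeable n).Quotient)
  val_inv := by
    rw [← Con.coe_mul, ← Con.coe_one, Con.eq]
    exact fun w => sameLink_cancel i true w
  inv_val := by
    rw [← Con.coe_mul, ← Con.coe_one, Con.eq]
    exact fun w => sameLink_cancel i false w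

/-- The braid group acts on the classes of interchangeable words. -/
def braidToUnits (n : ℕ) : BraidGroup n →* (interchangeable n).Quotientˣ :=
  PresentedGroup.toGroup (rels := braidRels n) (f := sigmaUnit) (by
    rintro x (⟨i, j, hij, rfl⟩ | ⟨i, j, hij, rfl⟩)
    · rw [map_mul, map_inv, mul_inv_eq_one]
      simp only [map_mul, FreeGroup.lift_apply_of]
      refine Units.ext ?_
      simp only [Units.val_mul, sigmaUnit, ← Con.coe_mul, Con.eq]
      exact fun w => sameLink_far_comm hij w
    · rw [map_mul, map_inv, mul_inv_eq_one]
      simp only [map_mul, FreeGroup.lift_apply_of]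
      refine Units.ext ?_
      simp only [Units.val_mul, sigmaUnit, ← Con.coe_mul, Con.eq]
      exact fun w => sameLink_braid hij w)

theorem val_braidToUnits (w : BraidWord n) : (braidToUnits n w.toBraid).1 =
    ((FreeMonoid.ofList w : FreeMonoid (Fin (n - 1) × Bool)) : (interchangeable n).Quotient) := by
  have h : braidToUnits n w.toBraid =
      (w.map fun x => cond x.2 (sigmaUnit x.1) (sigmaUnit x.1)⁻¹).prod := by
    change FreeGroup.lift sigmaUnit (FreeGroup.mk w) = _
    rw [FreeGroup.lift_mk]
  rw [h]
  induction w with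
  | nil => rfl
  | cons l w ih =>
    rw [List.map_cons, List.prod_cons, Units.val_mul, ih (by
      change FreeGroup.lift sigmaUnit (FreeGroup.mk w) = _
      rw [FreeGroup.lift_mk])]
    obtain ⟨i, ε⟩ := l
    cases ε <;> rfl

/-- The braid relations hold among the units of the quotient monoid, so equal braids have
interchangeable words; the remaining word is taken to be empty. -/
theorem sameLink_of_toBraid_eq {u v : BraidWord n} (h : u.toBraid = v.toBraid) : SameLink u v := by
  have h1 := val_braidToUnits u
  rw [h, val_braidToUnits, Con.eq] at h1
  simpa using (h1 []).symm

theorem toBraid_append (u v : BraidWord n) : toBraid (u ++ v) = u.toBraid * v.toBraid := by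
  rw [toBraid, toBraid, toBraid, ← map_mul, FreeGroup.mul_mk]

end BraidWord

theorem sameClosure_of_words {m n : ℕ} {β : BraidGroup m} {β' : BraidGroup n} {w : BraidWord m}
    {w' : BraidWord n} (hw : w.toBraid = β) (hw' : w'.toBraid = β') (h : w.SameLink w') :
    SameClosure β β' := fun _ _ hu hu' =>
  ((BraidWord.sameLink_of_toBraid_eq (hu.trans hw.symm)).trans h).trans
    (BraidWord.sameLink_of_toBraid_eq (hw'.trans hu'.symm))

theorem SameClosure.refl {n : ℕ} (β : BraidGroup n) : SameClosure β β := fun _ _ h h' =>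
  BraidWord.sameLink_of_toBraid_eq (h.trans h'.symm)

theorem SameClosure.trans {m n k : ℕ} {α : BraidGroup m} {β : BraidGroup n} {γ : BraidGroup k}
    (h : SameClosure α β) (h' : SameClosure β γ) : SameClosure α γ := fun u w hu hw => by
  obtain ⟨v, hv⟩ := BraidWord.toBraid_surjective n β
  exact (h u v hu hv).trans (h' v w hv hw)

theorem sameClosure_mul_comm {n : ℕ} (α β : BraidGroup n) : SameClosure (α * β) (β * α) := by
  obtain ⟨u, rfl⟩ := BraidWord.toBraid_surjective n α
  obtain ⟨v, rfl⟩ := BraidWord.toBraid_surjective n β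
  exact sameClosure_of_words (BraidWord.toBraid_append u v) (BraidWord.toBraid_append v u)
    (BraidWord.sameLink_append_comm u v)

/-! ### Horizontal pushes -/

/-- Displace every point within its horizontal plane. -/
noncomputable def horizPush (k : ℝ → ℂ → ℂ) (s : ℝ) (x : EuclideanSpace ℝ (Fin 3)) :
    EuclideanSpace ℝ (Fin 3) :=
  cylPoint (horiz x + s * k (x 2) (horiz x)) (x 2)

theorem dist_cylPoint (ξ η : ℂ) (h : ℝ) : dist (cylPoint ξ h) (cylPoint η h) = dist ξ η := by
  rw [EuclideanSpace.dist_eq, Fin.sum_univ_three, Complex.dist_eq_re_im]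
  simp [cylPoint, Real.dist_eq, sq_abs]

/-- Unlike a push within the pages, this one may carry strands across the axis, which is what
removing a turn requires. -/
theorem isIsotopicToId_horizPush {k : ℝ → ℂ → ℂ} (hk : Continuous fun p : ℝ × ℂ => k p.1 p.2)
    {C : ℝ} (hC : ∀ h ξ, ‖k h ξ‖ ≤ C) {K : NNReal} (hK : K < 1)
    (hlip : ∀ h, LipschitzWith K (k h)) : IsIsotopicToId (horizPush k 1) := by
  have hbij : ∀ s ∈ Set.Icc (0 : ℝ) 1, ∀ h, Function.Bijective fun ξ : ℂ => ξ + s * k h ξ := by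
    intro s hs h
    refine bijective_id_add_of_lipschitz hK (LipschitzWith.of_dist_le_mul fun a b => ?_)
    rw [dist_eq_norm, ← mul_sub, norm_mul, Complex.norm_real, Real.norm_of_nonneg hs.1,
      ← dist_eq_norm]
    calc s * dist (k h a) (k h b) ≤ 1 * dist (k h a) (k h b) :=
          mul_le_mul_of_nonneg_right hs.2 dist_nonneg
      _ ≤ _ := by rw [one_mul]; exact (hlip h).dist_le_mul a b
  refine isIsotopicToId_of_bijective (horizPush k) ?_ (fun s hs => ⟨fun x y hxy => ?_, fun y => ?_⟩)
    (fun x => ?_) C (fun s hs x => ?_)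
  · have hh := continuous_horiz.comp (continuous_snd (X := ℝ) (Y := EuclideanSpace ℝ (Fin 3)))
    simp only [Function.comp_def] at hh
    have h2 : Continuous fun p : ℝ × EuclideanSpace ℝ (Fin 3) => p.2 2 := by fun_prop
    have hf := hk.comp (h2.prodMk hh)
    simp only [Function.comp_def] at hf
    unfold horizPush
    refine continuous_cylPoint.comp (Continuous.prodMk ?_ h2)
    fun_prop
  · have h2 := congrArg (fun x => x 2) hxy
    have h1 := congrArg horiz hxy
    simp only [horizPush, cylPoint_apply_two, horiz_cylPoint] at h1 h2
    rw [h2] at h1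
    rw [← cylPoint_horiz x, ← cylPoint_horiz y, h2, (hbij s hs _).1 h1]
  · obtain ⟨ξ, hξ⟩ := (hbij s hs (y 2)).2 (horiz y)
    refine ⟨cylPoint ξ (y 2), ?_⟩
    simp only [horizPush, cylPoint_apply_two, horiz_cylPoint]
    simp only [] at hξ
    rw [hξ, cylPoint_horiz]
  · simp [horizPush, cylPoint_horiz]
  · have h1 : dist (horizPush k s x) x = dist (horiz x + s * k (x 2) (horiz x)) (horiz x) := by
      conv_lhs => rw [horizPush, ← cylPoint_horiz x]
      simp only [cylPoint_apply_two, horiz_cylPoint, dist_cylPoint]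
    rw [h1, dist_eq_norm, add_sub_cancel_left, norm_mul, Complex.norm_real,
      Real.norm_of_nonneg hs.1]
    calc s * ‖k (x 2) (horiz x)‖ ≤ 1 * ‖k (x 2) (horiz x)‖ :=
          mul_le_mul_of_nonneg_right hs.2 (norm_nonneg _)
      _ ≤ C := by rw [one_mul]; exact hC _ _

/-! ### Removing a loop around the axis -/

/-- Restrict a real number to the unit interval. -/
noncomputable def unitClamp (x : ℝ) : ℝ := max 0 (min 1 x)

theorem unitClamp_of_nonpos {x : ℝ} (h : x ≤ 0) : unitClamp x = 0 :=
  max_eq_left ((min_le_right _ _).trans h)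

theorem unitClamp_of_one_le {x : ℝ} (h : 1 ≤ x) : unitClamp x = 1 := by
  rw [unitClamp, min_eq_left h, max_eq_right zero_le_one]

theorem unitClamp_nonneg (x : ℝ) : 0 ≤ unitClamp x := le_max_left _ _

theorem unitClamp_le_one (x : ℝ) : unitClamp x ≤ 1 := max_le zero_le_one (min_le_left _ _)

theorem continuous_unitClamp : Continuous unitClamp := by
  unfold unitClamp
  fun_prop

theorem abs_unitClamp_sub_le (x y : ℝ) : |unitClamp x - unitClamp y| ≤ |x - y| := by
  unfold unitClamp
  refine (abs_max_sub_max_le_max _ _ _ _).trans (max_le (by simp) ?_)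
  exact (abs_min_sub_min_le_max _ _ _ _).trans (max_le (by simp) le_rfl)

/-- The point of the circle at the angle of the page `t`. -/
noncomputable def pageDir (t : ℝ) : ℂ := Complex.exp ((2 * Real.pi * t : ℝ) * Complex.I)

theorem norm_pageDir (t : ℝ) : ‖pageDir t‖ = 1 := Complex.norm_exp_ofReal_mul_I _

theorem continuous_pageDir : Continuous pageDir := by
  unfold pageDir
  fun_prop

/-- The displacement, at height `h`, from the helix that turns once and a quarter to the helix that
turns a quarter, between the same end points at the heights `-1` and `1`. -/
noncomputable def unwindStep (h : ℝ) : ℂ :=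
  pageDir (1 / 4 + max (-1) (min 1 h) / 8) - pageDir (3 / 4 + 5 * max (-1) (min 1 h) / 8)

theorem unwindStep_of_mem {h : ℝ} (hh : h ∈ Set.Icc (-1 : ℝ) 1) :
    unwindStep h = pageDir (1 / 4 + h / 8) - pageDir (3 / 4 + 5 * h / 8) := by
  rw [unwindStep, min_eq_right hh.2, max_eq_right hh.1]

theorem pageDir_add_one (t : ℝ) : pageDir (t + 1) = pageDir t := by
  unfold pageDir
  have : ((2 * Real.pi * (t + 1) : ℝ) : ℂ) * Complex.I =
      ((2 * Real.pi * t : ℝ) : ℂ) * Complex.I + 2 * Real.pi * Complex.I := by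
    push_cast; ring
  rw [this, Complex.exp_periodic]

theorem unwindStep_eq_zero {h : ℝ} (hh : 1 ≤ |h|) : unwindStep h = 0 := by
  rw [unwindStep]
  rcases le_abs.1 hh with h1 | h1
  · rw [min_eq_left h1, max_eq_right (by norm_num),
      show (3 / 4 + 5 * 1 / 8 : ℝ) = (1 / 4 + 1 / 8) + 1 by norm_num, pageDir_add_one, sub_self]
  · rw [min_eq_right (by linarith), max_eq_left (by linarith),
      show (1 / 4 + -1 / 8 : ℝ) = 3 / 4 + 5 * -1 / 8 by norm_num, sub_self]

theorem norm_unwindStep_le (h : ℝ) : ‖unwindStep h‖ ≤ 2 := by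
  refine (norm_sub_le _ _).trans ?_
  rw [norm_pageDir, norm_pageDir]
  norm_num

theorem continuous_unwindStep : Continuous unwindStep := by
  unfold unwindStep
  exact (continuous_pageDir.comp (by fun_prop)).sub (continuous_pageDir.comp (by fun_prop))

/-- The displacement that unwinds a loop around the axis within the radius `exp (-m)`. -/
noncomputable def unwindField (m : ℕ) (h : ℝ) (ξ : ℂ) : ℂ :=
  (Real.exp (-(m + 2 : ℝ)) * unitClamp ((Real.exp (-(m : ℝ)) - ‖ξ‖) /
    (Real.exp (-(m : ℝ)) - Real.exp (-(m + 2 : ℝ)))) : ℝ) * unwindStep h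

/-- This is `e² > 3`. It explains the depth `m + 2` of the core: the displacement there has length
up to twice the core radius and must fade out before radius `exp (-m)` with slope below `1`. -/
theorem three_mul_exp_lt (m : ℕ) : 3 * Real.exp (-(m + 2 : ℝ)) < Real.exp (-(m : ℝ)) := by
  have h1 : Real.exp (-(m : ℝ)) = Real.exp 2 * Real.exp (-(m + 2 : ℝ)) := by
    rw [← Real.exp_add]; ring_nf
  have h2 := Real.add_one_lt_exp (show (2 : ℝ) ≠ 0 by norm_num)
  have h3 := Real.exp_pos (-(m + 2 : ℝ))
  rw [h1]
  nlinarith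

/-- At each height the two helices have one point each on the core circle, and the push translates
one to the other. The helices share their end points, so the push can stop at heights `±1`; the
cutoff in the radius protects strands with real part at most `m`. -/
theorem exists_isIsotopicToId_unwind (m : ℕ) : ∃ T, IsIsotopicToId T ∧
    (∀ (t : ℝ) (z : ℂ), z.re ≤ m ∨ 1 ≤ |z.im| → T (axisPoint t z) = axisPoint t z) ∧
    ∀ h ∈ Set.Icc (-1 : ℝ) 1, T (axisPoint (3 / 4 + 5 * h / 8) ⟨m + 2, h⟩) =
      axisPoint (1 / 4 + h / 8) ⟨m + 2, h⟩ := by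
  have hlt := three_mul_exp_lt m
  have hpos := Real.exp_pos (-(m + 2 : ℝ))
  have hd : 0 < Real.exp (-(m : ℝ)) - Real.exp (-(m + 2 : ℝ)) := by linarith
  have him : ∀ t z, axisPoint t z 2 = z.im := fun t z => by
    rw [axisPoint_eq_cylPoint, cylPoint_apply_two]
  let K : NNReal := ⟨2 * Real.exp (-(m + 2 : ℝ)) /
    (Real.exp (-(m : ℝ)) - Real.exp (-(m + 2 : ℝ))), by positivity⟩
  refine ⟨_, isIsotopicToId_horizPush (k := unwindField m)
    (C := Real.exp (-(m + 2 : ℝ)) * 1 * 2) (K := K) ?_ (fun h ξ => ?_) ?_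
    (fun h => LipschitzWith.of_dist_le_mul fun a b => ?_), fun t z hz => ?_, fun h hh => ?_⟩
  · unfold unwindField
    refine Continuous.mul ?_ (continuous_unwindStep.comp continuous_fst)
    refine Complex.continuous_ofReal.comp (continuous_const.mul (continuous_unitClamp.comp ?_))
    fun_prop
  · rw [unwindField, norm_mul, Complex.norm_real, Real.norm_of_nonneg
      (mul_nonneg hpos.le (unitClamp_nonneg _))]
    exact mul_le_mul (mul_le_mul_of_nonneg_left (unitClamp_le_one _) hpos.le)
      (norm_unwindStep_le h) (norm_nonneg _) (by positivity)
  · rw [← NNReal.coe_lt_coe]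
    change 2 * Real.exp (-(m + 2 : ℝ)) /
      (Real.exp (-(m : ℝ)) - Real.exp (-(m + 2 : ℝ))) < 1
    rw [div_lt_one hd]
    linarith
  · rw [dist_eq_norm, unwindField, unwindField, ← sub_mul, norm_mul, ← Complex.ofReal_sub,
      ← mul_sub, Complex.norm_real, norm_mul, Real.norm_of_nonneg hpos.le, Real.norm_eq_abs]
    have h1 := abs_unitClamp_sub_le
      ((Real.exp (-(m : ℝ)) - ‖a‖) / (Real.exp (-(m : ℝ)) - Real.exp (-(m + 2 : ℝ))))
      ((Real.exp (-(m : ℝ)) - ‖b‖) / (Real.exp (-(m : ℝ)) - Real.exp (-(m + 2 : ℝ))))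
    rw [← sub_div, sub_sub_sub_cancel_left, abs_div, abs_of_pos hd] at h1
    have h2 : |‖b‖ - ‖a‖| ≤ dist a b := by
      rw [dist_comm, dist_eq_norm]; exact abs_norm_sub_norm_le _ _
    have h3 := h1.trans (div_le_div_of_nonneg_right h2 hd.le)
    calc _ ≤ Real.exp (-(m + 2 : ℝ)) *
          (dist a b / (Real.exp (-(m : ℝ)) - Real.exp (-(m + 2 : ℝ)))) * 2 :=
          mul_le_mul (mul_le_mul_of_nonneg_left h3 hpos.le) (norm_unwindStep_le h)
            (norm_nonneg _) (by positivity)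
      _ = 2 * Real.exp (-(m + 2 : ℝ)) /
          (Real.exp (-(m : ℝ)) - Real.exp (-(m + 2 : ℝ))) * dist a b := by ring
  · have h0 : unwindField m z.im (horiz (axisPoint t z)) = 0 := by
      rw [unwindField]
      rcases hz with hz | hz
      · rw [norm_horiz_axisPoint, unitClamp_of_nonpos]
        · simp
        · refine div_nonpos_of_nonpos_of_nonneg ?_ hd.le
          have := Real.exp_le_exp.2 (neg_le_neg hz)
          linarith
      · rw [unwindStep_eq_zero hz, mul_zero]
    rw [horizPush, him, h0, mul_zero, add_zero]
    conv_rhs => rw [← cylPoint_horiz (axisPoint t z), him]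
  · have hr : unwindField m h (horiz (axisPoint (3 / 4 + 5 * h / 8) ⟨m + 2, h⟩)) =
        (Real.exp (-(m + 2 : ℝ)) : ℝ) * unwindStep h := by
      rw [unwindField, norm_horiz_axisPoint, div_self hd.ne', unitClamp_of_one_le le_rfl, mul_one]
    rw [horizPush, him, hr, horiz_axisPoint, axisPoint_eq_cylPoint, unwindStep_of_mem hh]
    congr 1
    simp only [pageDir]
    push_cast
    ring

/-! ### The strands that run into and out of the core. -/

/-- The way of the strand that enters the core of the loop, relative to its base position. -/
noncomputable def enterPos (t : ℝ) : ℂ :=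
  ⟨2 * unitClamp (16 * t - 1), max (max (-16 * t) (-1)) (8 / 5 * (t - 3 / 4))⟩

/-- The way of the strand that leaves the core of the loop, relative to its final position. -/
noncomputable def leavePos (t : ℝ) : ℂ :=
  ⟨2 * unitClamp (7 - 16 * t), min 1 (min (8 / 5 * (t + 1 / 4)) (max 0 (8 - 16 * t)))⟩

/-- The way of a strand that enters the core and leaves it again without a loop. -/
noncomputable def shortcutPos (t : ℝ) : ℂ :=
  ⟨2 * min (unitClamp (16 * t - 1)) (unitClamp (7 - 16 * t)),
    max (max (-16 * t) (-1)) (min (8 * t - 2) (min 1 (max 0 (8 - 16 * t))))⟩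

theorem enterPos_eq_shortcutPos {t : ℝ} (h1 : t ≤ 1 / 8) : enterPos t = shortcutPos t := by
  apply Complex.ext
  · simp only [enterPos, shortcutPos]
    rw [unitClamp_of_one_le (x := 7 - 16 * t) (by linarith), min_eq_left (unitClamp_le_one _)]
  · simp only [enterPos, shortcutPos]
    exact (max_eq_left (le_max_of_le_right (by linarith))).trans
      (max_eq_left ((min_le_left _ _).trans (le_max_of_le_right (by linarith)))).symm

theorem leavePos_eq_shortcutPos {t : ℝ} (h1 : 3 / 8 ≤ t) : leavePos t = shortcutPos t := by
  apply Complex.ext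
  · simp only [leavePos, shortcutPos]
    rw [unitClamp_of_one_le (x := 16 * t - 1) (by linarith), min_eq_right (unitClamp_le_one _)]
  · simp only [leavePos, shortcutPos]
    simp only [max_def, min_def]
    split_ifs <;> linarith

/-- The height inverts `t = 3/4 + 5h/8`, the page of the long helix. -/
theorem enterPos_core {t : ℝ} (h0 : 1 / 8 ≤ t) : enterPos t = ⟨2, 8 / 5 * (t - 3 / 4)⟩ := by
  apply Complex.ext
  · simp only [enterPos]
    rw [unitClamp_of_one_le (by linarith), mul_one]
  · simp only [enterPos]
    rw [max_eq_right]
    exact max_le (by linarith) (by linarith)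

/-- The same helix one turn later: the height is that of `enterPos_core` at time `t + 1`. -/
theorem leavePos_core {t : ℝ} (h1 : t ≤ 3 / 8) : leavePos t = ⟨2, 8 / 5 * (t + 1 / 4)⟩ := by
  apply Complex.ext
  · simp only [leavePos]
    rw [unitClamp_of_one_le (by linarith), mul_one]
  · simp only [leavePos]
    rw [min_eq_left (a := 8 / 5 * (t + 1 / 4)), min_eq_right]
    · linarith
    · exact le_max_of_le_right (by linarith)

theorem shortcutPos_core {t : ℝ} (h0 : 1 / 8 ≤ t) (h1 : t ≤ 3 / 8) :
    shortcutPos t = ⟨2, 8 * t - 2⟩ := by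
  apply Complex.ext
  · simp only [shortcutPos]
    rw [unitClamp_of_one_le (by linarith), unitClamp_of_one_le (by linarith), min_self, mul_one]
  · simp only [shortcutPos]
    rw [min_eq_left, max_eq_right]
    · exact max_le (by linarith) (by linarith)
    · exact le_min (by linarith) (le_max_of_le_right (by linarith))

theorem enterPos_fixed {t : ℝ} (h1 : t ≤ 1 / 8) :
    (enterPos t).re = 0 ∨ 1 ≤ |(enterPos t).im| := by
  rcases le_total t (1 / 16) with h | h
  · left
    simp only [enterPos]
    rw [unitClamp_of_nonpos (by linarith), mul_zero]
  · right
    simp only [enterPos]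
    rw [max_eq_right (a := -16 * t) (by linarith), max_eq_left (by linarith)]
    simp

theorem leavePos_fixed {t : ℝ} (h0 : 3 / 8 ≤ t) :
    (leavePos t).re = 0 ∨ 1 ≤ |(leavePos t).im| := by
  rcases le_total t (7 / 16) with h | h
  · right
    simp only [leavePos]
    rw [min_eq_left]
    · simp
    · exact le_min (by linarith) (le_max_of_le_right (by linarith))
  · left
    simp only [leavePos]
    rw [unitClamp_of_nonpos (by linarith), mul_zero]

theorem leavePos_of_ge {t : ℝ} (h : 1 / 2 ≤ t) : leavePos t = 0 := by
  apply Complex.ext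
  · simp only [leavePos]
    rw [unitClamp_of_nonpos (by linarith), mul_zero, Complex.zero_re]
  · simp only [leavePos]
    rw [max_eq_left (by linarith), min_eq_right (a := 8 / 5 * (t + 1 / 4)) (by linarith),
      min_eq_right zero_le_one,
      Complex.zero_im]

theorem shortcutPos_zero : shortcutPos 0 = 0 := by
  rw [← enterPos_eq_shortcutPos (by norm_num)]
  apply Complex.ext
  · simp only [enterPos]
    rw [unitClamp_of_nonpos (by norm_num), mul_zero, Complex.zero_re]
  · simp only [enterPos]
    norm_num

/-- This matches the positive half twist, whose right strand passes above; it keeps the two strands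
apart while the twist is deformed into the loop. -/
theorem enterPos_im_lt_leavePos_im {t : ℝ} (h0 : 0 ≤ t) (h1 : t ≤ 1 / 2) :
    (enterPos t).im < (leavePos t).im := by
  simp only [enterPos, leavePos]
  rcases h0.eq_or_lt with rfl | h0
  · norm_num
  · have h2 : max (max (-16 * t) (-1)) (8 / 5 * (t - 3 / 4)) < 0 :=
      max_lt (max_lt (by linarith) (by norm_num)) (by linarith)
    exact h2.trans_le (le_min (by norm_num) (le_min (by linarith) (le_max_left _ _)))

theorem continuous_complex_mk {X : Type*} [TopologicalSpace X] {f g : X → ℝ} (hf : Continuous f)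
    (hg : Continuous g) : Continuous fun x => (⟨f x, g x⟩ : ℂ) :=
  Complex.equivRealProdCLM.symm.continuous.comp (hf.prodMk hg)

theorem continuous_enterPos : Continuous enterPos :=
  continuous_complex_mk (continuous_const.mul (continuous_unitClamp.comp (by fun_prop)))
    (by fun_prop)

theorem continuous_leavePos : Continuous leavePos :=
  continuous_complex_mk (continuous_const.mul (continuous_unitClamp.comp (by fun_prop)))
    (by fun_prop)

theorem continuous_shortcutPos : Continuous shortcutPos :=
  continuous_complex_mk (continuous_const.mul ((continuous_unitClamp.comp (by fun_prop)).min
    (continuous_unitClamp.comp (by fun_prop)))) (by fun_prop)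

/-! ### Positive stabilization of closed braid words. -/

namespace BraidWord

/-- The strands of the word keep distance at least `exp (-m)` from the axis, out of reach of the
unwinding. -/
theorem motion_re_le {m : ℕ} (w : BraidWord (m + 1)) (τ : ℝ) (j : Fin (m + 1)) :
    (w.motion τ j).re ≤ m := by
  induction w generalizing τ j with
  | nil =>
    rw [motion, Complex.natCast_re]
    exact_mod_cast Nat.lt_succ_iff.1 j.2
  | cons l w ih =>
    rw [motion]
    split_ifs
    · by_cases hj : (j : ℕ) = l.1 ∨ (j : ℕ) = l.1 + 1
      · refine (halfTwist_re_mem _ _ _ hj).2.trans ?_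
        have := l.1.2
        exact_mod_cast (by omega : (l.1 : ℕ) + 1 ≤ m)
      · rw [halfTwist_of_ne _ _ hj, Complex.natCast_re]
        exact_mod_cast Nat.lt_succ_iff.1 j.2
    · exact ih _ _

/-- A braid word as a word on more strands. -/
def incl {m n : ℕ} (h : m ≤ n) (w : BraidWord m) : BraidWord n :=
  w.map fun l => (Fin.castLE (Nat.sub_le_sub_right h 1) l.1, l.2)

theorem letterPerm_castLE {m n : ℕ} (h : m ≤ n) (i : Fin (m - 1)) (j : Fin m) :
    letterPerm (Fin.castLE (Nat.sub_le_sub_right h 1) i) (Fin.castLE h j) =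
      Fin.castLE h (letterPerm i j) := by
  exact Fin.ext ((coe_letterPerm _ _).trans (coe_letterPerm i j).symm)

theorem motion_incl {m n : ℕ} (h : m ≤ n) (w : BraidWord m) (τ : ℝ) (j : Fin m) :
    (w.incl h).motion τ (Fin.castLE h j) = w.motion τ j := by
  induction w generalizing τ j with
  | nil => rfl
  | cons l w ih =>
    change motion (_ :: incl h w) τ _ = _
    rw [motion, motion, letterPerm_castLE, ih]
    rfl

theorem motion_incl_of_ge {m n : ℕ} (h : m ≤ n) (w : BraidWord m) (τ : ℝ) (j : Fin n)
    (hj : m ≤ j) : (w.incl h).motion τ j = ((j : ℕ) : ℂ) := by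
  induction w generalizing τ with
  | nil => rfl
  | cons l w ih =>
    change motion (_ :: incl h w) τ _ = _
    have hl := l.1.2
    have h1 : ¬ ((j : ℕ) = l.1 ∨ (j : ℕ) = l.1 + 1) := by omega
    have h2 : letterPerm (Fin.castLE (Nat.sub_le_sub_right h 1) l.1) j = j := by
      refine Fin.ext ?_
      rw [coe_letterPerm, Fin.val_castLE, if_neg (fun h => h1 (.inl h)),
        if_neg (fun h => h1 (.inr h))]
    rw [motion, h2, ih]
    split_ifs
    · exact halfTwist_of_ne _ _ h1
    · rfl

theorem length_incl {m n : ℕ} (h : m ≤ n) (w : BraidWord m) : (w.incl h).length = w.length :=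
  List.length_map _

theorem toBraid_incl {m n : ℕ} (h : m ≤ n) (w : BraidWord m) :
    (w.incl h).toBraid = braidIncl h w.toBraid := by
  have h1 : braidIncl h w.toBraid = (w.map fun x => cond x.2
      (PresentedGroup.of (rels := braidRels n) (Fin.castLE (Nat.sub_le_sub_right h 1) x.1))
      (PresentedGroup.of (Fin.castLE (Nat.sub_le_sub_right h 1) x.1))⁻¹).prod := by
    change FreeGroup.lift (fun i => PresentedGroup.of (rels := braidRels n)
      (Fin.castLE (Nat.sub_le_sub_right h 1) i)) (FreeGroup.mk w) = _
    rw [FreeGroup.lift_mk]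
  rw [h1]
  clear h1
  induction w with
  | nil => rfl
  | cons l w ih =>
    change toBraid ([(Fin.castLE (Nat.sub_le_sub_right h 1) l.1, l.2)] ++ incl h w) = _
    rw [toBraid_append, ih, List.map_cons, List.prod_cons]
    obtain ⟨i, ε⟩ := l
    cases ε <;> rfl

/-- The motion of the closed braid word in the second half of the unit of time. -/
noncomputable def lateLoop {n : ℕ} (w : BraidWord n) (t : ℝ) : Fin n → ℂ :=
  w.motion (w.length * (2 * t - 1))

/-- The closed braid of a word with a loop around the axis added to its last strand. -/
noncomputable def curled {m : ℕ} (w : BraidWord (m + 1)) (t : ℝ) : Fin (m + 2) → ℂ :=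
  Fin.snoc (Fin.snoc (fun j : Fin m => w.lateLoop t j.castSucc) (m + enterPos t) : Fin (m + 1) → ℂ)
    (w.lateLoop t (Fin.last m) + leavePos t)

/-- The closed braid of a word with a detour towards the axis in its last strand. -/
noncomputable def detoured {m : ℕ} (w : BraidWord (m + 1)) (t : ℝ) : Fin (m + 1) → ℂ :=
  Fin.snoc (fun j : Fin m => w.lateLoop t j.castSucc) (w.lateLoop t (Fin.last m) + shortcutPos t)

/-- The last positive letter followed by a word on the other strands. -/
def stabilized {m : ℕ} (w : BraidWord (m + 1)) : BraidWord (m + 2) :=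
  (Fin.last m, true) :: w.incl (Nat.le_succ (m + 1))

theorem continuous_lateLoop {n : ℕ} (w : BraidWord n) : Continuous w.lateLoop :=
  w.continuous_motion.comp (by fun_prop)

theorem lateLoop_of_le {n : ℕ} (w : BraidWord n) {t : ℝ} (ht : t ≤ 1 / 2) (j : Fin n) :
    w.lateLoop t j = ((j : ℕ) : ℂ) :=
  motion_of_nonpos _ (mul_nonpos_of_nonneg_of_nonpos (Nat.cast_nonneg _) (by linarith)) j

theorem continuous_curled {m : ℕ} (w : BraidWord (m + 1)) : Continuous w.curled := by
  have h1 := w.continuous_lateLoop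
  have h2 : ∀ j, Continuous fun t => w.lateLoop t j := fun j => (continuous_apply j).comp h1
  unfold curled
  exact ((continuous_pi fun j => h2 _).finSnoc (continuous_const.add continuous_enterPos)).finSnoc
    ((h2 _).add continuous_leavePos)

theorem push_path_lateLoop {n : ℕ} (w : BraidWord n) :
    Push w.lateLoop fun t => (w.path.extend t).1 :=
  (w.push_motion_comp (by fun_prop) (by fun_prop) (by norm_num) (by simp) (by norm_num)
    (by simp)).trans w.push_path_loop.symm

theorem lateLoop_one {n : ℕ} (w : BraidWord n) (j : Fin n) :
    w.lateLoop 1 j = ((w.perm j : ℕ) : ℂ) :=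
  motion_of_ge _ (by norm_num) j

/-- The detour happens while the other strands wait at smaller real parts, so shrinking it linearly
meets nothing. -/
theorem push_detoured {m : ℕ} (w : BraidWord (m + 1)) : Push w.detoured w.lateLoop := by
  have h1 := w.continuous_lateLoop
  have h2 : ∀ j, Continuous fun p : ℝ × ℝ => w.lateLoop p.2 j := fun j =>
    (continuous_apply j).comp (h1.comp continuous_snd)
  have h3 : Continuous fun p : ℝ × ℝ => shortcutPos p.2 :=
    continuous_shortcutPos.comp continuous_snd
  have h0 : ∀ t, (1 / 2 : ℝ) ≤ t → shortcutPos t = 0 := fun t ht => by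
    rw [← leavePos_eq_shortcutPos (by linarith), leavePos_of_ge ht]
  set F : ℝ → ℝ → Fin (m + 1) → ℂ := fun s t => Fin.snoc (fun j : Fin m => w.lateLoop t j.castSucc)
    (w.lateLoop t (Fin.last m) + (1 - s : ℝ) * shortcutPos t) with hF
  have hlate : ∀ s t, (1 - s : ℝ) * shortcutPos t = 0 → F s t = w.lateLoop t := by
    intro s t h
    funext j
    simp only [hF, h, add_zero]
    induction j using Fin.lastCases <;> simp
  have := push_of_homotopy F (Continuous.continuousOn
    ((continuous_pi fun j => h2 _).finSnoc ((h2 _).add (by fun_prop)))) (fun s hs t ht => ?_) w.perm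
    (fun s _ => ?_)
  · refine this.congr (fun t _ => ?_) (fun t _ => hlate 1 t (by simp))
    simp [hF, detoured]
  · rcases le_total (1 / 2) t with h | h
    · rw [hlate s t (by rw [h0 t h, mul_zero])]
      exact w.motion_injective _
    · refine Fin.snoc_injective_iff.2 ⟨?_, ?_⟩
      · exact (w.motion_injective _).comp (Fin.castSucc_injective m)
      · rintro ⟨j, hj⟩
        change w.lateLoop t j.castSucc = _ at hj
        have hre := congrArg Complex.re hj
        rw [lateLoop_of_le w h, lateLoop_of_le w h, Complex.add_re, Complex.re_ofReal_mul] at hre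
        simp only [Complex.natCast_re, Fin.val_castSucc, Fin.val_last] at hre
        have hjm : (j : ℝ) < m := by exact_mod_cast j.2
        have hp : 0 ≤ (shortcutPos t).re := mul_nonneg zero_le_two
          (le_min (unitClamp_nonneg _) (unitClamp_nonneg _))
        nlinarith [mul_nonneg (sub_nonneg.2 hs.2) hp]
  · rw [hlate s 1 (by rw [h0 1 (by norm_num), mul_zero]),
      hlate s 0 (by rw [shortcutPos_zero, mul_zero])]
    funext j
    rw [Function.comp_apply, lateLoop_one, lateLoop_of_le w (by norm_num)]

theorem perm_incl {m n : ℕ} (h : m ≤ n) (w : BraidWord m) (j : Fin m) :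
    (w.incl h).perm (Fin.castLE h j) = Fin.castLE h (w.perm j) := by
  have h1 := motion_incl h w w.length j
  rw [motion_of_ge _ le_rfl, motion_of_ge _ (by rw [length_incl])] at h1
  exact Fin.ext (Nat.cast_injective (R := ℂ) h1)

theorem perm_incl_of_ge {m n : ℕ} (h : m ≤ n) (w : BraidWord m) (j : Fin n) (hj : m ≤ j) :
    (w.incl h).perm j = j := by
  have h1 := motion_incl_of_ge h w w.length j hj
  rw [motion_of_ge _ (by rw [length_incl])] at h1
  exact Fin.ext (Nat.cast_injective (R := ℂ) h1)

theorem letterPerm_last_of_lt {m : ℕ} (j : Fin m) :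
    letterPerm (n := m + 2) (Fin.last m) j.castSucc.castSucc = j.castSucc.castSucc := by
  refine Fin.ext ((coe_letterPerm _ _).trans ?_)
  have := j.2
  simp only [Fin.val_castSucc, Fin.val_last]
  rw [if_neg (by omega), if_neg (by omega)]

theorem letterPerm_last_castSucc (m : ℕ) :
    letterPerm (n := m + 2) (Fin.last m) (Fin.last m).castSucc = Fin.last (m + 1) := by
  refine Fin.ext ((coe_letterPerm _ _).trans ?_)
  simp

theorem letterPerm_last_last (m : ℕ) :
    letterPerm (n := m + 2) (Fin.last m) (Fin.last (m + 1)) = (Fin.last m).castSucc := by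
  refine Fin.ext ((coe_letterPerm _ _).trans ?_)
  simp

theorem perm_stabilized {m : ℕ} (w : BraidWord (m + 1)) :
    (∀ j : Fin m, w.stabilized.perm j.castSucc.castSucc = (w.perm j.castSucc).castSucc) ∧
    w.stabilized.perm (Fin.last m).castSucc = Fin.last (m + 1) ∧
    w.stabilized.perm (Fin.last (m + 1)) = (w.perm (Fin.last m)).castSucc := by
  have h : ∀ j, w.stabilized.perm j = (w.incl (Nat.le_succ (m + 1))).perm
      (letterPerm (n := m + 2) (Fin.last m) j) := fun j => rfl
  refine ⟨fun j => ?_, ?_, ?_⟩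
  · rw [h, letterPerm_last_of_lt]
    exact perm_incl _ w _
  · rw [h, letterPerm_last_castSucc]
    exact perm_incl_of_ge _ w _ le_rfl
  · rw [h, letterPerm_last_last]
    exact perm_incl _ w _

theorem curled_castSucc_castSucc {m : ℕ} (w : BraidWord (m + 1)) (t : ℝ) (j : Fin m) :
    w.curled t j.castSucc.castSucc = w.lateLoop t j.castSucc := by
  simp only [curled, Fin.snoc_castSucc]

theorem curled_castSucc_last {m : ℕ} (w : BraidWord (m + 1)) (t : ℝ) :
    w.curled t (Fin.last m).castSucc = m + enterPos t := by
  simp only [curled, Fin.snoc_castSucc, Fin.snoc_last]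

theorem curled_last {m : ℕ} (w : BraidWord (m + 1)) (t : ℝ) :
    w.curled t (Fin.last (m + 1)) = w.lateLoop t (Fin.last m) + leavePos t := by
  simp only [curled, Fin.snoc_last]

/-- The entering strand ends at real part `m + 2` and height `2/5`, where the leaving strand starts;
the curled braid thus closes up with the permutation of the stabilized word. -/
theorem curled_one {m : ℕ} (w : BraidWord (m + 1)) :
    w.curled 1 = w.curled 0 ∘ w.stabilized.perm := by
  have h0 : ∀ k : Fin (m + 1), w.curled 0 k.castSucc = ((k : ℕ) : ℂ) := by
    intro k
    induction k using Fin.lastCases with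
    | last =>
      rw [curled_castSucc_last, enterPos_eq_shortcutPos (by norm_num), shortcutPos_zero, add_zero,
        Fin.val_last]
    | cast k =>
      rw [curled_castSucc_castSucc, lateLoop_of_le w (by norm_num)]
  obtain ⟨h1, h2, h3⟩ := w.perm_stabilized
  funext j
  rw [Function.comp_apply]
  induction j using Fin.lastCases with
  | last => rw [curled_last, h3, h0, leavePos_of_ge (by norm_num), add_zero, lateLoop_one]
  | cast j =>
    induction j using Fin.lastCases with
    | last =>
      rw [curled_castSucc_last, h2, curled_last, enterPos_core (by norm_num),
        leavePos_core (by norm_num), lateLoop_of_le w (by norm_num), Fin.val_last]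
      norm_num
    | cast j => rw [curled_castSucc_castSucc, h1, h0, lateLoop_one]

/-- The closed braid of the stabilized word, with the first letter in the first half of the unit
of time. -/
noncomputable def twisted {m : ℕ} (w : BraidWord (m + 1)) (t : ℝ) : Fin (m + 2) → ℂ :=
  w.stabilized.motion (min (2 * t) 1 + w.length * max 0 (2 * t - 1))

theorem twisted_of_le {m : ℕ} (w : BraidWord (m + 1)) {t : ℝ} (h0 : 0 ≤ t) (h1 : t ≤ 1 / 2)
    (j : Fin (m + 2)) : w.twisted t j = halfTwist m true (2 * t) j := by
  rw [twisted, min_eq_left (by linarith), max_eq_left (by linarith), mul_zero, add_zero]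
  exact motion_cons_of_le _ _ (by linarith) (by linarith) j

theorem twisted_of_ge {m : ℕ} (w : BraidWord (m + 1)) {t : ℝ} (h1 : 1 / 2 ≤ t)
    (j : Fin (m + 2)) : w.twisted t j = (w.incl (Nat.le_succ (m + 1))).motion
      (w.length * (2 * t - 1)) (letterPerm (n := m + 2) (Fin.last m) j) := by
  have h2 : 0 ≤ (w.length : ℝ) * (2 * t - 1) := mul_nonneg (Nat.cast_nonneg _) (by linarith)
  rw [twisted, min_eq_right (by linarith), max_eq_right (by linarith)]
  refine (motion_cons_of_ge _ _ (by linarith) j).trans ?_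
  rw [add_sub_cancel_left]

theorem twisted_one {m : ℕ} (w : BraidWord (m + 1)) :
    w.twisted 1 = w.twisted 0 ∘ w.stabilized.perm := by
  have hl : (w.stabilized.length : ℝ) = w.length + 1 := by
    change (((w.incl (Nat.le_succ (m + 1))).length + 1 : ℕ) : ℝ) = _
    rw [length_incl]
    push_cast
    rfl
  funext j
  rw [Function.comp_apply, twisted, twisted, motion_of_ge, motion_of_nonpos]
  · norm_num
  · rw [hl]
    norm_num
    linarith

theorem injective_of_castSucc {α : Type*} {n : ℕ} {f : Fin (n + 1) → α}
    (h : Function.Injective fun j : Fin n => f j.castSucc)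
    (h' : ∀ j : Fin n, f j.castSucc ≠ f (Fin.last n)) : Function.Injective f := by
  rw [← Fin.snoc_init_self (α := fun _ => α) f]
  exact Fin.snoc_injective_iff.2 ⟨h, fun ⟨j, hj⟩ => h' j hj⟩

/-- Straight interpolation works. In the first half of the time the other strands rest to the left
and the last two are kept apart by height. In the second half the entering strand stays to the right
of real part `m`, and the others agree in both braids. -/
theorem push_twisted_curled {m : ℕ} (w : BraidWord (m + 1)) : Push w.twisted w.curled := by
  have hc1 : Continuous w.twisted := (continuous_motion _).comp (by fun_prop)
  have hc2 := w.continuous_curled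
  have := push_of_homotopy (fun s t j => ((1 - s : ℝ) : ℂ) * w.twisted t j + (s : ℂ) * w.curled t j)
    (Continuous.continuousOn (by fun_prop)) (fun s hs t ht => ?_) w.stabilized.perm (fun s _ => ?_)
  · simpa using this
  · have hs0 := hs.1
    have hs1 := sub_nonneg.2 hs.2
    have hcomb : ∀ z : ℂ, ((1 - s : ℝ) : ℂ) * z + (s : ℂ) * z = z := fun z => by push_cast; ring
    have he : 0 ≤ (enterPos t).re := mul_nonneg zero_le_two (unitClamp_nonneg _)
    have hl : 0 ≤ (leavePos t).re := mul_nonneg zero_le_two (unitClamp_nonneg _)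
    rcases le_total t (1 / 2) with h | h
    · have ha : ∀ j : Fin m, w.twisted t j.castSucc.castSucc = ((j : ℕ) : ℂ) := fun j => by
        have := j.2
        rw [twisted_of_le w ht.1 h]
        exact halfTwist_of_ne _ _ (by simp only [Fin.val_castSucc]; omega)
      have hm1 : (m : ℝ) ≤ (w.twisted t (Fin.last m).castSucc).re := by
        rw [twisted_of_le w ht.1 h]
        exact (halfTwist_re_mem _ _ _ (.inl (by simp))).1
      have hm2 : (m : ℝ) ≤ (w.twisted t (Fin.last (m + 1))).re := by
        rw [twisted_of_le w ht.1 h]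
        exact (halfTwist_re_mem _ _ _ (.inr (by simp))).1
      refine injective_of_castSucc (injective_of_castSucc ?_ fun j hj => ?_) fun j => ?_
      · intro j k hjk
        simp only [curled_castSucc_castSucc, lateLoop_of_le w h, ha, Fin.val_castSucc, hcomb] at hjk
        exact Fin.ext (Nat.cast_injective (R := ℂ) hjk)
      · rw [curled_castSucc_castSucc, lateLoop_of_le w h, ha, Fin.val_castSucc, hcomb,
          curled_castSucc_last] at hj
        have hre := congrArg Complex.re hj
        simp only [Complex.add_re, Complex.re_ofReal_mul, Complex.natCast_re] at hre
        have hjm : (j : ℝ) < m := by exact_mod_cast j.2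
        nlinarith [mul_nonneg hs0 he, mul_nonneg hs1 (sub_nonneg.2 hm1)]
      · induction j using Fin.lastCases with
        | cast j =>
          intro hj
          rw [curled_castSucc_castSucc, lateLoop_of_le w h, ha, Fin.val_castSucc, hcomb,
            curled_last, lateLoop_of_le w h, Fin.val_last] at hj
          have hre := congrArg Complex.re hj
          simp only [Complex.add_re, Complex.re_ofReal_mul, Complex.natCast_re] at hre
          have hjm : (j : ℝ) < m := by exact_mod_cast j.2
          nlinarith [mul_nonneg hs0 hl, mul_nonneg hs1 (sub_nonneg.2 hm2)]
        | last =>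
          intro hj
          -- At `s = 0` the heights of the half twist may coincide, so injectivity comes from the
          -- motion; for `s > 0` the strict gap between entering and leaving strand decides.
          rcases hs0.eq_or_lt with rfl | hs0
          · simp only [sub_zero, Complex.ofReal_one, one_mul, Complex.ofReal_zero, zero_mul,
              add_zero] at hj
            have := motion_injective w.stabilized _ hj
            exact absurd this (Fin.castSucc_lt_last _).ne
          · have him := congrArg Complex.im hj
            rw [curled_castSucc_last, curled_last, lateLoop_of_le w h, twisted_of_le w ht.1 h,
              twisted_of_le w ht.1 h] at him
            simp only [Complex.add_im, Complex.im_ofReal_mul, Complex.natCast_im, zero_add,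
              Fin.val_last, Fin.val_castSucc] at him
            rw [halfTwist_true_left, halfTwist_true_right] at him
            simp only [Complex.add_im, Complex.im_ofReal_mul, Complex.ofReal_im, Complex.I_im,
              mul_one, zero_add] at him
            have h2 : 0 ≤ Real.sin (Real.pi * (2 * t)) := Real.sin_nonneg_of_nonneg_of_le_pi
              (mul_nonneg Real.pi_pos.le (by linarith [ht.1]))
              (mul_le_of_le_one_right Real.pi_pos.le (by linarith))
            have h3 := enterPos_im_lt_leavePos_im ht.1 h
            nlinarith [mul_nonneg hs1 h2, mul_pos hs0 (sub_pos.2 h3)]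
    · have ha : ∀ j : Fin m, w.twisted t j.castSucc.castSucc = w.lateLoop t j.castSucc := fun j => by
        rw [twisted_of_ge w h, letterPerm_last_of_lt]
        exact motion_incl _ w _ _
      have hb : w.twisted t (Fin.last m).castSucc = ((m + 1 : ℝ) : ℂ) := by
        rw [twisted_of_ge w h, letterPerm_last_castSucc]
        refine (motion_incl_of_ge _ w _ _ le_rfl).trans ?_
        push_cast [Fin.val_last]
        rfl
      have hd : w.twisted t (Fin.last (m + 1)) = w.lateLoop t (Fin.last m) := by
        rw [twisted_of_ge w h, letterPerm_last_last]
        exact motion_incl _ w _ _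
      have hbig : ∀ j, w.lateLoop t j ≠
          ((1 - s : ℝ) : ℂ) * ((m + 1 : ℝ) : ℂ) + (s : ℂ) * (m + enterPos t) := by
        intro j hj
        have hre := congrArg Complex.re hj
        rw [enterPos_core (by linarith)] at hre
        simp only [Complex.add_re, Complex.re_ofReal_mul, Complex.natCast_re,
          Complex.ofReal_re] at hre
        have : (w.lateLoop t j).re ≤ m := motion_re_le _ _ _
        nlinarith
      refine injective_of_castSucc (injective_of_castSucc ?_ fun j hj => ?_) fun j hj => ?_
      · intro j k hjk
        simp only [curled_castSucc_castSucc, ha, hcomb] at hjk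
        exact Fin.castSucc_injective m (w.motion_injective _ hjk)
      · rw [curled_castSucc_castSucc, ha, hcomb, hb, curled_castSucc_last] at hj
        exact hbig _ hj
      · rw [curled_last, leavePos_of_ge h, add_zero, hd, hcomb] at hj
        induction j using Fin.lastCases with
        | cast j =>
          rw [curled_castSucc_castSucc, ha, hcomb] at hj
          exact absurd (w.motion_injective _ hj) (Fin.castSucc_lt_last _).ne
        | last =>
          rw [curled_castSucc_last, hb] at hj
          exact hbig _ hj.symm
  · funext j
    rw [twisted_one, curled_one]
    rfl

theorem push_curled {m : ℕ} (w : BraidWord (m + 1)) :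
    Push (fun t => (w.stabilized.path.extend t).1) w.curled := by
  have hl : (w.stabilized.length : ℝ) = w.length + 1 := by
    change (((w.incl (Nat.le_succ (m + 1))).length + 1 : ℕ) : ℝ) = _
    rw [length_incl]
    push_cast
    rfl
  refine w.stabilized.push_path_loop.trans (Push.trans ?_ w.push_twisted_curled)
  refine w.stabilized.push_motion_comp (by fun_prop) (by fun_prop) (by simp) ?_ (by simp) ?_
  · norm_num
  · rw [hl]
    norm_num
    linarith

/-- Three isotopies are composed: `T₁` makes the closed braid curled, `T₂` unwinds the turn into a
detour, `T₃` retracts the detour. Points of the core change their time under `T₂`, so only images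
are compared; orientation is read off on arcs outside the core. -/
theorem sameLink_stabilized {m : ℕ} (w : BraidWord (m + 1)) : SameLink w.stabilized w := by
  obtain ⟨T₁, hT₁, h₁⟩ := w.push_curled
  obtain ⟨T₂, hT₂, hfix, hcore⟩ := exists_isIsotopicToId_unwind m
  obtain ⟨T₃, hT₃, h₃⟩ := w.push_detoured.trans w.push_path_lateLoop
  have hother : ∀ t (j : Fin m), T₂ (axisPoint t (w.curled t j.castSucc.castSucc)) =
      axisPoint t (w.detoured t j.castSucc) := by
    intro t j
    simp only [curled, detoured, Fin.snoc_castSucc]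
    exact hfix _ _ (.inl (motion_re_le _ _ _))
  have henter : ∀ t ≤ (1 / 8 : ℝ), T₂ (axisPoint t (w.curled t (Fin.last m).castSucc)) =
      axisPoint t (w.detoured t (Fin.last m)) := by
    intro t ht
    simp only [curled, detoured, Fin.snoc_castSucc, Fin.snoc_last]
    rw [lateLoop_of_le w (by linarith), ← enterPos_eq_shortcutPos ht, Fin.val_last]
    refine hfix _ _ ((enterPos_fixed ht).imp (fun h => ?_) (fun h => ?_))
    · simp [h]
    · simpa using h
  have hleave : ∀ t, (3 / 8 : ℝ) ≤ t → T₂ (axisPoint t (w.curled t (Fin.last (m + 1)))) =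
      axisPoint t (w.detoured t (Fin.last m)) := by
    intro t ht
    simp only [curled, detoured, Fin.snoc_last]
    rw [← leavePos_eq_shortcutPos ht]
    rcases le_total t (1 / 2) with h | h
    · rw [lateLoop_of_le w h, Fin.val_last]
      refine hfix _ _ ((leavePos_fixed ht).imp (fun h => ?_) (fun h => ?_))
      · simp [h]
      · simpa using h
    · rw [leavePos_of_ge h, add_zero]
      exact hfix _ _ (.inl (motion_re_le _ _ _))
  have hdet : ∀ h ∈ Set.Icc (-1 : ℝ) 1, w.detoured (1 / 4 + h / 8) (Fin.last m) = ⟨m + 2, h⟩ := by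
    intro h hh
    simp only [detoured, Fin.snoc_last]
    rw [lateLoop_of_le w (by linarith [hh.2]), shortcutPos_core (by linarith [hh.1])
      (by linarith [hh.2]), Fin.val_last]
    apply Complex.ext
    · simp
    · simp
      ring
  have hcore₁ : ∀ t, (1 / 8 : ℝ) ≤ t → t ≤ 1 → ∃ u ∈ Set.Icc (0 : ℝ) 1,
      T₂ (axisPoint t (w.curled t (Fin.last m).castSucc)) =
      axisPoint u (w.detoured u (Fin.last m)) := by
    intro t h0 h1
    have hh : 8 / 5 * (t - 3 / 4) ∈ Set.Icc (-1 : ℝ) 1 := by constructor <;> linarith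
    refine ⟨1 / 4 + 8 / 5 * (t - 3 / 4) / 8, ⟨by linarith, by linarith⟩, ?_⟩
    rw [hdet _ hh, ← hcore _ hh]
    simp only [curled, Fin.snoc_castSucc, Fin.snoc_last]
    rw [enterPos_core h0]
    congr 2
    · ring
    · apply Complex.ext <;> simp
  have hcore₂ : ∀ t, 0 ≤ t → t ≤ (3 / 8 : ℝ) → ∃ u ∈ Set.Icc (0 : ℝ) 1,
      T₂ (axisPoint t (w.curled t (Fin.last (m + 1)))) =
      axisPoint u (w.detoured u (Fin.last m)) := by
    intro t h0 h1
    have hh : 8 / 5 * (t + 1 / 4) ∈ Set.Icc (-1 : ℝ) 1 := by constructor <;> linarith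
    refine ⟨1 / 4 + 8 / 5 * (t + 1 / 4) / 8, ⟨by linarith, by linarith⟩, ?_⟩
    rw [hdet _ hh, ← hcore _ hh]
    simp only [curled, Fin.snoc_last]
    rw [leavePos_core h1, lateLoop_of_le w (by linarith), Fin.val_last]
    congr 1
    -- The leaving strand at time `t` is the long helix at time `t + 1`, hence the integer `-1`.
    refine axisPoint_eq_iff.2 ⟨⟨-1, by push_cast; ring⟩, ?_⟩
    apply Complex.ext <;> simp
  have htot : ∀ t ∈ Set.Icc (0 : ℝ) 1, ∀ u ∈ Set.Icc (0 : ℝ) 1, ∀ j j',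
      T₂ (axisPoint t (w.curled t j)) = axisPoint u (w.detoured u j') →
      T₃ (T₂ (T₁ (axisPoint t ((w.stabilized.path.extend t).1 j)))) =
        axisPoint u ((w.path.extend u).1 j') := by
    intro t ht u hu j j' h
    rw [h₁ t ht, h, h₃ u hu]
  refine closedBraid_isotopic_of_image _ _ (hT₃.comp (hT₂.comp hT₁)) (fun t ht j => ?_)
    (fun j' => ?_) (fun j => ?_)
  · suffices ∃ u ∈ Set.Icc (0 : ℝ) 1, ∃ j', T₂ (axisPoint t (w.curled t j)) =
        axisPoint u (w.detoured u j') by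
      obtain ⟨u, hu, j', h⟩ := this
      exact ⟨u, hu, j', htot t ht u hu j j' h⟩
    induction j using Fin.lastCases with
    | last =>
      rcases le_total (3 / 8) t with h | h
      · exact ⟨t, ht, _, hleave t h⟩
      · obtain ⟨u, hu, h⟩ := hcore₂ t ht.1 h
        exact ⟨u, hu, _, h⟩
    | cast j =>
      induction j using Fin.lastCases with
      | last =>
        rcases le_total t (1 / 8) with h | h
        · exact ⟨t, ht, _, henter t h⟩
        · obtain ⟨u, hu, h⟩ := hcore₁ t h ht.2
          exact ⟨u, hu, _, h⟩
      | cast j => exact ⟨t, ht, _, hother t j⟩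
  · have hI : (1 / 2 : ℝ) ∈ Set.Icc (0 : ℝ) 1 := by constructor <;> norm_num
    have hI' : (1 / 2 : ℝ) ∈ Set.Ico (0 : ℝ) 1 := by constructor <;> norm_num
    induction j' using Fin.lastCases with
    | last => exact ⟨_, hI, _, _, hI', htot _ hI _ hI _ _ (hleave _ (by norm_num))⟩
    | cast j => exact ⟨_, hI, _, _, hI', htot _ hI _ hI _ _ (hother _ j)⟩
  · induction j using Fin.lastCases with
    | last =>
      refine ⟨1 / 2, 3 / 4, by norm_num, by norm_num, by norm_num, Fin.last m, fun t ht => ?_⟩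
      have ht' : t ∈ Set.Icc (0 : ℝ) 1 := ⟨by linarith [ht.1], by linarith [ht.2]⟩
      exact htot t ht' t ht' _ _ (hleave t (by linarith [ht.1]))
    | cast j =>
      refine ⟨0, 1 / 8, by norm_num, by norm_num, by norm_num, j, fun t ht => ?_⟩
      have ht' : t ∈ Set.Icc (0 : ℝ) 1 := ⟨ht.1, by linarith [ht.2]⟩
      refine htot t ht' t ht' _ _ ?_
      induction j using Fin.lastCases with
      | last => exact henter t ht.2
      | cast j => exact hother t j

end BraidWord

/-- Closing up is invariant under positive stabilization. -/
theorem sameClosure_stabilization {m : ℕ} (β : BraidGroup (m + 1)) :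
    SameClosure (braidIncl (Nat.le_succ (m + 1)) β * braidSigma (m + 2) (m + 1)) β := by
  obtain ⟨w, rfl⟩ := BraidWord.toBraid_surjective _ β
  refine (sameClosure_mul_comm _ _).trans
    (sameClosure_of_words (w := w.stabilized) ?_ rfl w.sameLink_stabilized)
  refine (BraidWord.toBraid_append (n := m + 2) [(Fin.last m, true)]
    (w.incl (Nat.le_succ (m + 1)))).trans ?_
  rw [BraidWord.toBraid_incl, braidSigma, dif_pos (by omega)]
  rfl

/-! ### Words in elements that satisfy the braid relations -/

/-- The elements `x 1, …, x (n - 1)` satisfy the braid relations. -/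
structure IsBraidSequence {G : Type*} [Monoid G] (x : ℕ → G) (n : ℕ) : Prop where
  braid : ∀ i, 1 ≤ i → i + 1 < n → x i * x (i + 1) * x i = x (i + 1) * x i * x (i + 1)
  comm : ∀ i j, 1 ≤ i → i + 2 ≤ j → j < n → Commute (x i) (x j)

/-- `x 1 * x 2 * ⋯ * x k`. -/
def ascProd {G : Type*} [Monoid G] (x : ℕ → G) : ℕ → G
  | 0 => 1
  | k + 1 => ascProd x k * x (k + 1)

/-- The product of `l` factors `x m * x (m - 1) * ⋯`. -/
def descProd {G : Type*} [Monoid G] (x : ℕ → G) : ℕ → ℕ → G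
  | _, 0 => 1
  | m, l + 1 => x m * descProd x (m - 1) l

section

variable {G : Type*} [Monoid G] {x : ℕ → G} {n : ℕ}

theorem descProd_succ (m l : ℕ) : descProd x m (l + 1) = descProd x m l * x (m - l) := by
  induction l generalizing m with
  | zero => simp [descProd]
  | succ l ih =>
    rw [descProd, ih, descProd, mul_assoc, Nat.sub_sub, add_comm 1 l]

theorem ascProd_congr {y : ℕ → G} {k : ℕ} (h : ∀ i, 1 ≤ i → i ≤ k → x i = y i) :
    ascProd x k = ascProd y k := by
  induction k with
  | zero => rfl
  | succ k ih =>
    rw [ascProd, ascProd, ih fun i h1 h2 => h i h1 (by omega), h (k + 1) (by omega) le_rfl]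

theorem descProd_congr {y : ℕ → G} {m l : ℕ} (hl : l ≤ m) (h : ∀ i, 1 ≤ i → i ≤ m → x i = y i) :
    descProd x m l = descProd y m l := by
  induction l generalizing m with
  | zero => rfl
  | succ l ih =>
    rw [descProd, descProd, ih (by omega) fun i h1 h2 => h i h1 (by omega), h m (by omega) le_rfl]

theorem map_ascProd {H : Type*} [Monoid H] (f : G →* H) (k : ℕ) :
    f (ascProd x k) = ascProd (fun i => f (x i)) k := by
  induction k with
  | zero => exact map_one f
  | succ k ih => rw [ascProd, ascProd, map_mul, ih]

theorem map_descProd {H : Type*} [Monoid H] (f : G →* H) (m l : ℕ) :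
    f (descProd x m l) = descProd (fun i => f (x i)) m l := by
  induction l generalizing m with
  | zero => exact map_one f
  | succ l ih => rw [descProd, descProd, map_mul, ih]

namespace IsBraidSequence

theorem commute_ascProd (h : IsBraidSequence x n) {k j : ℕ} (hkj : k + 2 ≤ j) (hj : j < n) :
    Commute (x j) (ascProd x k) := by
  induction k with
  | zero => exact Commute.one_right _
  | succ k ih =>
    exact (ih (by omega)).mul_right (h.comm (k + 1) j (by omega) (by omega) hj).symm

theorem commute_descProd (h : IsBraidSequence x n) {m l j : ℕ} (hl : l ≤ m) (hmj : m + 2 ≤ j)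
    (hj : j < n) : Commute (x j) (descProd x m l) := by
  induction l generalizing m with
  | zero => exact Commute.one_right _
  | succ l ih =>
    exact (h.comm m j (by omega) hmj hj).symm.mul_right (ih (by omega) (by omega))

/-- All letters commute with `x i` except those near `i`, where one braid relation raises the index.
-/
theorem ascProd_mul (h : IsBraidSequence x n) {i k : ℕ} (hi : 1 ≤ i) (hik : i + 1 ≤ k)
    (hk : k < n) : SemiconjBy (ascProd x k) (x i) (x (i + 1)) := by
  induction k, hik using Nat.le_induction with
  | base =>
    obtain ⟨i, rfl⟩ : ∃ i', i = i' + 1 := ⟨i - 1, by omega⟩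
    have hc := h.commute_ascProd (k := i) (j := i + 1 + 1) (by omega) hk
    have hb := h.braid (i + 1) hi hk
    rw [SemiconjBy, ascProd, ascProd]
    calc _ = ascProd x i * (x (i + 1) * x (i + 1 + 1) * x (i + 1)) := by simp only [mul_assoc]
      _ = ascProd x i * x (i + 1 + 1) * (x (i + 1) * x (i + 1 + 1)) := by
        rw [hb]; simp only [mul_assoc]
      _ = _ := by rw [← hc.eq]; simp only [mul_assoc]
  | succ k hik ih =>
    rw [ascProd]
    exact SemiconjBy.mul_left (ih (by omega)) (h.comm i (k + 1) hi (by omega) hk).symm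

theorem descProd_mul (h : IsBraidSequence x n) {m l i : ℕ} (hl : l ≤ m) (hm : m < n)
    (hi : m < i + l) (him : i + 1 ≤ m) : SemiconjBy (descProd x m l) (x (i + 1)) (x i) := by
  induction l generalizing m with
  | zero => omega
  | succ l ih =>
    rw [descProd]
    rcases Nat.lt_or_ge (i + 1) m with hlt | hge
    · exact SemiconjBy.mul_left (h.comm i m (by omega) (by omega) hm).symm
        (ih (by omega) (by omega) (by omega) (by omega))
    · obtain rfl : m = i + 1 := by omega
      obtain ⟨l, rfl⟩ : ∃ l', l = l' + 1 := ⟨l - 1, by omega⟩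
      have hc := h.commute_descProd (m := i - 1) (l := l) (j := i + 1) (by omega) (by omega) hm
      have hb := h.braid i (by omega) hm
      rw [Nat.add_sub_cancel, SemiconjBy, descProd]
      calc _ = x (i + 1) * x i * (descProd x (i - 1) l * x (i + 1)) := by simp only [mul_assoc]
        _ = x (i + 1) * x i * x (i + 1) * descProd x (i - 1) l := by
          rw [← hc.eq]; simp only [mul_assoc]
        _ = _ := by rw [← hb]; simp only [mul_assoc]

/-- The last letter of the first factor moves right through the other factors, each lowering its
index by one. The first letter freed this way is `x (k + 1)`, the next `x k`, and so on. -/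
theorem ascProd_pow (h : IsBraidSequence x n) {k s : ℕ} (hs : s ≤ k + 1) (hk : k + 1 < n) :
    ascProd x (k + 1) ^ s = ascProd x k ^ s * descProd x (k + 1) s := by
  induction s with
  | zero => simp [descProd]
  | succ s ih =>
    have hsemi : ∀ t, t ≤ s → SemiconjBy (ascProd x (k + 1) ^ t) (x (k + 1 - t)) (x (k + 1)) := by
      intro t
      induction t with
      | zero => intro _; rw [pow_zero]; exact SemiconjBy.one_left _
      | succ t iht =>
        intro ht
        have h1 := h.ascProd_mul (i := k + 1 - (t + 1)) (k := k + 1) (by omega) (by omega) hk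
        rw [show k + 1 - (t + 1) + 1 = k + 1 - t by omega] at h1
        rw [pow_succ]
        exact SemiconjBy.mul_left (iht (by omega)) h1
    calc ascProd x (k + 1) ^ (s + 1)
        = ascProd x k * (x (k + 1) * ascProd x (k + 1) ^ s) := by
          rw [pow_succ', ascProd, mul_assoc]
      _ = ascProd x k * (ascProd x (k + 1) ^ s * x (k + 1 - s)) := by rw [(hsemi s le_rfl).eq]
      _ = _ := by rw [ih (by omega), descProd_succ, pow_succ']; simp only [mul_assoc]

theorem semiconjBy_descProd (h : IsBraidSequence x n) {m p l : ℕ} (hp : p + 1 ≤ m) (hm : m < n)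
    (hl : l ≤ p) :
    SemiconjBy (descProd x m (p + 1)) (descProd x m l) (descProd x (m - 1) l) := by
  induction l with
  | zero => exact SemiconjBy.one_right _
  | succ l ih =>
    rw [descProd_succ m l, descProd_succ (m - 1) l]
    refine (ih (by omega)).mul_right ?_
    have := h.descProd_mul (m := m) (l := p + 1) (i := m - 1 - l) hp hm (by omega) (by omega)
    rwa [show m - 1 - l + 1 = m - l by omega] at this

/-- Reversal exchanges ascending and descending products, so `ascProd_pow` also yields its mirror
image. -/
theorem op (h : IsBraidSequence x n) : IsBraidSequence (fun i => MulOpposite.op (x i)) n where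
  braid i h1 h2 := by
    have := h.braid i h1 h2
    simp only [← MulOpposite.op_mul, ← mul_assoc]
    rw [this]
  comm i j h1 h2 h3 := (h.comm i j h1 h2 h3).op

theorem ascProd_op (k : ℕ) :
    ascProd (fun i => MulOpposite.op (x i)) k = MulOpposite.op (descProd x k k) := by
  induction k with
  | zero => rfl
  | succ k ih => rw [ascProd, descProd, ih, MulOpposite.op_mul, Nat.add_sub_cancel]

theorem descProd_op (k : ℕ) :
    descProd (fun i => MulOpposite.op (x i)) k k = MulOpposite.op (ascProd x k) := by
  induction k with
  | zero => rfl
  | succ k ih => rw [ascProd, descProd, Nat.add_sub_cancel, ih, MulOpposite.op_mul]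

/-- The full twist, written with ascending or with descending factors. -/
theorem full_twist (h : IsBraidSequence x n) {k : ℕ} (hk : k < n) :
    ascProd x k ^ (k + 1) = descProd x k k ^ (k + 1) := by
  induction k with
  | zero => rfl
  | succ k ih =>
    have h1 : ascProd x (k + 1) ^ (k + 1 + 1) =
        ascProd x k ^ (k + 1) * (descProd x (k + 1) (k + 1) * ascProd x (k + 1)) := by
      rw [pow_succ, h.ascProd_pow le_rfl hk, mul_assoc]
    have h2 : descProd x (k + 1) (k + 1) ^ (k + 1 + 1) =
        descProd x (k + 1) (k + 1) * ascProd x (k + 1) * descProd x k k ^ (k + 1) := by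
      have h3 := h.op.ascProd_pow (k := k) (s := k + 1) le_rfl hk
      rw [ascProd_op, ascProd_op, descProd_op, ← MulOpposite.op_pow, ← MulOpposite.op_pow,
        ← MulOpposite.op_mul, MulOpposite.op_inj] at h3
      rw [pow_succ', h3, mul_assoc]
    -- The descending product lowers an index that the ascending one has raised, so their product
    -- commutes with `x 1, …, x k`: it is the last strand encircling all others.
    have h3 : ∀ l ≤ k, Commute (descProd x (k + 1) (k + 1) * ascProd x (k + 1)) (ascProd x l) := by
      intro l
      induction l with
      | zero => intro _; exact Commute.one_right _
      | succ l ihl =>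
        intro hl
        refine (ihl (by omega)).mul_right ?_
        exact SemiconjBy.mul_left
          (h.descProd_mul (i := l + 1) le_rfl hk (by omega) (by omega))
          (h.ascProd_mul (i := l + 1) (by omega) (by omega) hk)
    rw [h1, h2, ← ih (by omega), ((h3 k le_rfl).pow_right (k + 1)).eq]

end IsBraidSequence

end

/-! ### T-links -/

theorem isBraidSequence_braidSigma (n : ℕ) : IsBraidSequence (braidSigma n) n where
  braid i h1 h2 := by
    rw [braidSigma, braidSigma, dif_pos ⟨h1, by omega⟩, dif_pos ⟨by omega, h2⟩]
    have := PresentedGroup.one_of_mem (rels := braidRels n)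
      (Or.inr ⟨⟨i - 1, by omega⟩, ⟨i + 1 - 1, by omega⟩, by simp only []; omega, rfl⟩)
    rw [map_mul, map_inv, mul_inv_eq_one] at this
    simpa [PresentedGroup.of] using this
  comm i j h1 h2 h3 := by
    rw [braidSigma, braidSigma, dif_pos ⟨h1, by omega⟩, dif_pos ⟨by omega, h3⟩]
    have := PresentedGroup.one_of_mem (rels := braidRels n)
      (Or.inl ⟨⟨i - 1, by omega⟩, ⟨j - 1, by omega⟩, by simp only []; omega, rfl⟩)
    rw [map_mul, map_inv, mul_inv_eq_one] at this
    rw [commute_iff_eq]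
    simpa [PresentedGroup.of] using this

theorem braidBracket_one (n k : ℕ) : braidBracket n 1 (k + 1) = ascProd (braidSigma n) k := by
  rw [braidBracket, Nat.add_sub_cancel]
  induction k with
  | zero => rfl
  | succ k ih =>
    rw [List.range'_concat, List.map_append, List.prod_append, ih, ascProd]
    simp [add_comm]

theorem braidIncl_braidSigma {m n : ℕ} (h : m ≤ n) {i : ℕ} (h1 : 1 ≤ i) (hi : i < m) :
    braidIncl h (braidSigma m i) = braidSigma n i := by
  rw [braidSigma, braidSigma, dif_pos ⟨h1, hi⟩, dif_pos ⟨h1, by omega⟩]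
  exact PresentedGroup.toGroup.of _

theorem braidIncl_ascProd {m n : ℕ} (h : m ≤ n) {k : ℕ} (hk : k < m) :
    braidIncl h (ascProd (braidSigma m) k) = ascProd (braidSigma n) k := by
  rw [map_ascProd]
  exact ascProd_congr fun i h1 h2 => braidIncl_braidSigma h h1 (by omega)

theorem braidIncl_descProd {m n : ℕ} (h : m ≤ n) {k l : ℕ} (hl : l ≤ k) (hk : k < m) :
    braidIncl h (descProd (braidSigma m) k l) = descProd (braidSigma n) k l := by
  rw [map_descProd]
  exact descProd_congr hl fun i h1 h2 => braidIncl_braidSigma h h1 (by omega)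

theorem braidIncl_braidIncl {k m n : ℕ} (h : k ≤ m) (h' : m ≤ n) (β : BraidGroup k) :
    braidIncl h' (braidIncl h β) = braidIncl (h.trans h') β := by
  obtain ⟨w, rfl⟩ := BraidWord.toBraid_surjective k β
  rw [← BraidWord.toBraid_incl, ← BraidWord.toBraid_incl, ← BraidWord.toBraid_incl]
  congr 1
  simp [BraidWord.incl]

/-- Removing the last strands of `γ [1, p + j + 1] ^ (p + 1)` one after the other. -/
theorem sameClosure_destabilize {a p : ℕ} (γ : BraidGroup a) (h₀ : a ≤ p + 1) (j k : ℕ)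
    (h : a ≤ p + j + 1) :
    SameClosure
      (braidIncl h γ * ascProd (braidSigma (p + j + 1)) (p + j) ^ (p + 1) *
        descProd (braidSigma (p + j + 1)) (p + j) p ^ k)
      (braidIncl h₀ γ * ascProd (braidSigma (p + 1)) p ^ (p + 1) *
        descProd (braidSigma (p + 1)) p p ^ (k + j)) := by
  induction j generalizing k with
  | zero => exact SameClosure.refl _
  | succ j ih =>
    have hx := isBraidSequence_braidSigma (p + j + 2)
    have h' : a ≤ p + j + 1 := by omega
    obtain ⟨y, hy⟩ : ∃ y, y = descProd (braidSigma (p + j + 1)) (p + j) p := ⟨_, rfl⟩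
    obtain ⟨β, hβ⟩ : ∃ β, β = braidIncl h' γ * ascProd (braidSigma (p + j + 1)) (p + j) ^ (p + 1) *
      y ^ k := ⟨_, rfl⟩
    have hle : p + j + 1 ≤ p + j + 2 := Nat.le_succ _
    -- The collected powers pass to the left of the new descending product, dropping to lower
    -- indices. The top generator then occurs once, between braids on one strand fewer.
    have e1 : braidIncl h γ * ascProd (braidSigma (p + j + 2)) (p + j + 1) ^ (p + 1) *
        descProd (braidSigma (p + j + 2)) (p + j + 1) p ^ k =
        braidIncl hle β * braidSigma (p + j + 2) (p + j + 1) * braidIncl hle y := by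
      have hs : SemiconjBy (descProd (braidSigma (p + j + 2)) (p + j + 1) (p + 1))
          (descProd (braidSigma (p + j + 2)) (p + j + 1) p ^ k)
          (descProd (braidSigma (p + j + 2)) (p + j) p ^ k) :=
        (hx.semiconjBy_descProd (by omega) (by omega) le_rfl).pow_right k
      have hd : descProd (braidSigma (p + j + 2)) (p + j + 1) (p + 1) =
          braidSigma (p + j + 2) (p + j + 1) * descProd (braidSigma (p + j + 2)) (p + j) p := rfl
      rw [hβ, hy, map_mul, map_mul, map_pow, map_pow, braidIncl_ascProd hle (by omega),
        braidIncl_descProd hle (by omega) (by omega), braidIncl_braidIncl,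
        hx.ascProd_pow (k := p + j) (s := p + 1) (by omega) (by omega), mul_assoc, mul_assoc,
        hs.eq, hd]
      simp only [mul_assoc]
    have e2 : braidIncl hle y * (braidIncl hle β * braidSigma (p + j + 2) (p + j + 1)) =
        braidIncl hle (y * β) * braidSigma (p + j + 2) (p + j + 1) := by
      rw [map_mul, mul_assoc]
    have e3 : β * y = braidIncl h' γ * ascProd (braidSigma (p + j + 1)) (p + j) ^ (p + 1) *
        descProd (braidSigma (p + j + 1)) (p + j) p ^ (k + 1) := by
      rw [hβ, ← hy, pow_succ y k, mul_assoc, mul_assoc]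
    have s1 := sameClosure_mul_comm
      (braidIncl hle β * braidSigma (p + j + 2) (p + j + 1)) (braidIncl hle y)
    rw [← e1, e2] at s1
    -- With `y` conjugated to the front the top generator is last and can be removed; conjugating
    -- back adds `y` to the collected powers.
    have s2 := (sameClosure_stabilization (m := p + j) (y * β)).trans (sameClosure_mul_comm y β)
    rw [e3] at s2
    have s3 := ih (k + 1) h'
    rw [show k + 1 + j = k + (j + 1) by omega] at s3
    exact (s1.trans s2).trans s3

/-- Destabilizing `j = r - s` times leaves `j` descending products. Divisibility enters only to
regroup them into full twists, which can be rewritten with ascending products. -/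
theorem sameClosure_bracket_swap {a s r : ℕ} (has : a ≤ s) (hsr : s ≤ r) (hdvd : s ∣ r)
    (γ : BraidGroup a) :
    SameClosure (braidIncl (has.trans hsr) γ * braidBracket r 1 r ^ s)
      (braidIncl has γ * braidBracket s 1 s ^ r) := by
  rcases Nat.eq_zero_or_pos s with rfl | hs
  · obtain rfl := Nat.eq_zero_of_zero_dvd hdvd
    exact SameClosure.refl _
  obtain ⟨p, rfl⟩ : ∃ p, s = p + 1 := ⟨s - 1, by omega⟩
  obtain ⟨j, rfl⟩ : ∃ j, r = p + j + 1 := ⟨r - (p + 1), by omega⟩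
  obtain ⟨q, hq⟩ : p + 1 ∣ j := by
    have h1 : p + j + 1 = p + 1 + j := by omega
    rw [h1] at hdvd
    exact (Nat.dvd_add_right (dvd_refl _)).1 hdvd
  have h1 := sameClosure_destabilize γ has j 0 (has.trans hsr)
  rw [pow_zero, mul_one, zero_add] at h1
  rw [braidBracket_one, braidBracket_one]
  convert h1 using 1
  rw [show p + j + 1 = p + 1 + j by omega, pow_add, mul_assoc, hq, pow_mul, pow_mul (descProd _ _ _),
    (isBraidSequence_braidSigma (p + 1)).full_twist (Nat.lt_succ_self p)]

/-! ### Parameter lists of T-links. -/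

theorem sameClosure_tLinkBraid {p : List (ℕ × ℕ)} {n : ℕ} (h : tLinkStrands p = n) :
    SameClosure (tLinkBraid p) (p.map fun q => braidBracket n 1 q.1 ^ q.2).prod ∧
    SameClosure (p.map fun q => braidBracket n 1 q.1 ^ q.2).prod (tLinkBraid p) := by
  subst h
  exact ⟨SameClosure.refl _, SameClosure.refl _⟩

theorem tLinkStrands_append_singleton (p : List (ℕ × ℕ)) (r s : ℕ) :
    tLinkStrands (p ++ [(r, s)]) = r := by
  simp [tLinkStrands]

theorem IsTLinkParams.fst_le {p p' : List (ℕ × ℕ)} (h : IsTLinkParams (p ++ p')) {s : ℕ}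
    (hlast : ∀ q ∈ p.getLast?, q.1 ≤ s) : ∀ q ∈ p, 1 ≤ q.1 ∧ q.1 ≤ s := by
  obtain ⟨h1, h2⟩ := h
  intro q hq
  refine ⟨by have := (h2 q (List.mem_append_left _ hq)).1; omega, ?_⟩
  rw [List.map_append, List.pairwise_append] at h1
  rcases List.eq_nil_or_concat p with rfl | ⟨l, b, rfl⟩
  · simp at hq
  · have hb : b.1 ≤ s := hlast b (by simp)
    rw [List.concat_eq_append, List.mem_append, List.mem_singleton] at hq
    rcases hq with hq | rfl
    · have h3 := h1.1
      rw [List.concat_eq_append, List.map_append, List.pairwise_append] at h3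
      exact (h3.2.2 _ (List.mem_map_of_mem hq) b.1 (by simp)).trans hb
    · exact hb

theorem braidIncl_brackets {m n : ℕ} (h : m ≤ n) (p : List (ℕ × ℕ))
    (hp : ∀ q ∈ p, 1 ≤ q.1 ∧ q.1 ≤ m) :
    braidIncl h (p.map fun q => braidBracket m 1 q.1 ^ q.2).prod =
      (p.map fun q => braidBracket n 1 q.1 ^ q.2).prod := by
  rw [map_list_prod, List.map_map]
  congr 1
  refine List.map_congr_left fun q hq => ?_
  obtain ⟨h1, h2⟩ := hp q hq
  obtain ⟨k, hk⟩ : ∃ k, q.1 = k + 1 := ⟨q.1 - 1, by omega⟩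
  rw [Function.comp_apply, map_pow, hk, braidBracket_one, braidBracket_one,
    braidIncl_ascProd h (by omega)]

theorem mainTheorem10 :
    (∀ (a s r : ℕ) (has : a ≤ s) (hsr : s ≤ r), s ∣ r → ∀ γ : BraidGroup a,
      SameClosure (braidIncl (has.trans hsr) γ * braidBracket r 1 r ^ s)
        (braidIncl has γ * braidBracket s 1 s ^ r)) ∧
    (∀ (p : List (ℕ × ℕ)) (r s : ℕ), IsTLinkParams (p ++ [(r, s)]) →
      (∀ q ∈ p.getLast?, q.1 ≤ s) → s ≤ r → s ∣ r →
      SameTLink (p ++ [(r, s)]) (p ++ [(s, r)])) := by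
  refine ⟨fun a s r has hsr hdvd γ => sameClosure_bracket_swap has hsr hdvd γ,
    fun p r s hp hlast hsr hdvd => ?_⟩
  have hle := hp.fst_le hlast
  have h1 := (sameClosure_tLinkBraid (tLinkStrands_append_singleton p r s)).1
  have h2 := (sameClosure_tLinkBraid (tLinkStrands_append_singleton p s r)).2
  -- Here `a = s`: all earlier `r_i` are at most `s`, so the earlier factors already form a braid in
  -- `B_s`.
  have h3 := sameClosure_bracket_swap le_rfl hsr hdvd
    (p.map fun q => braidBracket s 1 q.1 ^ q.2).prod
  rw [braidIncl_brackets _ p hle, braidIncl_brackets _ p hle] at h3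
  rw [List.map_append, List.prod_append, List.map_singleton, List.prod_singleton] at h1 h2
  exact (h1.trans h3).trans h2
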